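/- Let $0<r_1<r_2$ and $t>0$. Let $M_t=R_t\cup S\subset\mathbb R^2$ be the mushroom billiard table, where $R_t=[-r_1,r_1]\times[-t,0]$ and $S$ is the closed upper semidisk of radius $r_2$ centred at the origin, and let $A(t)$ be the area of $M_t$. Let $\mathcal D_t\subset S^*M_t=M_t\times S^1$ be the domain of the billiard flow, that is, the set of phase points whose billiard trajectory is defined for all positive and negative times (it meets no corner, has no tangential collision and has only finitely many collisions in every bounded time interval). Let $U_t\subset\mathcal D_t$ be the set of phase points whose trajectory enters $R_t\cup\overline{B(0,r_1)}$; its complement $\mathcal D_t\setminus U_t$ consists of the trajectories that stay in the semi-annulus $S\setminus\overline{B(0,r_1)}$. Let $\mu_L$ be the (normalised) Liouville measure on $S^*M_t$, and for integers $n,k\ge 1$ let $\alpha_{n,k}$ be the $k$-th positive zero of the Bessel function $J_n$. For all $\epsilon>0$ and $\lambda>0$ the set of pairs $(n,k)$, $n,k\geq 1$, with $\alpha_{n,k}/r_2<\lambda$ and $\alpha_{n,k}<\frac{nr_2}{r_1+\epsilon}$ is finite, the limit below exists as a finite real number, and $$\lim_{\epsilon\to0^+}\ \liminf_{\lambda\to\infty}\frac{\#\left\{(n,k):\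 \alpha_{n,k}/r_2<\lambda,\ \alpha_{n,k}<\frac{nr_2}{r_1+\epsilon}\right\}}{\lambda^2}\ \ge\ \left(1-\frac{\mu_L(U_t)}{\mu_L(\mathcal D_t)}\right)\cdot\frac{A(t)}{4\pi}.$$ -/

import Mathlib

namespace Mushroom

/-! ### Bessel functions of the first kind and their zeros -/

/-- The Bessel function `J_n` of the first kind, of integer order `n ≥ 0`, on the real line. -/
noncomputable def besselJ (n : ℕ) (x : ℝ) : ℝ :=
  ∑' m : ℕ, (-1 : ℝ) ^ m / ((m.factorial : ℝ) * ((m + n).factorial : ℝ)) * (x / 2) ^ (2 * m + n)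

/-- For `k ≥ 1`, `besselZero n k` is the `k`-th positive zero `α_{n,k}` of `J_n`, in increasing
order. The value `0` at `k = 0` is only the start of the recursion. -/
noncomputable def besselZero (n : ℕ) : ℕ → ℝ
  | 0 => 0
  | k + 1 => sInf {x : ℝ | besselZero n k < x ∧ besselJ n x = 0}

/-- The index pairs `(n, k)` of the semidisk quasimodes with `α_{n,k} / r₂ < lam` and
`α_{n,k} < n r₂ / (r₁ + ε)`. -/
def quasimodeIndices (r₁ r₂ ε lam : ℝ) : Set (ℕ × ℕ) :=
  {p | 1 ≤ p.1 ∧ 1 ≤ p.2 ∧ besselZero p.1 p.2 / r₂ < lam ∧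
    besselZero p.1 p.2 < (p.1 : ℝ) * r₂ / (r₁ + ε)}

/-! ### The mushroom and its phase space -/

/-- The Euclidean plane. -/
abbrev Plane : Type := EuclideanSpace ℝ (Fin 2)

/-- The unit (co)directions. -/
abbrev Dir : Type := Metric.sphere (0 : Plane) 1

/-- The stalk `R_t = [-r₁, r₁] × [-t, 0]`. -/
def stalk (r₁ t : ℝ) : Set Plane :=
  {x | -r₁ ≤ x 0 ∧ x 0 ≤ r₁ ∧ -t ≤ x 1 ∧ x 1 ≤ 0}

/-- The closed upper semidisk of radius `r₂` centred at the origin. -/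
def cap (r₂ : ℝ) : Set Plane :=
  {x | ‖x‖ ≤ r₂ ∧ 0 ≤ x 1}

/-- The mushroom `M_t`, the union of the stalk and the semidisk. -/
def mushroom (r₁ r₂ t : ℝ) : Set Plane :=
  stalk r₁ t ∪ cap r₂

/-- The area of the mushroom. -/
noncomputable def area (r₁ r₂ t : ℝ) : ℝ :=
  (MeasureTheory.volume (mushroom r₁ r₂ t)).toReal

/-- `OuterNormal r₁ r₂ t p N`: the point `p` is a smooth boundary point of the mushroom (on the
boundary, and none of the six corners `(± r₂, 0)`, `(± r₁, 0)`, `(± r₁, -t)`), and `N` is the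
outward unit normal there. -/
inductive OuterNormal (r₁ r₂ t : ℝ) : Plane → Plane → Prop
  | arc (p : Plane) (hp : ‖p‖ = r₂) (hp' : 0 < p 1) : OuterNormal r₁ r₂ t p (r₂⁻¹ • p)
  | ledge (p : Plane) (hp : p 1 = 0) (h₁ : r₁ < |p 0|) (h₂ : |p 0| < r₂) :
      OuterNormal r₁ r₂ t p !₂[0, -1]
  | right (p : Plane) (hp : p 0 = r₁) (h₁ : -t < p 1) (h₂ : p 1 < 0) :
      OuterNormal r₁ r₂ t p !₂[1, 0]
  | left (p : Plane) (hp : p 0 = -r₁) (h₁ : -t < p 1) (h₂ : p 1 < 0) :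
      OuterNormal r₁ r₂ t p !₂[-1, 0]
  | bottom (p : Plane) (hp : p 1 = -t) (h₁ : |p 0| < r₁) :
      OuterNormal r₁ r₂ t p !₂[0, -1]

/-- A complete broken Hamiltonian trajectory, for the Hamiltonian `|ξ|²` on the unit cosphere
bundle of the mushroom, so `x' = 2 ξ`. Its position at time `s` is `x s`, its successive collision
times are `τ n` (`n ∈ ℤ`), and its direction between the times `τ n` and `τ (n + 1)` is `ω n`.
The collision times exhaust the time axis without accumulating; all collisions take place at smooth
boundary points, are not tangential, and obey the law of reflection; between collisions the
trajectory stays in the interior. -/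
structure IsTrajectory (r₁ r₂ t : ℝ) (x : ℝ → Plane) (τ : ℤ → ℝ) (ω : ℤ → Dir) : Prop where
  strictMono : StrictMono τ
  tendsto_top : Filter.Tendsto τ Filter.atTop Filter.atTop
  tendsto_bot : Filter.Tendsto τ Filter.atBot Filter.atBot
  free : ∀ n : ℤ, ∀ s ∈ Set.Icc (τ n) (τ (n + 1)),
    x s = x (τ n) + (2 * (s - τ n)) • (ω n : Plane)
  interior : ∀ n : ℤ, ∀ s ∈ Set.Ioo (τ n) (τ (n + 1)), x s ∈ interior (mushroom r₁ r₂ t)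
  reflect : ∀ n : ℤ, ∃ N : Plane, OuterNormal r₁ r₂ t (x (τ (n + 1))) N ∧
    0 < inner ℝ (ω n : Plane) N ∧
    (ω (n + 1) : Plane) = (ω n : Plane) - (2 * inner ℝ (ω n : Plane) N) • N

/-- The phase point `z` is the state at time `0` of the trajectory `(x, τ, ω)`. (If time `0` is a
collision time, both the incoming and the outgoing direction are admitted.) -/
def StartsAt (x : ℝ → Plane) (τ : ℤ → ℝ) (ω : ℤ → Dir) (z : Plane × Dir) : Prop :=
  x 0 = z.1 ∧ ∃ n : ℤ, 0 ∈ Set.Icc (τ n) (τ (n + 1)) ∧ ω n = z.2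

/-- The domain `𝒟_t` of the billiard flow: the phase points whose billiard trajectory is defined
for all times, positive and negative. -/
def flowDomain (r₁ r₂ t : ℝ) : Set (Plane × Dir) :=
  {z | ∃ (x : ℝ → Plane) (τ : ℤ → ℝ) (ω : ℤ → Dir),
    IsTrajectory r₁ r₂ t x τ ω ∧ StartsAt x τ ω z}

/-- The ergodic region `U_t`: the phase points of `𝒟_t` whose trajectory enters
`R_t ∪ closedBall 0 r₁`. Its complement in `𝒟_t` consists of the trajectories that lie entirely in
the semi-annulus `S \ closedBall 0 r₁`. -/
def ergodicRegion (r₁ r₂ t : ℝ) : Set (Plane × Dir) :=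
  {z | ∃ (x : ℝ → Plane) (τ : ℤ → ℝ) (ω : ℤ → Dir),
    IsTrajectory r₁ r₂ t x τ ω ∧ StartsAt x τ ω z ∧
      ∃ s : ℝ, x s ∈ stalk r₁ t ∪ Metric.closedBall 0 r₁}

/-- The Liouville measure on the unit cosphere bundle `M_t × S¹` of the mushroom: the product of
Lebesgue measure on `M_t` and arc length on `S¹`, normalised to total mass one. -/
noncomputable def liouville (r₁ r₂ t : ℝ) : MeasureTheory.Measure (Plane × Dir) :=
  ProbabilityTheory.cond
    ((MeasureTheory.volume : MeasureTheory.Measure Plane).prod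
      (MeasureTheory.volume : MeasureTheory.Measure Plane).toSphere)
    (mushroom r₁ r₂ t ×ˢ Set.univ)

end Mushroom

/-!
# Quasimodes of the semidisk in a mushroom billiard

With `c = r₁ / r₂` and `I(c) = ∫ v in c..1, √(1 - v²)` (`capIntegral`), the lower density of the
quasimodes is at least `r₂² I(c) / (2π)`, while the phase-space side of the inequality is at most
that number.

*Counting.* `u = √x J_n` solves `u'' = -q u` with `q = 1 - (n² - 1/4) / x²`. Sturm comparison gives a
zero of `J_n` in every interval of length `π / κ` on which `q ≥ κ²`, and, since `q < 1`, a gap of at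
least `1` between zeros. As `q` is increasing, a grid of mesh about `√X` shows that `J_n` has at
least `π⁻¹ ∫ x in n..X, √(1 - n²/x²) - 2 √X` zeros up to `X` (`exists_index_le`). The error is uniform
in `n`; after summation over `n`, the sum and the integral are exchanged, and for each `x` the sum
over `n ≥ c x` is at least `x I(c) - 1`. This gives `ncard_quasimodeIndices_ge`. The bounds
`n ≤ α_{n,k}` and `k ≤ α_{n,k}` give finiteness, and boundedness of the density, which is monotone
in `ε`; hence the limit exists (`exists_tendsto_quasimodeDensity`).

*Phase space.* The radial velocity of a trajectory that avoids the stalk and the disk of radius `r₁`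
grows at a constant rate, is preserved at the ledges, and changes sign from positive to negative at
the arc. If the angular momentum were less than `r₁`, it could never vanish, and would have to be
unbounded in the past or in the future (`le_abs_cross_of_avoids`). So `𝒟_t \ U_t` lies in the set of
angular momentum at least `r₁`, whose measure is computed by Fubini and a rotation
(`phaseMeasure_annularRegion_le`).

The quotient by `μ_L(𝒟_t)` requires that the flow is defined almost everywhere
(`liouville_flowDomain`). Trajectories are unfolded into parametrised lines of arbitrary speed. The
bounce maps on lines have differentiable inverses, so they pull null sets back to null sets, and
the set of lines that reach a corner, or become parallel to an axis, after finitely many bounces is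
null (`negligible_exceptionalLines`). For the other lines there is always a next, transversal
collision (`exists_next_collision`), and the collision times do not accumulate
(`IsOrbit.tendsto_atTop`): repeated collisions with the arc are separated by a time determined by a
conserved quantity, and only finitely many collisions with straight walls can follow one another
in a short time.
-/

namespace Mushroom

open Filter Topology Set MeasureTheory

/-! ### Bessel functions: recurrences and the differential equation -/

/-- The entire function `φ_n(z) = ∑ (-z)^m / (m! (m+n)!)`, so that
`J_n(x) = (x/2)^n φ_n(x²/4)`. -/
noncomputable def besselCore (n : ℕ) (z : ℝ) : ℝ :=
  ∑' m : ℕ, (-1 : ℝ) ^ m / ((m.factorial : ℝ) * ((m + n).factorial : ℝ)) * z ^ m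

/-- The Taylor coefficients of `besselCore n`. -/
noncomputable def coreCoeff (n m : ℕ) : ℝ :=
  (-1 : ℝ) ^ m / ((m.factorial : ℝ) * ((m + n).factorial : ℝ))

lemma abs_coreCoeff_le (n m : ℕ) : |coreCoeff n m| ≤ 1 / (m.factorial : ℝ) := by
  unfold coreCoeff
  rw [abs_div, abs_pow, abs_neg, abs_one, one_pow, abs_of_pos (by positivity)]
  have h1 : (1 : ℝ) ≤ ((m + n).factorial : ℝ) := by exact_mod_cast Nat.succ_le_of_lt (Nat.factorial_pos _)
  have h2 : (0 : ℝ) < (m.factorial : ℝ) := by positivity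
  exact one_div_le_one_div_of_le h2 (le_mul_of_one_le_right h2.le h1)

lemma summable_coreCoeff (n : ℕ) (z : ℝ) : Summable fun m => coreCoeff n m * z ^ m := by
  refine Summable.of_norm_bounded (Real.summable_pow_div_factorial |z|) fun m => ?_
  rw [norm_mul, norm_pow, Real.norm_eq_abs, Real.norm_eq_abs]
  have := abs_coreCoeff_le n m
  calc |coreCoeff n m| * |z| ^ m ≤ 1 / (m.factorial : ℝ) * |z| ^ m := by gcongr
    _ = _ := by ring

lemma coreCoeff_succ (n m : ℕ) : coreCoeff n (m + 1) * ((m : ℝ) + 1) = -coreCoeff (n + 1) m := by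
  unfold coreCoeff
  have e : m + 1 + n = m + (n + 1) := by ring
  rw [e, Nat.factorial_succ m, pow_succ]
  push_cast
  have h2 : (0 : ℝ) < (m.factorial : ℝ) := by positivity
  have h3 : (0 : ℝ) < ((m + (n + 1)).factorial : ℝ) := by positivity
  field_simp

lemma hasDerivAt_besselCore (n : ℕ) (z : ℝ) :
    HasDerivAt (besselCore n) (-besselCore (n + 1) z) z := by
  set R : ℝ := |z| + 1 with hR
  have hR0 : 0 < R := by positivity
  have hu : Summable fun m : ℕ => R ^ (m - 1) / ((m - 1).factorial : ℝ) := by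
    rw [← summable_nat_add_iff 1]
    simpa using Real.summable_pow_div_factorial R
  have key := hasDerivAt_tsum_of_isPreconnected (𝕜 := ℝ)
    (g := fun m y => coreCoeff n m * y ^ m)
    (g' := fun m y => coreCoeff n m * ((m : ℝ) * y ^ (m - 1))) (t := Metric.ball (0 : ℝ) R)
    (y₀ := 0) (y := z) hu Metric.isOpen_ball (convex_ball 0 R).isPreconnected
    (fun m y _ => (hasDerivAt_pow m y).const_mul _) ?_ (Metric.mem_ball_self hR0)
    (summable_coreCoeff n 0) (by simp [hR])
  · have e : (∑' m : ℕ, coreCoeff n m * ((m : ℝ) * z ^ (m - 1))) = -besselCore (n + 1) z := by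
      have hs : Summable fun m : ℕ => coreCoeff n m * ((m : ℝ) * z ^ (m - 1)) := by
        rw [← summable_nat_add_iff 1]
        refine (summable_coreCoeff (n + 1) z).neg.congr fun m => ?_
        have := coreCoeff_succ n m
        simp only [Nat.cast_add, Nat.cast_one, Nat.add_sub_cancel]
        rw [← mul_assoc, this]; ring
      rw [hs.tsum_eq_zero_add]
      simp only [Nat.cast_zero, zero_mul, mul_zero, zero_add, besselCore]
      rw [← tsum_neg]
      refine tsum_congr fun m => ?_
      have := coreCoeff_succ n m
      simp only [Nat.cast_add, Nat.cast_one, Nat.add_sub_cancel]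
      rw [← mul_assoc, this]
      simp [coreCoeff]
    rw [e] at key
    exact key
  · intro m y hy
    rw [Metric.mem_ball, dist_zero_right, Real.norm_eq_abs] at hy
    rcases m with _ | m
    · simp
    · rw [Nat.add_sub_cancel, ← mul_assoc]
      push_cast
      rw [coreCoeff_succ, norm_mul, norm_neg, norm_pow, Real.norm_eq_abs, Real.norm_eq_abs]
      have := abs_coreCoeff_le (n + 1) m
      calc |coreCoeff (n + 1) m| * |y| ^ m ≤ 1 / (m.factorial : ℝ) * R ^ m := by gcongr
        _ = _ := by ring

lemma besselCore_recurrence (n : ℕ) (z : ℝ) :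
    besselCore n z = (n + 1) * besselCore (n + 1) z - z * besselCore (n + 2) z := by
  have h0 := summable_coreCoeff n z
  have h1 := (summable_coreCoeff (n + 1) z).mul_left ((n : ℝ) + 1)
  have h2 := (summable_coreCoeff (n + 2) z).mul_left z
  have e0 : besselCore n z = ∑' m, coreCoeff n m * z ^ m := rfl
  have e1 : besselCore (n + 1) z = ∑' m, coreCoeff (n + 1) m * z ^ m := rfl
  have e2 : besselCore (n + 2) z = ∑' m, coreCoeff (n + 2) m * z ^ m := rfl
  rw [e0, e1, e2, ← tsum_mul_left, ← tsum_mul_left, h0.tsum_eq_zero_add, h1.tsum_eq_zero_add]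
  have h1' := (summable_nat_add_iff 1).2 h1
  rw [add_sub_assoc, ← h1'.tsum_sub h2]
  congr 1
  · unfold coreCoeff
    simp only [pow_zero, Nat.factorial_zero, Nat.cast_one, zero_add, one_mul, mul_one,
      Nat.factorial_succ n]
    push_cast
    field_simp
  · refine tsum_congr fun m => ?_
    unfold coreCoeff
    have e : m + 1 + (n + 1) = (m + 1 + n) + 1 := by ring
    have e' : m + (n + 2) = (m + 1 + n) + 1 := by ring
    rw [e, e', Nat.factorial_succ (m + 1 + n), Nat.factorial_succ m]
    push_cast
    have h2 : (0 : ℝ) < (m.factorial : ℝ) := by positivity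
    have h3 : (0 : ℝ) < ((m + 1 + n).factorial : ℝ) := by positivity
    field_simp
    ring

lemma besselCore_zero_pos (n : ℕ) : 0 < besselCore n 0 := by
  have : besselCore n 0 = 1 / (n.factorial : ℝ) := by
    unfold besselCore
    rw [tsum_eq_single 0]
    · simp
    · intro m hm; simp [hm]
  rw [this]; positivity

lemma besselJ_eq (n : ℕ) (x : ℝ) : besselJ n x = (x / 2) ^ n * besselCore n ((x / 2) ^ 2) := by
  unfold besselJ besselCore
  rw [← tsum_mul_left]
  refine tsum_congr fun m => ?_
  rw [pow_add, pow_mul]; ring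

lemma analyticOnNhd_besselJ (n : ℕ) : AnalyticOnNhd ℝ (besselJ n) univ := by
  have hcore : AnalyticOnNhd ℝ (besselCore n) univ := by
    have hr : (FormalMultilinearSeries.ofScalars ℝ (coreCoeff n)).radius = ⊤ := by
      refine FormalMultilinearSeries.radius_eq_top_of_summable_norm _ fun r => ?_
      refine (summable_coreCoeff n r).norm.congr fun m => ?_
      rw [FormalMultilinearSeries.ofScalars_norm, norm_mul, norm_pow]
      simp
    have h := (FormalMultilinearSeries.ofScalars ℝ (coreCoeff n)).hasFPowerSeriesOnBall
      (by rw [hr]; simp)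
    have hs : (FormalMultilinearSeries.ofScalars ℝ (coreCoeff n)).sum = besselCore n := by
      funext x
      change FormalMultilinearSeries.ofScalarsSum (coreCoeff n) x = _
      rw [FormalMultilinearSeries.ofScalarsSum_eq_tsum]
      simp [besselCore, coreCoeff]
    rw [hs, hr] at h
    intro x _
    exact h.analyticAt_of_mem (by simp)
  have : besselJ n = fun x => (x / 2) ^ n * besselCore n ((x / 2) ^ 2) := funext (besselJ_eq n)
  rw [this]
  intro x _
  have hx : AnalyticAt ℝ (fun x : ℝ => x / 2) x := by fun_prop
  exact (hx.pow n).mul ((hcore _ (mem_univ _)).comp (hx.pow 2))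

lemma continuous_besselJ (n : ℕ) : Continuous (besselJ n) :=
  continuousOn_univ.1 (analyticOnNhd_besselJ n).continuousOn

lemma besselJ_recurrence (n : ℕ) {x : ℝ} (hx : x ≠ 0) :
    besselJ (n + 2) x = 2 * (n + 1) / x * besselJ (n + 1) x - besselJ n x := by
  rw [besselJ_eq, besselJ_eq, besselJ_eq, besselCore_recurrence n]
  field_simp
  ring

lemma hasDerivAt_besselJ (n : ℕ) {x : ℝ} (hx : x ≠ 0) :
    HasDerivAt (besselJ n) (n / x * besselJ n x - besselJ (n + 1) x) x := by
  have e : besselJ n = fun x => (x / 2) ^ n * besselCore n ((x / 2) ^ 2) := funext (besselJ_eq n)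
  have h1 : HasDerivAt (fun x : ℝ => x / 2) (1 / 2) x := (hasDerivAt_id x).div_const 2
  have h2 := (h1.pow n).mul ((hasDerivAt_besselCore n ((x / 2) ^ 2)).comp x (h1.pow 2))
  rw [besselJ_eq n x, besselJ_eq (n + 1) x, e]
  refine h2.congr_deriv ?_
  simp only [Pi.pow_apply, Function.comp]
  rcases n with _ | n
  · simp; ring
  · rw [Nat.add_sub_cancel]
    push_cast
    field_simp
    ring

/-- Second half of the first-order system satisfied by `(J_n, J_{n+1})`. -/
lemma hasDerivAt_besselJ_succ (n : ℕ) {x : ℝ} (hx : x ≠ 0) :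
    HasDerivAt (besselJ (n + 1)) (besselJ n x - (n + 1) / x * besselJ (n + 1) x) x := by
  refine (hasDerivAt_besselJ (n + 1) hx).congr_deriv ?_
  rw [besselJ_recurrence n hx]
  push_cast
  ring

/-- `(x J_n')' = (n²/x - x) J_n`, with `x J_n' = n J_n - x J_{n+1}`. -/
lemma hasDerivAt_mul_deriv_besselJ (n : ℕ) {x : ℝ} (hx : x ≠ 0) :
    HasDerivAt (fun x => n * besselJ n x - x * besselJ (n + 1) x)
      ((n ^ 2 / x - x) * besselJ n x) x := by
  have h := ((hasDerivAt_besselJ n hx).const_mul (n : ℝ)).sub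
    ((hasDerivAt_id x).mul (hasDerivAt_besselJ_succ n hx))
  refine h.congr_deriv ?_
  simp only [id]
  field_simp
  ring

/-- The Liouville normal form `√x J_n(x)`, which satisfies an equation without first-order term. -/
noncomputable def besselU (n : ℕ) (x : ℝ) : ℝ := √x * besselJ n x

/-- The derivative of `besselU n` on the positive axis. -/
noncomputable def besselU' (n : ℕ) (x : ℝ) : ℝ :=
  besselJ n x / (2 * √x) + √x * (n / x * besselJ n x - besselJ (n + 1) x)

/-- The potential in `u'' = -q u` for `u = √x J_n`. -/
noncomputable def besselQ (n : ℕ) (x : ℝ) : ℝ := 1 - ((n : ℝ) ^ 2 - 1 / 4) / x ^ 2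

lemma hasDerivAt_besselU (n : ℕ) {x : ℝ} (hx : 0 < x) :
    HasDerivAt (besselU n) (besselU' n x) x := by
  refine ((Real.hasDerivAt_sqrt hx.ne').mul (hasDerivAt_besselJ n hx.ne')).congr_deriv ?_
  unfold besselU'
  ring

lemma hasDerivAt_besselU' (n : ℕ) {x : ℝ} (hx : 0 < x) :
    HasDerivAt (besselU' n) (-(besselQ n x * besselU n x)) x := by
  have hs := Real.hasDerivAt_sqrt hx.ne'
  have hx' := hx.ne'
  have hsp : √x ≠ 0 := (Real.sqrt_pos.2 hx).ne'
  have hJ := hasDerivAt_besselJ n hx'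
  have h1 := hJ.div (hs.const_mul 2) (mul_ne_zero two_ne_zero hsp)
  have h2 := hs.mul (((((hasDerivAt_id x).inv hx').const_mul (n : ℝ)).mul hJ).sub
    (hasDerivAt_besselJ_succ n hx'))
  refine ((h1.add h2).congr_of_eventuallyEq (f₁ := besselU' n) ?_).congr_deriv ?_
  · refine Eventually.of_forall fun y => ?_
    simp [besselU', div_eq_mul_inv]
  · unfold besselQ besselU
    have e : x = √x * √x := (Real.mul_self_sqrt hx.le).symm
    simp only [Pi.mul_apply, Pi.sub_apply, Pi.inv_apply, id]
    generalize besselJ n x = a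
    generalize besselJ (n + 1) x = b
    generalize √x = s at *
    subst e
    field_simp
    ring

/-! ### Sturm comparison -/

/-- If `u'' = -q u` with `q ≥ κ²`, then `u` vanishes in every half-open interval of length
`π / κ`. -/
lemma sturm_exists_zero {u u' q : ℝ → ℝ} {a κ : ℝ} (hκ : 0 < κ)
    (hu : ∀ x ∈ Icc a (a + Real.pi / κ), HasDerivAt u (u' x) x)
    (hu' : ∀ x ∈ Icc a (a + Real.pi / κ), HasDerivAt u' (-(q x * u x)) x)
    (hq : ∀ x ∈ Icc a (a + Real.pi / κ), κ ^ 2 ≤ q x) :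
    ∃ x ∈ Ioc a (a + Real.pi / κ), u x = 0 := by
  have hl : 0 < Real.pi / κ := by positivity
  -- the case of a positive solution, from the Wronskian with `sin (κ (x - a))`
  have pos : ∀ {u u' : ℝ → ℝ}, (∀ x ∈ Icc a (a + Real.pi / κ), HasDerivAt u (u' x) x) →
      (∀ x ∈ Icc a (a + Real.pi / κ), HasDerivAt u' (-(q x * u x)) x) →
      (∀ x ∈ Ioc a (a + Real.pi / κ), 0 < u x) → False := by
    intro u u' hu hu' hpos
    set b := a + Real.pi / κ with hb
    have hab : a < b := by linarith
    have hW : ∀ x ∈ Icc a b, HasDerivAt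
        (fun x => u' x * Real.sin (κ * (x - a)) - u x * (κ * Real.cos (κ * (x - a))))
        ((κ ^ 2 - q x) * u x * Real.sin (κ * (x - a))) x := by
      intro x hx
      have h0 : HasDerivAt (fun x => κ * (x - a)) κ x := by
        simpa using ((hasDerivAt_id x).sub_const a).const_mul κ
      refine (((hu' x hx).mul h0.sin).sub ((hu x hx).mul (h0.cos.const_mul κ))).congr_deriv ?_
      ring
    have hanti : AntitoneOn
        (fun x => u' x * Real.sin (κ * (x - a)) - u x * (κ * Real.cos (κ * (x - a))))
        (Icc a b) := by
      refine antitoneOn_of_deriv_nonpos (convex_Icc a b)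
        (fun x hx => (hW x hx).continuousAt.continuousWithinAt)
        (fun x hx => (hW x (interior_subset hx)).differentiableAt.differentiableWithinAt) ?_
      intro x hx
      rw [interior_Icc] at hx
      rw [(hW x (Ioo_subset_Icc_self hx)).deriv]
      have h1 := hpos x ⟨hx.1, hx.2.le⟩
      have h2 := hq x (Ioo_subset_Icc_self hx)
      have h3 : 0 ≤ Real.sin (κ * (x - a)) := by
        refine Real.sin_nonneg_of_nonneg_of_le_pi (mul_nonneg hκ.le (by linarith [hx.1])) ?_
        have : x - a ≤ Real.pi / κ := by linarith [hx.2]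
        rwa [le_div_iff₀ hκ, mul_comm] at this
      exact mul_nonpos_of_nonpos_of_nonneg
        (mul_nonpos_of_nonpos_of_nonneg (by linarith) h1.le) h3
    have h := hanti (left_mem_Icc.2 hab.le) (right_mem_Icc.2 hab.le) hab.le
    have e : κ * (b - a) = Real.pi := by rw [hb]; field_simp; ring
    simp only [e, Real.sin_pi, Real.cos_pi, sub_self, mul_zero, Real.sin_zero, Real.cos_zero] at h
    have hb' := hpos b (right_mem_Ioc.2 hab)
    have ha' : 0 ≤ u a := by
      have : Tendsto u (𝓝[>] a) (𝓝 (u a)) :=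
        ((hu a (left_mem_Icc.2 hab.le)).continuousAt.tendsto).mono_left nhdsWithin_le_nhds
      refine ge_of_tendsto this ?_
      filter_upwards [Ioc_mem_nhdsGT hab] with x hx using (hpos x hx).le
    nlinarith [mul_pos hκ hb', mul_nonneg hκ.le ha']
  by_contra! hne
  have hcont : ContinuousOn u (Ioc a (a + Real.pi / κ)) := fun x hx =>
    (hu x (Ioc_subset_Icc_self hx)).continuousAt.continuousWithinAt
  have hbm : a + Real.pi / κ ∈ Ioc a (a + Real.pi / κ) := ⟨by linarith, le_rfl⟩
  -- a solution without zeros has constant sign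
  have sign : ∀ {v : ℝ → ℝ}, ContinuousOn v (Ioc a (a + Real.pi / κ)) →
      (∀ x ∈ Ioc a (a + Real.pi / κ), v x ≠ 0) → 0 < v (a + Real.pi / κ) →
      ∀ x ∈ Ioc a (a + Real.pi / κ), 0 < v x := by
    intro v hv hv0 hvb x hx
    by_contra! hneg
    obtain ⟨y, hy, hy0⟩ := isPreconnected_Ioc.intermediate_value hx hbm hv ⟨hneg, hvb.le⟩
    exact hv0 y hy hy0
  rcases lt_or_gt_of_ne (hne _ hbm) with h | h
  · refine pos (u := fun x => -u x) (u' := fun x => -u' x) (fun x hx => (hu x hx).neg)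
      (fun x hx => ?_) (sign hcont.neg (fun x hx => neg_ne_zero.2 (hne x hx)) (by simpa using h))
    exact (hu' x hx).neg.congr_deriv (by ring)
  · exact pos hu hu' (sign hcont hne h)

/-- If `u'' = -q u` with `q < 1`, two zeros enclosing an interval where `u > 0` are at distance
at least `π`. -/
lemma sturm_gap {u u' q : ℝ → ℝ} {a b : ℝ} (hab : a < b)
    (hu : ∀ x ∈ Icc a b, HasDerivAt u (u' x) x)
    (hu' : ∀ x ∈ Icc a b, HasDerivAt u' (-(q x * u x)) x)
    (hq : ∀ x ∈ Icc a b, q x < 1) (ha : u a = 0) (hb : u b = 0)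
    (hpos : ∀ x ∈ Ioo a b, 0 < u x) : Real.pi ≤ b - a := by
  by_contra! hlt
  have hW : ∀ x ∈ Icc a b, HasDerivAt
      (fun x => u' x * Real.sin (x - a) - u x * Real.cos (x - a))
      ((1 - q x) * u x * Real.sin (x - a)) x := by
    intro x hx
    have h0 : HasDerivAt (fun x => x - a) 1 x := (hasDerivAt_id x).sub_const a
    refine (((hu' x hx).mul h0.sin).sub ((hu x hx).mul h0.cos)).congr_deriv ?_
    ring
  have hmono : StrictMonoOn
      (fun x => u' x * Real.sin (x - a) - u x * Real.cos (x - a)) (Icc a b) := by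
    refine strictMonoOn_of_deriv_pos (convex_Icc a b)
      (fun x hx => (hW x hx).continuousAt.continuousWithinAt) ?_
    intro x hx
    rw [interior_Icc] at hx
    rw [(hW x (Ioo_subset_Icc_self hx)).deriv]
    have h3 : 0 < Real.sin (x - a) :=
      Real.sin_pos_of_pos_of_lt_pi (by linarith [hx.1]) (by linarith [hx.2])
    have h2 := hq x (Ioo_subset_Icc_self hx)
    exact mul_pos (mul_pos (by linarith) (hpos x hx)) h3
  have h := hmono (left_mem_Icc.2 hab.le) (right_mem_Icc.2 hab.le) hab
  simp only [sub_self, Real.sin_zero, mul_zero, ha, hb, zero_mul, sub_zero] at h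
  have hsin : 0 < Real.sin (b - a) :=
    Real.sin_pos_of_pos_of_lt_pi (by linarith) hlt
  have hneg : u' b ≤ 0 := by
    have hd : HasDerivWithinAt u (u' b) (Iio b) b :=
      (hu b (right_mem_Icc.2 hab.le)).hasDerivWithinAt
    rw [hasDerivWithinAt_iff_tendsto_slope' (by simp)] at hd
    refine le_of_tendsto hd ?_
    filter_upwards [Ioo_mem_nhdsLT hab] with x hx
    rw [slope_def_field, hb]
    exact div_nonpos_of_nonneg_of_nonpos (by linarith [hpos x hx]) (by linarith [hx.2])
      |>.trans le_rfl
  nlinarith [mul_nonneg (neg_nonneg.2 hneg) hsin.le]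

/-! ### Positive zeros of Bessel functions -/

lemma besselJ_pos_near_zero (n : ℕ) : ∃ δ > 0, ∀ x ∈ Ioo 0 δ, 0 < besselJ n x := by
  have hc : ContinuousAt (fun x : ℝ => besselCore n ((x / 2) ^ 2)) 0 := by
    have h1 : ContinuousAt (besselCore n) ((0 / 2 : ℝ) ^ 2) :=
      (hasDerivAt_besselCore n _).continuousAt
    exact ContinuousAt.comp (f := fun x : ℝ => (x / 2) ^ 2) h1 (by fun_prop)
  have h0 : 0 < besselCore n (((0 : ℝ) / 2) ^ 2) := by simpa using besselCore_zero_pos n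
  obtain ⟨δ, hδ, h⟩ := Metric.eventually_nhds_iff.1 (hc.eventually (lt_mem_nhds h0))
  refine ⟨δ, hδ, fun x hx => ?_⟩
  rw [besselJ_eq]
  have : dist x 0 < δ := by rw [Real.dist_eq, sub_zero, abs_of_pos hx.1]; exact hx.2
  have hx0 := hx.1
  exact mul_pos (by positivity) (h this)

lemma besselJ_eventually_ne (n : ℕ) (a : ℝ) : ∀ᶠ x in 𝓝[≠] a, besselJ n x ≠ 0 := by
  rcases (analyticOnNhd_besselJ n a (mem_univ a)).eventually_eq_zero_or_eventually_ne_zero with h | h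
  · exfalso
    have := (analyticOnNhd_besselJ n).eqOn_zero_of_preconnected_of_eventuallyEq_zero
      isPreconnected_univ (mem_univ a) h
    obtain ⟨δ, hδ, hp⟩ := besselJ_pos_near_zero n
    have h1 := hp (δ / 2) ⟨by linarith, by linarith⟩
    have h2 := this (mem_univ (δ / 2))
    simp only [Pi.zero_apply] at h2
    linarith
  · exact h

/-- To the right of any `a`, a zero of `J_n` is preceded by a first one. -/
lemma exists_first_zero (n : ℕ) {a b : ℝ} (hab : a < b) (hb : besselJ n b = 0) :
    ∃ z ∈ Ioc a b, besselJ n z = 0 ∧ ∀ x ∈ Ioo a z, besselJ n x ≠ 0 := by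
  have h1 : ∀ᶠ x in 𝓝[>] a, besselJ n x ≠ 0 :=
    (besselJ_eventually_ne n a).filter_mono (nhdsWithin_mono a fun x hx => ne_of_gt hx)
  obtain ⟨c, hc, hcn⟩ := mem_nhdsGT_iff_exists_Ioo_subset.1 h1
  set S := Icc c b ∩ besselJ n ⁻¹' {0} with hS
  have hcb : c ≤ b := by
    by_contra! hlt
    exact hcn ⟨hab, hlt⟩ hb
  have hcomp : IsCompact S :=
    isCompact_Icc.inter_right (isClosed_singleton.preimage (continuous_besselJ n))
  obtain ⟨z, hz, hzmin⟩ := hcomp.exists_isLeast ⟨b, ⟨hcb, le_rfl⟩, hb⟩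
  have hc' : a < c := hc
  refine ⟨z, ⟨by linarith [hz.1.1], hz.1.2⟩, hz.2, fun x hx h0 => ?_⟩
  rcases lt_or_ge x c with hxc | hxc
  · exact hcn ⟨hx.1, hxc⟩ h0
  · have := hzmin ⟨⟨hxc, by linarith [hx.2, hz.1.2]⟩, h0⟩
    linarith [hx.2]

lemma le_of_besselJ_eq_zero (n : ℕ) {b : ℝ} (hb : 0 < b) (h0 : besselJ n b = 0) :
    (n : ℝ) ≤ b := by
  by_contra! hlt
  obtain ⟨z, hz, hz0, hne⟩ := exists_first_zero n hb h0
  obtain ⟨δ, hδ, hp⟩ := besselJ_pos_near_zero n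
  have hpos : ∀ x ∈ Ioo 0 z, 0 < besselJ n x := by
    intro x hx
    by_contra! hneg
    have hy : min (δ / 2) (z / 2) ∈ Ioo 0 z :=
      ⟨lt_min (by linarith) (by linarith [hz.1]), (min_le_right _ _).trans_lt (by linarith [hz.1])⟩
    have hy' : 0 < besselJ n (min (δ / 2) (z / 2)) :=
      hp _ ⟨hy.1, (min_le_left _ _).trans_lt (by linarith)⟩
    obtain ⟨w, hw, hw0⟩ := isPreconnected_Ioo.intermediate_value hx hy
      (continuous_besselJ n).continuousOn ⟨hneg, hy'.le⟩
    exact hne w hw hw0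
  -- `x J_n'` increases from `0` while `x ≤ n`, hence `J_n` increases up to its first zero
  have hn : n ≠ 0 := by
    rintro rfl
    simp at hlt; linarith
  have hg0 : (n : ℝ) * besselJ n 0 - 0 * besselJ (n + 1) 0 = 0 := by
    rw [besselJ_eq]; simp [hn]
  have hgmono : MonotoneOn (fun x => n * besselJ n x - x * besselJ (n + 1) x) (Icc 0 z) := by
    refine monotoneOn_of_deriv_nonneg (convex_Icc 0 z) ?_ ?_ ?_
    · have := continuous_besselJ n
      have := continuous_besselJ (n + 1)
      fun_prop
    · intro x hx
      rw [interior_Icc] at hx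
      exact (hasDerivAt_mul_deriv_besselJ n hx.1.ne').differentiableAt.differentiableWithinAt
    · intro x hx
      rw [interior_Icc] at hx
      rw [(hasDerivAt_mul_deriv_besselJ n hx.1.ne').deriv]
      refine mul_nonneg ?_ (hpos x hx).le
      have hxn : x ≤ n := by linarith [hx.2, hz.2]
      rw [sub_nonneg, le_div_iff₀ hx.1]
      nlinarith [hx.1]
  have hJmono : MonotoneOn (besselJ n) (Icc (z / 2) z) := by
    refine monotoneOn_of_deriv_nonneg (convex_Icc _ z) (continuous_besselJ n).continuousOn ?_ ?_
    · intro x hx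
      rw [interior_Icc] at hx
      have : 0 < x := by linarith [hx.1, hz.1]
      exact (hasDerivAt_besselJ n this.ne').differentiableAt.differentiableWithinAt
    · intro x hx
      rw [interior_Icc] at hx
      have hx0 : 0 < x := by linarith [hx.1, hz.1]
      rw [(hasDerivAt_besselJ n hx0.ne').deriv]
      have h := hgmono (left_mem_Icc.2 hz.1.le) ⟨hx0.le, hx.2.le⟩ hx0.le
      simp only [hg0] at h
      have e : (n : ℝ) / x * besselJ n x - besselJ (n + 1) x =
        (n * besselJ n x - x * besselJ (n + 1) x) / x := by field_simp
      rw [e]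
      positivity
  have hz2 : z / 2 < z := by linarith [hz.1]
  have h1 := hJmono (left_mem_Icc.2 hz2.le) (right_mem_Icc.2 hz2.le) hz2.le
  have h2 := hpos (z / 2) ⟨by linarith [hz.1], hz2⟩
  linarith

lemma besselQ_lt_one {n : ℕ} (hn : 1 ≤ n) {x : ℝ} (hx : 0 < x) : besselQ n x < 1 := by
  unfold besselQ
  have h1 : (1 : ℝ) ≤ n := by exact_mod_cast hn
  have : 0 < ((n : ℝ) ^ 2 - 1 / 4) / x ^ 2 := div_pos (by nlinarith) (by positivity)
  linarith

lemma besselJ_zero_gap {n : ℕ} (hn : 1 ≤ n) {a b : ℝ} (ha : 0 < a) (hab : a < b)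
    (ha0 : besselJ n a = 0) (hb0 : besselJ n b = 0) : a + 1 ≤ b := by
  obtain ⟨z, hz, hz0, hne⟩ := exists_first_zero n hab hb0
  have hπ := Real.pi_gt_three
  suffices Real.pi ≤ z - a by linarith [hz.2]
  have hm : (a + z) / 2 ∈ Ioo a z := ⟨by linarith [hz.1], by linarith [hz.1]⟩
  have hpx : ∀ x ∈ Icc a z, 0 < x := fun x hx => ha.trans_le hx.1
  rcases lt_or_gt_of_ne (hne _ hm) with h | h
  · refine sturm_gap (u := fun x => -besselU n x) (u' := fun x => -besselU' n x)
      (q := besselQ n) hz.1 (fun x hx => (hasDerivAt_besselU n (hpx x hx)).neg)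
      (fun x hx => ?_) (fun x hx => besselQ_lt_one hn (hpx x hx)) (by simp [besselU, ha0])
      (by simp [besselU, hz0]) ?_
    · exact (hasDerivAt_besselU' n (hpx x hx)).neg.congr_deriv (by ring)
    · intro x hx
      have : besselJ n x < 0 := by
        by_contra! hc
        obtain ⟨w, hw, hw0⟩ := isPreconnected_Ioo.intermediate_value hm hx
          (continuous_besselJ n).continuousOn ⟨h.le, hc⟩
        exact hne w hw hw0
      have hs := Real.sqrt_pos.2 (hpx x (Ioo_subset_Icc_self hx))
      unfold besselU
      nlinarith
  · refine sturm_gap (u := besselU n) (u' := besselU' n)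
      (q := besselQ n) hz.1 (fun x hx => (hasDerivAt_besselU n (hpx x hx)))
      (fun x hx => hasDerivAt_besselU' n (hpx x hx)) (fun x hx => besselQ_lt_one hn (hpx x hx))
      (by simp [besselU, ha0]) (by simp [besselU, hz0]) ?_
    intro x hx
    have : 0 < besselJ n x := by
      by_contra! hc
      obtain ⟨w, hw, hw0⟩ := isPreconnected_Ioo.intermediate_value hx hm
        (continuous_besselJ n).continuousOn ⟨hc, h.le⟩
      exact hne w hw hw0
    have hs := Real.sqrt_pos.2 (hpx x (Ioo_subset_Icc_self hx))
    exact mul_pos hs this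

/-- If `a > 0` and `1 - n²/a² ≥ κ²`, then `J_n` has a zero in `(a, a + π/κ]`. -/
lemma besselJ_exists_zero {n : ℕ} {a κ : ℝ} (ha : 0 < a) (hκ : 0 < κ)
    (h : κ ^ 2 ≤ 1 - (n : ℝ) ^ 2 / a ^ 2) :
    ∃ x ∈ Ioc a (a + Real.pi / κ), besselJ n x = 0 := by
  have hpx : ∀ x ∈ Icc a (a + Real.pi / κ), 0 < x := fun x hx => ha.trans_le hx.1
  have hq : ∀ x ∈ Icc a (a + Real.pi / κ), κ ^ 2 ≤ besselQ n x := by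
    intro x hx
    refine h.trans ?_
    unfold besselQ
    have h1 : ((n : ℝ) ^ 2 - 1 / 4) / x ^ 2 ≤ (n : ℝ) ^ 2 / a ^ 2 := by
      have hx0 := hpx x hx
      calc ((n : ℝ) ^ 2 - 1 / 4) / x ^ 2 ≤ (n : ℝ) ^ 2 / x ^ 2 := by gcongr; linarith
        _ ≤ _ := by have := hx.1; gcongr
    linarith
  obtain ⟨x, hx, hx0⟩ := sturm_exists_zero hκ (fun x hx => hasDerivAt_besselU n (hpx x hx))
    (fun x hx => hasDerivAt_besselU' n (hpx x hx)) hq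
  refine ⟨x, hx, ?_⟩
  have hs := Real.sqrt_pos.2 (hpx x (Ioc_subset_Icc_self hx))
  exact (mul_eq_zero.1 hx0).resolve_left hs.ne'

lemma exists_besselJ_zero_gt (n : ℕ) (a : ℝ) : ∃ x, a < x ∧ besselJ n x = 0 := by
  set b : ℝ := max a (2 * n + 1)
  have hb : (2 * n + 1 : ℝ) ≤ b := le_max_right _ _
  have hb0 : 0 < b := lt_of_lt_of_le (by positivity) hb
  obtain ⟨x, hx, hx0⟩ := besselJ_exists_zero (n := n) (κ := 1 / 2) hb0 (by norm_num) (by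
    have : (n : ℝ) ^ 2 / b ^ 2 ≤ 1 / 4 := by
      rw [div_le_iff₀ (by positivity)]
      nlinarith [Nat.cast_nonneg (α := ℝ) n]
    linarith)
  exact ⟨x, (le_max_left _ _).trans_lt hx.1, hx0⟩

/-- The recursive values `besselZero n k`, `k ≥ 1`, are genuine positive zeros of `J_n`. -/
lemma besselZero_spec {n : ℕ} (hn : 1 ≤ n) (k : ℕ) :
    (0 ≤ besselZero n k ∧ (k = 0 ∨ 0 < besselZero n k ∧ besselJ n (besselZero n k) = 0)) ∧
      besselZero n k + 1 ≤ besselZero n (k + 1) := by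
  -- all zeros beyond `α_k` are at distance at least one, so the infimum is attained
  have step : ∀ k, (0 ≤ besselZero n k ∧
      (k = 0 ∨ 0 < besselZero n k ∧ besselJ n (besselZero n k) = 0)) →
      besselZero n k + 1 ≤ besselZero n (k + 1) ∧ besselJ n (besselZero n (k + 1)) = 0 := by
    intro k hk
    set S := {x : ℝ | besselZero n k < x ∧ besselJ n x = 0} with hS
    have hgap : ∀ x ∈ S, besselZero n k + 1 ≤ x := by
      intro x hx
      rcases hk.2 with rfl | h
      · have h0 : besselZero n 0 = 0 := rfl
        rw [hS, h0] at hx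
        have := le_of_besselJ_eq_zero n hx.1 hx.2
        have h1 : (1 : ℝ) ≤ n := by exact_mod_cast hn
        rw [h0]; linarith
      · exact besselJ_zero_gap hn h.1 hx.1 h.2 hx.2
    have hne : S.Nonempty := exists_besselJ_zero_gt n _
    have hcl : IsClosed S := by
      have : S = Ici (besselZero n k + 1) ∩ besselJ n ⁻¹' {0} := by
        ext x
        refine ⟨fun hx => ⟨hgap x hx, hx.2⟩, fun hx => ⟨?_, hx.2⟩⟩
        have := hx.1
        simp only [mem_Ici] at this
        linarith
      rw [this]
      exact isClosed_Ici.inter (isClosed_singleton.preimage (continuous_besselJ n))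
    have hmem : sInf S ∈ S := hcl.csInf_mem hne ⟨besselZero n k, fun x hx => hx.1.le⟩
    exact ⟨hgap _ hmem, hmem.2⟩
  have all : ∀ k, 0 ≤ besselZero n k ∧
      (k = 0 ∨ 0 < besselZero n k ∧ besselJ n (besselZero n k) = 0) := by
    intro k
    induction k with
    | zero => exact ⟨le_rfl, Or.inl rfl⟩
    | succ k ih =>
      obtain ⟨h1, h2⟩ := step k ih
      have : 0 < besselZero n (k + 1) := by linarith [ih.1]
      exact ⟨this.le, Or.inr ⟨this, h2⟩⟩
  exact ⟨all k, (step k (all k)).1⟩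

lemma besselZero_strictMono {n : ℕ} (hn : 1 ≤ n) : StrictMono (besselZero n) :=
  strictMono_nat_of_lt_succ fun k => by linarith [(besselZero_spec hn k).2]

lemma cast_le_besselZero {n : ℕ} (hn : 1 ≤ n) (k : ℕ) : (k : ℝ) ≤ besselZero n k := by
  induction k with
  | zero => simp [besselZero]
  | succ k ih => push_cast; linarith [(besselZero_spec hn k).2]

lemma order_le_besselZero {n k : ℕ} (hn : 1 ≤ n) (hk : 1 ≤ k) : (n : ℝ) ≤ besselZero n k := by
  obtain h | h := (besselZero_spec hn k).1.2
  · omega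
  · exact le_of_besselJ_eq_zero n h.1 h.2

/-! ### Lower bound for the number of zeros of one Bessel function -/

/-- `√(1 - n²/x²)`, which is `π` times the asymptotic density of the zeros of `J_n` near `x`. -/
noncomputable def zeroDensity (n x : ℝ) : ℝ := √(1 - n ^ 2 / x ^ 2)

lemma zeroDensity_nonneg (n x : ℝ) : 0 ≤ zeroDensity n x := Real.sqrt_nonneg _

lemma zeroDensity_le_one (n x : ℝ) : zeroDensity n x ≤ 1 := by
  unfold zeroDensity
  rw [Real.sqrt_le_iff]
  refine ⟨zero_le_one, ?_⟩
  have : 0 ≤ n ^ 2 / x ^ 2 := by positivity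
  linarith

lemma measurable_zeroDensity (n : ℝ) : Measurable (zeroDensity n) := by
  unfold zeroDensity; fun_prop

lemma intervalIntegrable_zeroDensity (n a b : ℝ) :
    IntervalIntegrable (zeroDensity n) volume a b := by
  refine (intervalIntegrable_const (c := (1 : ℝ))).mono_fun
    (measurable_zeroDensity n).aestronglyMeasurable (Eventually.of_forall fun x => ?_)
  simp only [Real.norm_eq_abs, abs_of_nonneg (zeroDensity_nonneg n x)]
  simpa using zeroDensity_le_one n x

lemma zeroDensity_mono (n : ℝ) {x y : ℝ} (hx : 0 < x) (hxy : x ≤ y) :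
    zeroDensity n x ≤ zeroDensity n y := by
  unfold zeroDensity
  gcongr

lemma besselZero_add_le {n k : ℕ} {a κ : ℝ} (ha : 0 < a) (hκ : 0 < κ)
    (h : κ ^ 2 ≤ 1 - (n : ℝ) ^ 2 / a ^ 2) (hk : besselZero n k ≤ a) (j : ℕ) :
    besselZero n (k + j) ≤ a + j * (Real.pi / κ) := by
  induction j with
  | zero => simpa using hk
  | succ j ih =>
    have hp : 0 < Real.pi / κ := by positivity
    have ha' : a ≤ a + j * (Real.pi / κ) := by
      have : 0 ≤ j * (Real.pi / κ) := by positivity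
      linarith
    obtain ⟨x, hx, hx0⟩ := besselJ_exists_zero (n := n) (ha.trans_le ha') hκ (h.trans (by gcongr))
    have : besselZero n (k + (j + 1)) ≤ x :=
      csInf_le ⟨besselZero n (k + j), fun y hy => hy.1.le⟩ ⟨ih.trans_lt hx.1, hx0⟩
    push_cast
    linarith [hx.2]

lemma integral_zeroDensity_le (n : ℝ) {a b : ℝ} (ha : 0 < a) (hab : a ≤ b) :
    ∫ x in a..b, zeroDensity n x ≤ (b - a) * zeroDensity n b := by
  have := intervalIntegral.integral_mono_on hab (intervalIntegrable_zeroDensity n a b)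
    (intervalIntegrable_const (c := zeroDensity n b) (μ := volume))
    (fun x hx => zeroDensity_mono n (ha.trans_le hx.1) hx.2)
  simpa using this

lemma exists_index_on_grid {n : ℕ} (hn : 1 ≤ n) {h : ℝ} (hh : 0 < h) (i : ℕ) :
    ∃ K : ℕ, besselZero n K ≤ n + (i + 1) * h ∧
      (1 / Real.pi) * (∫ x in (n : ℝ)..(n + i * h), zeroDensity n x) - i ≤ K := by
  have hn0 : (0 : ℝ) < n := by exact_mod_cast hn
  have hπ := Real.pi_pos
  induction i with
  | zero => exact ⟨0, by simp [besselZero]; positivity, by simp⟩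
  | succ i ih =>
    obtain ⟨K, hK, hKi⟩ := ih
    have hih : (0 : ℝ) ≤ i * h := by positivity
    set a : ℝ := n + (i + 1) * h with ha
    have hna : (n : ℝ) < a := by rw [ha]; nlinarith
    have ha0 : 0 < a := hn0.trans hna
    have hq : 0 < 1 - (n : ℝ) ^ 2 / a ^ 2 := by
      rw [sub_pos, div_lt_one (by positivity)]
      gcongr
    set κ := zeroDensity n a with hκ
    have hκ0 : 0 < κ := Real.sqrt_pos.2 hq
    have hκ2 : κ ^ 2 ≤ 1 - (n : ℝ) ^ 2 / a ^ 2 := (Real.sq_sqrt hq.le).le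
    refine ⟨K + ⌊h * κ / Real.pi⌋₊, ?_, ?_⟩
    · have h1 := besselZero_add_le ha0 hκ0 hκ2 hK ⌊h * κ / Real.pi⌋₊
      have h2 : (⌊h * κ / Real.pi⌋₊ : ℝ) ≤ h * κ / Real.pi := Nat.floor_le (by positivity)
      have h3 : (⌊h * κ / Real.pi⌋₊ : ℝ) * (Real.pi / κ) ≤ h := by
        calc _ ≤ h * κ / Real.pi * (Real.pi / κ) := by gcongr
          _ = h := by field_simp
      push_cast
      rw [ha] at h1
      linarith
    · have h2 : h * κ / Real.pi < ⌊h * κ / Real.pi⌋₊ + 1 := Nat.lt_floor_add_one _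
      have e : ∫ x in (n : ℝ)..(n + ((i + 1 : ℕ) : ℝ) * h), zeroDensity n x =
          (∫ x in (n : ℝ)..(n + i * h), zeroDensity n x) +
            ∫ x in (n + i * h : ℝ)..a, zeroDensity n x := by
        rw [intervalIntegral.integral_add_adjacent_intervals
          (intervalIntegrable_zeroDensity _ _ _) (intervalIntegrable_zeroDensity _ _ _)]
        push_cast; rfl
      have h3 := integral_zeroDensity_le n (a := n + i * h) (b := a) (by positivity)
        (by rw [ha]; nlinarith)
      have h4 : a - (n + i * h) = h := by rw [ha]; ring
      rw [h4, ← hκ] at h3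
      rw [e]
      have h5 : (1 / Real.pi) * (∫ x in (n + i * h : ℝ)..a, zeroDensity n x) ≤
          h * κ / Real.pi := by
        rw [div_mul_eq_mul_div, one_mul]; gcongr
      push_cast
      rw [mul_add]
      linarith

/-- A lower bound for the number of zeros of `J_n` up to `X`, with an error that is uniform
in `n`. -/
lemma exists_index_le {n : ℕ} (hn : 1 ≤ n) {X : ℝ} (hX : (n : ℝ) ≤ X) :
    ∃ K : ℕ, besselZero n K ≤ X ∧
      (1 / Real.pi) * (∫ x in (n : ℝ)..X, zeroDensity n x) - 2 * √X ≤ K := by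
  have hn0 : (0 : ℝ) < n := by exact_mod_cast hn
  have hX0 : 0 < X := hn0.trans_le hX
  have hs : 0 < √X := Real.sqrt_pos.2 hX0
  rcases hX.eq_or_lt with rfl | hlt
  · exact ⟨0, by simp [besselZero], by simp⟩
  -- the grid has mesh `h ≤ √X` and at most `√X + 1` steps
  obtain ⟨i, hi⟩ : ∃ i : ℕ, ⌈√X⌉₊ = i + 1 :=
    Nat.exists_eq_succ_of_ne_zero (Nat.ceil_pos.2 hs).ne'
  have hi1 : √X ≤ i + 1 := by have := Nat.le_ceil √X; rw [hi] at this; exact_mod_cast this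
  have hi2 : (i : ℝ) ≤ √X := by
    have := Nat.ceil_lt_add_one hs.le
    rw [hi] at this; push_cast at this; linarith
  set h := (X - n) / (i + 1) with hh
  have hi0 : (0 : ℝ) < i + 1 := by positivity
  have hh0 : 0 < h := div_pos (by linarith) hi0
  have hhs : h ≤ √X := by
    rw [hh, div_le_iff₀ hi0]
    have : √X * √X = X := Real.mul_self_sqrt hX0.le
    nlinarith
  obtain ⟨K, hK, hKi⟩ := exists_index_on_grid hn hh0 i
  have e : (n : ℝ) + (i + 1) * h = X := by rw [hh]; field_simp; ring
  refine ⟨K, e ▸ hK, ?_⟩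
  have e1 := intervalIntegral.integral_add_adjacent_intervals
    (intervalIntegrable_zeroDensity n n (n + i * h)) (intervalIntegrable_zeroDensity n (n + i * h) X)
  have h3 := integral_zeroDensity_le n (a := n + i * h) (b := X) (by positivity) (by nlinarith)
  have h4 : X - (n + i * h) = h := by rw [← e]; ring
  rw [h4] at h3
  have h5 : ∫ x in (n + i * h : ℝ)..X, zeroDensity n x ≤ √X := by
    nlinarith [zeroDensity_le_one n X, zeroDensity_nonneg n X]
  have hπ1 : 1 / Real.pi ≤ 1 := by
    rw [div_le_one Real.pi_pos]; linarith [Real.pi_gt_three]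
  have hπ0 : 0 < 1 / Real.pi := by positivity
  have h6 : 1 / Real.pi * ∫ x in (n + i * h : ℝ)..X, zeroDensity n x ≤ √X := by
    calc _ ≤ 1 / Real.pi * √X := by gcongr
      _ ≤ 1 * √X := by gcongr
      _ = _ := one_mul _
  rw [← e1, mul_add]
  linarith

/-! ### Summation over the order -/

/-- The area of the part of the quarter disk `v² + w² ≤ 1` with `v ≥ c`. -/
noncomputable def capIntegral (c : ℝ) : ℝ := ∫ v in c..1, √(1 - v ^ 2)

lemma intervalIntegrable_sqrt_one_sub (a b : ℝ) :
    IntervalIntegrable (fun v : ℝ => √(1 - v ^ 2)) volume a b :=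
  (by fun_prop : Continuous fun v : ℝ => √(1 - v ^ 2)).intervalIntegrable a b

lemma sqrt_one_sub_le_one (v : ℝ) : √(1 - v ^ 2) ≤ 1 := by
  rw [Real.sqrt_le_iff]
  exact ⟨zero_le_one, by nlinarith [sq_nonneg v]⟩

/-- For fixed `x`, the density summed over the orders `n ≥ c x` is at least
`x` times `capIntegral c`, up to a bounded error. -/
lemma sum_zeroDensity_ge {c x : ℝ} (hc0 : 0 < c) (hc1 : c < 1) (hx : 0 < x) {N : ℕ}
    (hN : x < N + 1) :
    x * capIntegral c - 1 ≤ ∑ n ∈ Finset.Ico ⌈c * x⌉₊ (N + 1), zeroDensity (n : ℕ) x := by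
  have hcx : c * x < x := by nlinarith
  set m := ⌈c * x⌉₊ with hm
  have hm1 : c * x ≤ m := Nat.le_ceil _
  have hm2 : (m : ℝ) < c * x + 1 := Nat.ceil_lt_add_one (by positivity)
  have hmN : m ≤ N + 1 := by
    rw [hm, Nat.ceil_le]; push_cast; linarith
  set φ : ℝ → ℝ := fun y => √(1 - (y / x) ^ 2) with hφ
  have hφc : Continuous φ := by fun_prop
  have hφi : ∀ a b, IntervalIntegrable φ volume a b := fun a b => hφc.intervalIntegrable a b
  have hanti : AntitoneOn φ (Icc (m : ℝ) ((N + 1 : ℕ) : ℝ)) := by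
    intro y hy z hz hyz
    have : 0 ≤ y := (Nat.cast_nonneg m).trans hy.1
    simp only [hφ]
    gcongr
  have h1 := AntitoneOn.integral_le_sum_Ico hmN hanti
  have e : ∑ n ∈ Finset.Ico m (N + 1), φ n =
      ∑ n ∈ Finset.Ico m (N + 1), zeroDensity (n : ℕ) x := by
    refine Finset.sum_congr rfl fun n _ => ?_
    simp only [hφ, zeroDensity, div_pow]
  rw [e] at h1
  have h2 : ∫ y in (c * x)..x, φ y = x * capIntegral c := by
    simp only [hφ, capIntegral]
    rw [intervalIntegral.integral_comp_div (fun v => √(1 - v ^ 2)) hx.ne', mul_div_cancel_right₀ _ hx.ne',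
      div_self hx.ne', smul_eq_mul]
  have h3 : ∫ y in x..((N + 1 : ℕ) : ℝ), φ y = 0 := by
    have hle : x ≤ ((N + 1 : ℕ) : ℝ) := by push_cast; exact hN.le
    have : ∫ y in x..((N + 1 : ℕ) : ℝ), φ y = ∫ y in x..((N + 1 : ℕ) : ℝ), (0 : ℝ) := by
      refine intervalIntegral.integral_congr fun y hy => ?_
      rw [uIcc_of_le hle] at hy
      simp only [hφ]
      refine Real.sqrt_eq_zero_of_nonpos ?_
      have : 1 ≤ y / x := by rw [le_div_iff₀ hx]; linarith [hy.1]
      nlinarith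
    rw [this]; simp
  have h4 : ∫ y in (c * x)..(m : ℝ), φ y ≤ 1 := by
    have := intervalIntegral.integral_mono_on hm1 (hφi _ _)
      (intervalIntegrable_const (c := (1 : ℝ)) (μ := volume))
      (fun y _ => sqrt_one_sub_le_one (y / x))
    simp at this
    linarith
  have h5 := intervalIntegral.integral_add_adjacent_intervals (hφi (c * x) m)
    (hφi m ((N + 1 : ℕ) : ℝ))
  have h6 := intervalIntegral.integral_add_adjacent_intervals (hφi (c * x) x)
    (hφi x ((N + 1 : ℕ) : ℝ))
  linarith

lemma sum_integral_zeroDensity_ge {c R : ℝ} (hc0 : 0 < c) (hc1 : c < 1) (hR : 0 < R) :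
    R ^ 2 / 2 * capIntegral c - R ≤
      ∑ n ∈ Finset.Icc 1 ⌊R⌋₊, ∫ x in ((n : ℕ) : ℝ)..min R (n / c), zeroDensity n x := by
  have hle : ∀ n ∈ Finset.Icc 1 ⌊R⌋₊, ((n : ℕ) : ℝ) ≤ min R (n / c) := by
    intro n hn
    rw [Finset.mem_Icc] at hn
    refine le_min ((Nat.le_floor_iff hR.le).1 hn.2) ?_
    rw [le_div_iff₀ hc0]
    nlinarith [Nat.cast_nonneg (α := ℝ) n]
  have hint : ∀ n : ℕ, IntegrableOn
      ((Ioc (n : ℝ) (min R (n / c))).indicator (zeroDensity n)) (Ioc 0 R) := by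
    intro n
    have : IntegrableOn (zeroDensity n) (Ioc 0 R) :=
      (intervalIntegrable_iff_integrableOn_Ioc_of_le hR.le).1 (intervalIntegrable_zeroDensity n 0 R)
    exact this.indicator measurableSet_Ioc
  have e : ∑ n ∈ Finset.Icc 1 ⌊R⌋₊, ∫ x in ((n : ℕ) : ℝ)..min R (n / c), zeroDensity n x =
      ∫ x in Ioc 0 R, ∑ n ∈ Finset.Icc 1 ⌊R⌋₊,
        (Ioc ((n : ℕ) : ℝ) (min R (n / c))).indicator (zeroDensity n) x := by
    rw [integral_finsetSum _ fun n _ => hint n]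
    refine Finset.sum_congr rfl fun n hn => ?_
    rw [intervalIntegral.integral_of_le (hle n hn), setIntegral_indicator measurableSet_Ioc]
    congr 2
    rw [eq_comm, inter_eq_right]
    exact fun x hx => ⟨(Nat.cast_nonneg n).trans_lt hx.1, hx.2.trans (min_le_left _ _)⟩
  rw [e]
  have e2 : R ^ 2 / 2 * capIntegral c - R = ∫ x in Ioc 0 R, (x * capIntegral c - 1) := by
    rw [← intervalIntegral.integral_of_le hR.le, intervalIntegral.integral_sub
      (Continuous.intervalIntegrable (by fun_prop) _ _) intervalIntegrable_const,
      intervalIntegral.integral_mul_const, integral_id]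
    simp
  rw [e2]
  refine setIntegral_mono_on ?_ (integrable_finsetSum _ fun n _ => hint n) measurableSet_Ioc ?_
  · exact (intervalIntegrable_iff_integrableOn_Ioc_of_le hR.le).1
      (Continuous.intervalIntegrable (by fun_prop) _ _)
  · intro x hx
    refine (sum_zeroDensity_ge hc0 hc1 hx.1 (hx.2.trans_lt (Nat.lt_floor_add_one R))).trans ?_
    have hcx : 0 < c * x := mul_pos hc0 hx.1
    have hsub : Finset.Ico ⌈c * x⌉₊ (⌊R⌋₊ + 1) ⊆ Finset.Icc 1 ⌊R⌋₊ := by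
      intro n hn
      rw [Finset.mem_Ico] at hn
      have : 0 < ⌈c * x⌉₊ := Nat.ceil_pos.2 hcx
      rw [Finset.mem_Icc]; omega
    refine (Finset.sum_le_sum fun n hn => ?_).trans
      (Finset.sum_le_sum_of_subset_of_nonneg hsub fun n _ _ =>
        indicator_nonneg (fun y _ => zeroDensity_nonneg n y) x)
    rw [Finset.mem_Ico, Nat.ceil_le] at hn
    by_cases hnx : (n : ℝ) < x
    · rw [indicator_of_mem]
      refine ⟨hnx, le_min hx.2 ?_⟩
      rw [le_div_iff₀ hc0]; linarith [hn.1]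
    · -- orders `n ≥ x` contribute nothing
      have : zeroDensity n x = 0 := by
        refine Real.sqrt_eq_zero_of_nonpos ?_
        rw [sub_nonpos, one_le_div (by have := hx.1; positivity)]
        have := hx.1
        push Not at hnx
        gcongr
      rw [this]
      exact indicator_nonneg (fun y _ => zeroDensity_nonneg n y) x

/-! ### Counting the quasimodes -/

lemma quasimodeIndices_subset {r₁ r₂ ε lam : ℝ} (hr₂ : 0 < r₂) :
    quasimodeIndices r₁ r₂ ε lam ⊆
      ↑(Finset.Icc 1 ⌊lam * r₂⌋₊ ×ˢ Finset.Icc 1 ⌊lam * r₂⌋₊) := by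
  rintro ⟨n, k⟩ ⟨hn, hk, h, -⟩
  simp only at hn hk h
  rw [div_lt_iff₀ hr₂] at h
  have h1 := order_le_besselZero hn hk
  have h2 := cast_le_besselZero hn k
  simp only [Finset.coe_product, Finset.coe_Icc, mem_prod, mem_Icc]
  exact ⟨⟨hn, Nat.le_floor (h1.trans h.le)⟩, ⟨hk, Nat.le_floor (h2.trans h.le)⟩⟩

lemma quasimodeIndices_finite {r₁ r₂ ε lam : ℝ} (hr₂ : 0 < r₂) :
    (quasimodeIndices r₁ r₂ ε lam).Finite :=
  (Finset.finite_toSet _).subset (quasimodeIndices_subset hr₂)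

lemma ncard_quasimodeIndices_le {r₁ r₂ ε lam : ℝ} (hr₂ : 0 < r₂) (hlam : 0 < lam) :
    ((quasimodeIndices r₁ r₂ ε lam).ncard : ℝ) ≤ (lam * r₂) ^ 2 := by
  have h := Set.ncard_le_ncard (quasimodeIndices_subset (r₁ := r₁) (ε := ε) (lam := lam) hr₂)
    (Finset.finite_toSet _)
  rw [Set.ncard_coe_finset, Finset.card_product, Nat.card_Icc, Nat.add_sub_cancel] at h
  have h2 : (⌊lam * r₂⌋₊ : ℝ) ≤ lam * r₂ := Nat.floor_le (by positivity)
  calc ((quasimodeIndices r₁ r₂ ε lam).ncard : ℝ) ≤ (⌊lam * r₂⌋₊ : ℝ) * ⌊lam * r₂⌋₊ := by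
        exact_mod_cast h
    _ ≤ _ := by rw [sq]; gcongr

lemma ncard_quasimodeIndices_ge {r₁ r₂ ε lam : ℝ} (hr₁ : 0 < r₁ + ε) (hr : r₁ + ε < r₂)
    (hlam : 0 < lam) :
    1 / Real.pi * ((lam * r₂) ^ 2 / 2 * capIntegral ((r₁ + ε) / r₂) - lam * r₂) -
        lam * r₂ * (2 * √(lam * r₂) + 1) ≤
      ((quasimodeIndices r₁ r₂ ε lam).ncard : ℝ) := by
  have hr₂ : 0 < r₂ := hr₁.trans hr
  set R := lam * r₂ with hRdef
  have hR : 0 < R := by positivity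
  set c := (r₁ + ε) / r₂ with hcdef
  have hc0 : 0 < c := by positivity
  have hc1 : c < 1 := (div_lt_one hr₂).2 hr
  have hex : ∀ n : ℕ, ∃ K : ℕ, n ∈ Finset.Icc 1 ⌊R⌋₊ → besselZero n K ≤ min R (n / c) ∧
      (1 / Real.pi) * (∫ x in (n : ℝ)..min R (n / c), zeroDensity n x) - 2 * √R ≤ K := by
    intro n
    by_cases hn : n ∈ Finset.Icc 1 ⌊R⌋₊
    · have hn' := Finset.mem_Icc.1 hn
      have hle : (n : ℝ) ≤ min R (n / c) := by
        refine le_min ((Nat.le_floor_iff hR.le).1 hn'.2) ?_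
        rw [le_div_iff₀ hc0]
        nlinarith [Nat.cast_nonneg (α := ℝ) n]
      obtain ⟨K, hK, hK'⟩ := exists_index_le hn'.1 hle
      refine ⟨K, fun _ => ⟨hK, le_trans ?_ hK'⟩⟩
      have : √(min R (n / c)) ≤ √R := Real.sqrt_le_sqrt (min_le_left _ _)
      linarith
    · exact ⟨0, fun h => absurd h hn⟩
  choose K hK using hex
  -- the indices below the last one satisfy the strict inequalities
  set F : Finset (Σ _ : ℕ, ℕ) := (Finset.Icc 1 ⌊R⌋₊).sigma fun n => Finset.Icc 1 (K n - 1)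
  have hsub : ((F.map (Equiv.sigmaEquivProd ℕ ℕ).toEmbedding : Finset (ℕ × ℕ)) : Set (ℕ × ℕ)) ⊆
      quasimodeIndices r₁ r₂ ε lam := by
    rintro ⟨n, k⟩ h
    simp only [Finset.coe_map, mem_image, Finset.mem_coe, F, Finset.mem_sigma, Sigma.exists,
      Equiv.coe_toEmbedding, Equiv.sigmaEquivProd_apply, Prod.mk.injEq] at h
    obtain ⟨n', k', ⟨hn, hk⟩, rfl, rfl⟩ := h
    have hn1 := (Finset.mem_Icc.1 hn).1
    rw [Finset.mem_Icc] at hk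
    have hlt : besselZero n' k' < min R (n' / c) :=
      (besselZero_strictMono hn1 (by omega)).trans_le (hK n' hn).1
    refine ⟨hn1, hk.1, ?_, ?_⟩
    · rw [div_lt_iff₀ hr₂]; exact hlt.trans_le (min_le_left _ _)
    · refine hlt.trans_le ((min_le_right _ _).trans (le_of_eq ?_))
      simp only [hcdef]; field_simp
  have hcard := Set.ncard_le_ncard hsub (quasimodeIndices_finite hr₂)
  rw [Set.ncard_coe_finset, Finset.card_map, Finset.card_sigma] at hcard
  simp only [Nat.card_Icc, Nat.add_sub_cancel] at hcard
  have hcard' : ∑ n ∈ Finset.Icc 1 ⌊R⌋₊, ((K n - 1 : ℕ) : ℝ) ≤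
      ((quasimodeIndices r₁ r₂ ε lam).ncard : ℝ) := by exact_mod_cast hcard
  refine le_trans ?_ hcard'
  have h1 : ∑ n ∈ Finset.Icc 1 ⌊R⌋₊, ((1 / Real.pi) *
      (∫ x in ((n : ℕ) : ℝ)..min R (n / c), zeroDensity n x) - (2 * √R + 1)) ≤
      ∑ n ∈ Finset.Icc 1 ⌊R⌋₊, ((K n - 1 : ℕ) : ℝ) := by
    refine Finset.sum_le_sum fun n hn => ?_
    have h := (hK n hn).2
    have : (K n : ℝ) ≤ ((K n - 1 : ℕ) : ℝ) + 1 := by exact_mod_cast (by omega : K n ≤ K n - 1 + 1)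
    linarith
  refine le_trans ?_ h1
  rw [Finset.sum_sub_distrib, ← Finset.mul_sum, Finset.sum_const, Nat.card_Icc,
    Nat.add_sub_cancel, nsmul_eq_mul]
  have h2 := sum_integral_zeroDensity_ge hc0 hc1 hR
  have h3 : (⌊R⌋₊ : ℝ) ≤ R := Nat.floor_le hR.le
  have h4 : 0 ≤ 2 * √R + 1 := by positivity
  gcongr

/-! ### The limit of the counting function -/

lemma capIntegral_ge {c d : ℝ} (hcd : c ≤ d) : capIntegral c - (d - c) ≤ capIntegral d := by
  have h := intervalIntegral.integral_add_adjacent_intervals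
    (intervalIntegrable_sqrt_one_sub c d) (intervalIntegrable_sqrt_one_sub d 1)
  have h1 := intervalIntegral.integral_mono_on hcd (intervalIntegrable_sqrt_one_sub c d)
    (intervalIntegrable_const (c := (1 : ℝ)) (μ := volume)) (fun y _ => sqrt_one_sub_le_one y)
  simp only [intervalIntegral.integral_const, smul_eq_mul, mul_one] at h1
  unfold capIntegral
  linarith

/-- The lower asymptotic density of the quasimodes. -/
noncomputable def quasimodeDensity (r₁ r₂ ε : ℝ) : EReal :=
  Filter.liminf (fun lam : ℝ =>
    ((((quasimodeIndices r₁ r₂ ε lam).ncard : ℝ) / lam ^ 2 : ℝ) : EReal)) Filter.atTop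

lemma quasimodeDensity_antitoneOn {r₁ r₂ : ℝ} (hr₁ : 0 < r₁) (hr₂ : 0 < r₂) :
    AntitoneOn (quasimodeDensity r₁ r₂) (Ioi 0) := by
  intro ε hε δ hδ hle
  refine liminf_le_liminf (Eventually.of_forall fun lam => ?_)
  rw [EReal.coe_le_coe_iff]
  have hsub : quasimodeIndices r₁ r₂ δ lam ⊆ quasimodeIndices r₁ r₂ ε lam := by
    rintro p ⟨h1, h2, h3, h4⟩
    refine ⟨h1, h2, h3, h4.trans_le ?_⟩
    have : 0 < r₁ + ε := add_pos hr₁ hε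
    gcongr
  have := Set.ncard_le_ncard hsub (quasimodeIndices_finite hr₂)
  gcongr

lemma quasimodeDensity_le {r₁ r₂ ε : ℝ} (hr₂ : 0 < r₂) :
    quasimodeDensity r₁ r₂ ε ≤ ((r₂ ^ 2 : ℝ) : EReal) := by
  have h : quasimodeDensity r₁ r₂ ε ≤ liminf (fun _ : ℝ => ((r₂ ^ 2 : ℝ) : EReal)) atTop := by
    refine liminf_le_liminf ?_
    filter_upwards [eventually_gt_atTop 0] with lam hlam
    rw [EReal.coe_le_coe_iff, div_le_iff₀ (by positivity), mul_comm, ← mul_pow]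
    exact ncard_quasimodeIndices_le hr₂ hlam
  rwa [liminf_const] at h

lemma le_quasimodeDensity {r₁ r₂ ε : ℝ} (hr₁ : 0 < r₁ + ε) (hr : r₁ + ε < r₂) :
    ((r₂ ^ 2 * capIntegral ((r₁ + ε) / r₂) / (2 * Real.pi) : ℝ) : EReal) ≤
      quasimodeDensity r₁ r₂ ε := by
  have hr₂ : 0 < r₂ := hr₁.trans hr
  set b := r₂ ^ 2 * capIntegral ((r₁ + ε) / r₂) / (2 * Real.pi) with hb
  set r : ℝ → ℝ := fun lam => b - (r₂ / Real.pi + r₂) * lam⁻¹ - 2 * r₂ * √r₂ * (√lam)⁻¹ with hrdef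
  have hlim : Tendsto r atTop (𝓝 b) := by
    have h1 : Tendsto (fun lam : ℝ => lam⁻¹) atTop (𝓝 0) := tendsto_inv_atTop_zero
    have h2 : Tendsto (fun lam : ℝ => (√lam)⁻¹) atTop (𝓝 0) :=
      tendsto_inv_atTop_zero.comp Real.tendsto_sqrt_atTop
    have := ((tendsto_const_nhds (x := b)).sub (h1.const_mul (r₂ / Real.pi + r₂))).sub
      (h2.const_mul (2 * r₂ * √r₂))
    simpa using this
  have hlim' : Tendsto (fun lam => ((r lam : ℝ) : EReal)) atTop (𝓝 (b : EReal)) :=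
    (continuous_coe_real_ereal.tendsto b).comp hlim
  rw [← hlim'.liminf_eq]
  refine liminf_le_liminf ?_
  filter_upwards [eventually_gt_atTop 0] with lam hlam
  rw [EReal.coe_le_coe_iff, le_div_iff₀ (by positivity)]
  refine le_trans (le_of_eq ?_) (ncard_quasimodeIndices_ge hr₁ hr hlam)
  have hs : √(lam * r₂) = √lam * √r₂ := Real.sqrt_mul hlam.le _
  have hs0 : 0 < √lam := Real.sqrt_pos.2 hlam
  have hs2 : lam = √lam * √lam := (Real.mul_self_sqrt hlam.le).symm
  have hπ := Real.pi_pos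
  simp only [hrdef, hb, hs]
  generalize capIntegral ((r₁ + ε) / r₂) = I
  generalize √lam = s at *
  generalize √r₂ = q
  subst hs2
  field_simp
  ring

lemma exists_tendsto_quasimodeDensity {r₁ r₂ : ℝ} (hr₁ : 0 < r₁) (hr : r₁ < r₂) :
    ∃ L : ℝ, Tendsto (quasimodeDensity r₁ r₂) (𝓝[>] 0) (𝓝 (L : EReal)) ∧
      r₂ ^ 2 * capIntegral (r₁ / r₂) / (2 * Real.pi) ≤ L := by
  have hr₂ : 0 < r₂ := hr₁.trans hr
  have hπ := Real.pi_pos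
  have hlim := (quasimodeDensity_antitoneOn hr₁ hr₂).tendsto_nhdsGT (OrderTop.bddAbove _)
  set Λ := sSup (quasimodeDensity r₁ r₂ '' Ioi 0)
  set g : ℝ → ℝ := fun ε => r₂ ^ 2 * (capIntegral (r₁ / r₂) - ε / r₂) / (2 * Real.pi)
  have hg : Tendsto (fun ε => ((g ε : ℝ) : EReal)) (𝓝[>] 0)
      (𝓝 ((r₂ ^ 2 * capIntegral (r₁ / r₂) / (2 * Real.pi) : ℝ) : EReal)) := by
    have : Continuous fun ε => ((g ε : ℝ) : EReal) :=
      continuous_coe_real_ereal.comp (by fun_prop)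
    have h := (this.tendsto 0).mono_left (nhdsWithin_le_nhds (s := Ioi 0))
    simpa [g] using h
  have hle : ((r₂ ^ 2 * capIntegral (r₁ / r₂) / (2 * Real.pi) : ℝ) : EReal) ≤ Λ := by
    refine le_of_tendsto_of_tendsto hg hlim ?_
    filter_upwards [Ioo_mem_nhdsGT (sub_pos.2 hr)] with ε hε
    have h := le_quasimodeDensity (r₁ := r₁) (r₂ := r₂) (ε := ε) (by linarith [hε.1])
      (by linarith [hε.2])
    refine le_trans ?_ h
    rw [EReal.coe_le_coe_iff]
    have h2 : capIntegral (r₁ / r₂) - ε / r₂ ≤ capIntegral ((r₁ + ε) / r₂) := by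
      have := capIntegral_ge (c := r₁ / r₂) (d := (r₁ + ε) / r₂)
        (by have := hε.1; gcongr; linarith)
      have e : (r₁ + ε) / r₂ - r₁ / r₂ = ε / r₂ := by ring
      rwa [e] at this
    simp only [g]
    gcongr
  have hub : Λ ≤ ((r₂ ^ 2 : ℝ) : EReal) := by
    refine sSup_le ?_
    rintro _ ⟨ε, -, rfl⟩
    exact quasimodeDensity_le hr₂
  have hcoe : ((Λ.toReal : ℝ) : EReal) = Λ := by
    refine EReal.coe_toReal ?_ ?_
    · rintro h; rw [h] at hub; exact EReal.coe_ne_top _ (top_le_iff.1 hub)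
    · rintro h; rw [h] at hle; exact EReal.coe_ne_bot _ (le_bot_iff.1 hle)
  refine ⟨Λ.toReal, by rw [hcoe]; exact hlim, ?_⟩
  rw [← EReal.coe_le_coe_iff, hcoe]
  exact hle

/-! ### The phase volume of the annular region -/

/-- The determinant `x ∧ v`; for a unit vector `v` it is, up to sign, the distance of the origin
from the line through `x` in direction `v`. -/
def cross (x v : Plane) : ℝ := x 0 * v 1 - x 1 * v 0

lemma inner_plane (x v : Plane) : inner ℝ x v = x 0 * v 0 + x 1 * v 1 := by
  rw [PiLp.inner_apply, Fin.sum_univ_two]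
  simp only [RCLike.inner_apply, conj_trivial]
  ring

lemma norm_sq_plane (x : Plane) : ‖x‖ ^ 2 = x 0 ^ 2 + x 1 ^ 2 := by
  rw [EuclideanSpace.norm_sq_eq, Fin.sum_univ_two]
  simp

lemma norm_sq_dir (ω : Dir) : (ω : Plane) 0 ^ 2 + (ω : Plane) 1 ^ 2 = 1 := by
  rw [← norm_sq_plane]; simp

/-- The rotation `x ↦ (x ∧ ω, x · ω)`. -/
noncomputable def rotation (ω : Dir) : Plane ≃ₗᵢ[ℝ] Plane :=
  LinearIsometry.toLinearIsometryEquiv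
    { toFun := fun x => !₂[cross x ω, inner ℝ x (ω : Plane)]
      map_add' := fun x y => by
        ext i
        fin_cases i <;> simp [cross, inner_add_left]; ring
      map_smul' := fun a x => by
        ext i
        fin_cases i <;> simp [cross, inner_smul_left]; ring
      norm_map' := fun x => by
        rw [← sq_eq_sq₀ (norm_nonneg _) (norm_nonneg _), norm_sq_plane, norm_sq_plane]
        have := norm_sq_dir ω
        simp [cross, inner_plane]
        linear_combination (x 0 ^ 2 + x 1 ^ 2) * this } rfl

lemma rotation_apply_zero (ω : Dir) (x : Plane) : rotation ω x 0 = cross x ω := rfl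

lemma volume_circularSegment_le {r₁ r₂ : ℝ} (hr₁ : 0 < r₁) (hr : r₁ < r₂) :
    volume {y : Plane | ‖y‖ ≤ r₂ ∧ r₁ ≤ y 0} ≤
      ENNReal.ofReal (2 * r₂ ^ 2 * capIntegral (r₁ / r₂)) := by
  have hr₂ : 0 < r₂ := hr₁.trans hr
  set e : Plane → ℝ × ℝ := fun y => (y 0, y 1)
  have he : MeasurePreserving e volume volume :=
    (volume_preserving_finTwoArrow ℝ).comp (PiLp.volume_preserving_ofLp (Fin 2))
  set S : Set (ℝ × ℝ) := {p | r₁ ≤ p.1 ∧ p.1 ≤ r₂ ∧ p.1 ^ 2 + p.2 ^ 2 ≤ r₂ ^ 2} with hSdef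
  have hS : MeasurableSet S := by
    refine IsClosed.measurableSet (IsClosed.and ?_ (IsClosed.and ?_ ?_))
    all_goals exact isClosed_le (by fun_prop) (by fun_prop)
  have hsub : {y : Plane | ‖y‖ ≤ r₂ ∧ r₁ ≤ y 0} = e ⁻¹' S := by
    ext y
    have hn := norm_sq_plane y
    simp only [mem_ofPred_eq, mem_preimage, hSdef, e]
    constructor
    · rintro ⟨h1, h2⟩
      have : ‖y‖ ^ 2 ≤ r₂ ^ 2 := by gcongr
      exact ⟨h2, by nlinarith [sq_nonneg (y 1)], by linarith⟩
    · rintro ⟨h1, h2, h3⟩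
      exact ⟨by rw [← abs_of_nonneg (norm_nonneg y), ← abs_of_pos hr₂, ← sq_le_sq]; linarith, h1⟩
  rw [hsub, he.measure_preimage hS.nullMeasurableSet, Measure.volume_eq_prod,
    Measure.prod_apply hS]
  have hslice : ∀ a : ℝ, volume (Prod.mk a ⁻¹' S) ≤
      (Icc r₁ r₂).indicator (fun a => ENNReal.ofReal (2 * √(r₂ ^ 2 - a ^ 2))) a := by
    intro a
    by_cases ha : a ∈ Icc r₁ r₂
    · rw [indicator_of_mem ha]
      have : Prod.mk a ⁻¹' S ⊆ Icc (-√(r₂ ^ 2 - a ^ 2)) √(r₂ ^ 2 - a ^ 2) := by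
        rintro b ⟨-, -, h⟩
        rw [mem_Icc, ← abs_le]
        refine Real.abs_le_sqrt ?_
        simp only at h
        linarith
      refine (measure_mono this).trans (le_of_eq ?_)
      rw [Real.volume_Icc]
      congr 1; ring
    · have : Prod.mk a ⁻¹' S = ∅ := by
        ext b
        simp only [mem_preimage, hSdef, mem_ofPred_eq, mem_empty_iff_false, iff_false]
        exact fun h => ha ⟨h.1, h.2.1⟩
      rw [this]; simp
  refine (lintegral_mono hslice).trans ?_
  rw [lintegral_indicator measurableSet_Icc, ← ofReal_integral_eq_lintegral_ofReal]
  · refine ENNReal.ofReal_le_ofReal (le_of_eq ?_)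
    rw [integral_Icc_eq_integral_Ioc, ← intervalIntegral.integral_of_le hr.le]
    have h := intervalIntegral.integral_comp_div (a := r₁) (b := r₂)
      (fun v => √(1 - v ^ 2)) hr₂.ne'
    rw [div_self hr₂.ne', smul_eq_mul] at h
    unfold capIntegral
    have e2 : ∀ a : ℝ, 2 * √(r₂ ^ 2 - a ^ 2) = 2 * r₂ * √(1 - (a / r₂) ^ 2) := by
      intro a
      have : r₂ ^ 2 - a ^ 2 = r₂ ^ 2 * (1 - (a / r₂) ^ 2) := by field_simp
      rw [this, Real.sqrt_mul (by positivity), Real.sqrt_sq hr₂.le]; ring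
    simp_rw [e2]
    rw [intervalIntegral.integral_const_mul, h]
    ring
  · exact Continuous.integrableOn_Icc (by fun_prop)
  · exact Eventually.of_forall fun a => by positivity

lemma isClosed_cap (r₂ : ℝ) : IsClosed (cap r₂) :=
  IsClosed.and (isClosed_le (by fun_prop) (by fun_prop)) (isClosed_le (by fun_prop) (by fun_prop))

lemma volume_coord_eq_zero (i : Fin 2) (a : ℝ) : volume {p : Plane | p i = a} = 0 := by
  have h : volume {f : Fin 2 → ℝ | f i = a} = 0 := by
    rw [volume_pi]; exact Measure.pi_hyperplane (α := fun _ => ℝ) (fun _ => volume) i a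
  have hm : MeasurableSet {f : Fin 2 → ℝ | f i = a} :=
    measurableSet_eq_fun (measurable_pi_apply i) measurable_const
  rw [← (PiLp.volume_preserving_ofLp (Fin 2)).measure_preimage hm.nullMeasurableSet] at h
  exact h

/-- For a fixed direction, reflecting the part with negative angular momentum through the origin
packs the two pieces of the half disk into one circular segment. -/
lemma volume_capSlice_le {r₁ r₂ : ℝ} (hr₁ : 0 < r₁) (hr : r₁ < r₂) (ω : Dir) :
    volume {x : Plane | x ∈ cap r₂ ∧ r₁ ≤ |cross x ω|} ≤
      ENNReal.ofReal (2 * r₂ ^ 2 * capIntegral (r₁ / r₂)) := by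
  set A : Set Plane := {x | x ∈ cap r₂ ∧ r₁ ≤ cross x ω}
  set B : Set Plane := {x | x ∈ cap r₂ ∧ r₁ ≤ -cross x ω}
  have hc0 : Continuous fun x : Plane => cross x ω := by unfold cross; fun_prop
  have hB : MeasurableSet B :=
    ((isClosed_cap r₂).and (isClosed_le continuous_const hc0.neg)).measurableSet
  have hsub : {x : Plane | x ∈ cap r₂ ∧ r₁ ≤ |cross x ω|} ⊆ A ∪ B := by
    rintro x ⟨h1, h2⟩
    rcases le_abs.1 h2 with h | h
    · exact Or.inl ⟨h1, h⟩
    · exact Or.inr ⟨h1, h⟩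
  have hnegB : volume (Neg.neg ⁻¹' B) = volume B :=
    (Measure.measurePreserving_neg (volume : Measure Plane)).measure_preimage hB.nullMeasurableSet
  have hdisj : AEDisjoint volume A (Neg.neg ⁻¹' B) := by
    refine measure_mono_null ?_ (volume_coord_eq_zero 1 0)
    rintro x ⟨hA, hB⟩
    have h1 := hA.1.2
    have h2 := hB.1.2
    simp only [PiLp.neg_apply] at h2
    simp only [mem_ofPred_eq]
    linarith
  have hseg : A ∪ Neg.neg ⁻¹' B ⊆ rotation ω ⁻¹' {y : Plane | ‖y‖ ≤ r₂ ∧ r₁ ≤ y 0} := by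
    rintro x (h | h)
    · refine ⟨?_, ?_⟩
      · rw [LinearIsometryEquiv.norm_map]; exact h.1.1
      · rw [rotation_apply_zero]; exact h.2
    · refine ⟨?_, ?_⟩
      · have := h.1.1
        rw [norm_neg] at this
        rwa [LinearIsometryEquiv.norm_map]
      · rw [rotation_apply_zero]
        have := h.2
        simp only [cross, PiLp.neg_apply] at this ⊢
        linarith
  have hmeas : MeasurableSet {y : Plane | ‖y‖ ≤ r₂ ∧ r₁ ≤ y 0} := by
    refine (IsClosed.and ?_ ?_).measurableSet
    all_goals exact isClosed_le (by fun_prop) (by fun_prop)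
  calc _ ≤ volume (A ∪ B) := measure_mono hsub
    _ ≤ volume A + volume B := measure_union_le _ _
    _ = volume (A ∪ Neg.neg ⁻¹' B) := by
        rw [measure_union₀ (measurable_neg hB).nullMeasurableSet hdisj, hnegB]
    _ ≤ volume (rotation ω ⁻¹' {y : Plane | ‖y‖ ≤ r₂ ∧ r₁ ≤ y 0}) := measure_mono hseg
    _ = volume {y : Plane | ‖y‖ ≤ r₂ ∧ r₁ ≤ y 0} :=
        (rotation ω).measurePreserving.measure_preimage hmeas.nullMeasurableSet
    _ ≤ _ := volume_circularSegment_le hr₁ hr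

/-- Phase points over the semidisk whose angular momentum is at least `r₁` in absolute value. -/
def annularRegion (r₁ r₂ : ℝ) : Set (Plane × Dir) :=
  {z | z.1 ∈ cap r₂ ∧ r₁ ≤ |cross z.1 z.2|}

/-- The product of Lebesgue measure on the plane and arc length on the circle. -/
noncomputable def phaseMeasure : Measure (Plane × Dir) :=
  (volume : Measure Plane).prod (volume : Measure Plane).toSphere

lemma toSphere_univ :
    (volume : Measure Plane).toSphere univ = ENNReal.ofReal (2 * Real.pi) := by
  rw [Measure.toSphere_apply_univ, EuclideanSpace.volume_ball_fin_two]
  rw [ENNReal.ofReal_mul (by norm_num)]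
  simp [finrank_euclideanSpace]

lemma phaseMeasure_annularRegion_le {r₁ r₂ : ℝ} (hr₁ : 0 < r₁) (hr : r₁ < r₂) :
    phaseMeasure (annularRegion r₁ r₂) ≤
      ENNReal.ofReal (4 * Real.pi * r₂ ^ 2 * capIntegral (r₁ / r₂)) := by
  have hE : MeasurableSet (annularRegion r₁ r₂) := by
    refine IsClosed.measurableSet (IsClosed.and ?_ ?_)
    · exact (isClosed_cap r₂).preimage continuous_fst
    · refine isClosed_le (by fun_prop) ?_
      unfold cross; fun_prop
  unfold phaseMeasure
  rw [Measure.prod_apply_symm hE]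
  calc _ ≤ ∫⁻ _ : Dir, ENNReal.ofReal (2 * r₂ ^ 2 * capIntegral (r₁ / r₂))
        ∂(volume : Measure Plane).toSphere := lintegral_mono fun ω => volume_capSlice_le hr₁ hr ω
    _ = _ := by
      rw [lintegral_const, toSphere_univ, ← ENNReal.ofReal_mul']
      · congr 1; ring
      · positivity

/-! ### Reflections of oriented lines -/

/-- Parametrised lines `s ↦ x + s v` in the plane, of arbitrary speed. -/
abbrev Line : Type := Plane × Plane

/-- The point of a parametrised line at time `s`. -/
def Line.at (z : Line) (s : ℝ) : Plane := z.1 + s • z.2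

/-- Reversal of time. -/
def Line.reverse (z : Line) : Line := (z.1, -z.2)

lemma Line.reverse_at (z : Line) (s : ℝ) : z.reverse.at s = z.at (-s) := by
  simp [Line.at, Line.reverse]

/-- The mirror image of a direction in the line orthogonal to the unit vector `N`. -/
noncomputable def mirror (N v : Plane) : Plane := v - (2 * inner ℝ v N) • N

/-- The line which a particle on `z` follows after a collision at time `s` at a point with unit
normal `N`, extrapolated backwards so that both lines are at the same point at time `s`. -/
noncomputable def Line.bounce (z : Line) (s : ℝ) (N : Plane) : Line :=
  (z.at s - s • mirror N z.2, mirror N z.2)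

lemma Line.bounce_at (z : Line) (s : ℝ) (N : Plane) : (z.bounce s N).at s = z.at s := by
  simp [Line.at, Line.bounce]

lemma mirror_mirror {N : Plane} (hN : ‖N‖ = 1) (v : Plane) : mirror N (mirror N v) = v := by
  have h : inner ℝ N N = (1 : ℝ) := by rw [real_inner_self_eq_norm_sq, hN]; norm_num
  unfold mirror
  rw [inner_sub_left, real_inner_smul_left, h]
  module

lemma inner_mirror {N : Plane} (hN : ‖N‖ = 1) (v : Plane) :
    inner ℝ (mirror N v) N = -inner ℝ v N := by
  have h : inner ℝ N N = (1 : ℝ) := by rw [real_inner_self_eq_norm_sq, hN]; norm_num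
  unfold mirror
  rw [inner_sub_left, real_inner_smul_left, h]
  ring

lemma norm_mirror {N : Plane} (hN : ‖N‖ = 1) (v : Plane) : ‖mirror N v‖ = ‖v‖ := by
  have h : inner ℝ N N = (1 : ℝ) := by rw [real_inner_self_eq_norm_sq, hN]; norm_num
  rw [← sq_eq_sq₀ (norm_nonneg _) (norm_nonneg _), ← real_inner_self_eq_norm_sq,
    ← real_inner_self_eq_norm_sq]
  unfold mirror
  rw [inner_sub_left, inner_sub_right, inner_sub_right]
  simp only [real_inner_smul_left, real_inner_smul_right, h]
  rw [real_inner_comm v N]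
  ring

lemma mirror_smul (N v : Plane) (c : ℝ) : mirror N (c • v) = c • mirror N v := by
  unfold mirror
  rw [real_inner_smul_left]
  module

lemma mirror_neg (N v : Plane) : mirror N (-v) = -mirror N v := by
  simpa using mirror_smul N v (-1)

/-- The bounce off the straight line `⟨q, N⟩ = d`; no collision time is needed. -/
noncomputable def flatBounce (N : Plane) (d : ℝ) (z : Line) : Line :=
  (z.1 + (2 * (d - inner ℝ z.1 N)) • N, mirror N z.2)

lemma flatBounce_eq {N : Plane} {d s : ℝ} {z : Line} (h : inner ℝ (z.at s) N = d) :
    flatBounce N d z = z.bounce s N := by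
  unfold flatBounce Line.bounce
  rw [← h]
  ext1
  · simp only [Line.at, mirror, inner_add_left, real_inner_smul_left]
    module
  · rfl

lemma flatBounce_flatBounce {N : Plane} (hN : ‖N‖ = 1) (d : ℝ) (z : Line) :
    flatBounce N d (flatBounce N d z) = z := by
  have h : inner ℝ N N = (1 : ℝ) := by rw [real_inner_self_eq_norm_sq, hN]; norm_num
  unfold flatBounce
  ext1
  · simp only [inner_add_left, real_inner_smul_left, h]
    module
  · exact mirror_mirror hN _

lemma differentiable_flatBounce (N : Plane) (d : ℝ) : Differentiable ℝ (flatBounce N d) := by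
  have h1 : Differentiable ℝ fun z : Line => inner ℝ z.1 N :=
    differentiable_fst.inner ℝ (differentiable_const N)
  have h2 : Differentiable ℝ fun z : Line => inner ℝ z.2 N :=
    differentiable_snd.inner ℝ (differentiable_const N)
  unfold flatBounce mirror
  fun_prop

/-- The quarter discriminant of the equation `‖x + s v‖ = r`. -/
noncomputable def disc (r : ℝ) (z : Line) : ℝ :=
  (inner ℝ z.1 z.2) ^ 2 - ‖z.2‖ ^ 2 * (‖z.1‖ ^ 2 - r ^ 2)

/-- The time at which a line leaves the disk of radius `r` about the origin. -/
noncomputable def exitTime (r : ℝ) (z : Line) : ℝ :=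
  (-inner ℝ z.1 z.2 + √(disc r z)) / ‖z.2‖ ^ 2

/-- The bounce off the circle of radius `r` about the origin. -/
noncomputable def arcBounce (r : ℝ) (z : Line) : Line :=
  z.bounce (exitTime r z) (r⁻¹ • z.at (exitTime r z))

lemma norm_sq_at (z : Line) (s : ℝ) :
    ‖z.at s‖ ^ 2 = ‖z.1‖ ^ 2 + 2 * s * inner ℝ z.1 z.2 + s ^ 2 * ‖z.2‖ ^ 2 := by
  unfold Line.at
  rw [norm_add_sq_real, real_inner_smul_right, norm_smul, mul_pow, Real.norm_eq_abs, sq_abs]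
  ring

lemma inner_at (z : Line) (s : ℝ) :
    inner ℝ (z.at s) z.2 = inner ℝ z.1 z.2 + s * ‖z.2‖ ^ 2 := by
  unfold Line.at
  rw [inner_add_left, real_inner_smul_left, real_inner_self_eq_norm_sq]

lemma disc_eq_of_norm_at {r s : ℝ} {z : Line} (h : ‖z.at s‖ = r) :
    disc r z = (inner ℝ (z.at s) z.2) ^ 2 := by
  rw [inner_at]
  unfold disc
  rw [← h, norm_sq_at]
  ring

lemma exitTime_eq {r s : ℝ} {z : Line} (h : ‖z.at s‖ = r)
    (hpos : 0 < inner ℝ (z.at s) z.2) : exitTime r z = s := by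
  have hv : z.2 ≠ 0 := by rintro h0; rw [h0] at hpos; simp at hpos
  have hv' : ‖z.2‖ ^ 2 ≠ 0 := by positivity
  unfold exitTime
  rw [disc_eq_of_norm_at h, Real.sqrt_sq hpos.le, inner_at, div_eq_iff hv']
  ring

lemma snd_ne_zero_of_disc_pos {r : ℝ} {z : Line} (h : 0 < disc r z) : z.2 ≠ 0 := by
  rintro h0
  simp [disc, h0] at h

lemma inner_at_exitTime {r : ℝ} {z : Line} (h : 0 < disc r z) :
    inner ℝ (z.at (exitTime r z)) z.2 = √(disc r z) := by
  have hv := snd_ne_zero_of_disc_pos h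
  have hv' : ‖z.2‖ ^ 2 ≠ 0 := by positivity
  rw [inner_at]
  unfold exitTime
  field_simp
  ring

lemma norm_at_exitTime {r : ℝ} (hr : 0 < r) {z : Line} (h : 0 < disc r z) :
    ‖z.at (exitTime r z)‖ = r := by
  have hv := snd_ne_zero_of_disc_pos h
  have hv' : ‖z.2‖ ^ 2 ≠ 0 := by positivity
  rw [← sq_eq_sq₀ (norm_nonneg _) hr.le]
  have h1 := inner_at_exitTime h
  have h2 : √(disc r z) ^ 2 = disc r z := Real.sq_sqrt h.le
  rw [← h1, inner_at] at h2
  rw [norm_sq_at]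
  unfold disc at h2
  have : ‖z.2‖ ^ 2 * (‖z.1‖ ^ 2 + 2 * exitTime r z * inner ℝ z.1 z.2 +
      exitTime r z ^ 2 * ‖z.2‖ ^ 2) = ‖z.2‖ ^ 2 * r ^ 2 := by linear_combination h2
  exact mul_left_cancel₀ hv' this

lemma arcBounce_eq {r s : ℝ} {z : Line} (h : ‖z.at s‖ = r)
    (hpos : 0 < inner ℝ (z.at s) z.2) : arcBounce r z = z.bounce s (r⁻¹ • z.at s) := by
  unfold arcBounce
  rw [exitTime_eq h hpos]

lemma norm_inv_smul_at {r s : ℝ} (hr : 0 < r) {z : Line} (h : ‖z.at s‖ = r) :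
    ‖r⁻¹ • z.at s‖ = 1 := by
  rw [norm_smul, h, norm_inv, Real.norm_eq_abs, abs_of_pos hr, inv_mul_cancel₀ hr.ne']

/-- The bounce off the circle is inverted by conjugation with time reversal. -/
lemma reverse_arcBounce {r : ℝ} (hr : 0 < r) {z : Line} (h : 0 < disc r z) :
    0 < disc r (arcBounce r z).reverse ∧
      (arcBounce r (arcBounce r z).reverse).reverse = z := by
  set s := exitTime r z with hs
  have hq : ‖z.at s‖ = r := norm_at_exitTime hr h
  have hb : 0 < inner ℝ (z.at s) z.2 := by
    rw [inner_at_exitTime h]; exact Real.sqrt_pos.2 h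
  set N := r⁻¹ • z.at s with hN
  have hN1 : ‖N‖ = 1 := norm_inv_smul_at hr hq
  have hw : arcBounce r z = z.bounce s N := rfl
  set w := (arcBounce r z).reverse with hwdef
  have hat : w.at (-s) = z.at s := by
    rw [hwdef, Line.reverse_at, neg_neg, hw, Line.bounce_at]
  have hin : inner ℝ (w.at (-s)) w.2 = inner ℝ (z.at s) z.2 := by
    rw [hat]
    have e : z.at s = r • N := by rw [hN, smul_smul, mul_inv_cancel₀ hr.ne', one_smul]
    have e2 : w.2 = -mirror N z.2 := rfl
    have aux : ∀ {N v : Plane}, ‖N‖ = 1 → inner ℝ (r • N) (-mirror N v) = inner ℝ (r • N) v := by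
      intro N v hN
      rw [inner_neg_right, real_inner_smul_left, real_inner_smul_left, real_inner_comm,
        inner_mirror hN, real_inner_comm]
      ring
    rw [e2, e, aux hN1]
  have hwn : ‖w.at (-s)‖ = r := by rw [hat, hq]
  refine ⟨?_, ?_⟩
  · rw [disc_eq_of_norm_at hwn, hin]; positivity
  · rw [arcBounce_eq hwn (by rw [hin]; exact hb), hat]
    have e2 : w.2 = -mirror N z.2 := rfl
    unfold Line.bounce
    rw [e2, mirror_neg, ← hN, mirror_mirror hN1, hat]
    ext1
    · simp [Line.reverse, Line.at]
    · simp [Line.reverse]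

lemma differentiableAt_arcBounce {r : ℝ} {z : Line} (h : 0 < disc r z) :
    DifferentiableAt ℝ (arcBounce r) z := by
  have hv := snd_ne_zero_of_disc_pos h
  have hv' : ‖z.2‖ ^ 2 ≠ 0 := by positivity
  have hn1 : DifferentiableAt ℝ (fun z : Line => ‖z.1‖ ^ 2) z :=
    (differentiableAt_fst).norm_sq ℝ
  have hn2 : DifferentiableAt ℝ (fun z : Line => ‖z.2‖ ^ 2) z :=
    (differentiableAt_snd).norm_sq ℝ
  have hi : DifferentiableAt ℝ (fun z : Line => inner ℝ z.1 z.2) z :=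
    differentiableAt_fst.inner ℝ differentiableAt_snd
  have hd : DifferentiableAt ℝ (disc r) z := by
    unfold disc
    exact (hi.pow 2).sub (hn2.mul (hn1.sub_const _))
  have hs : DifferentiableAt ℝ (exitTime r) z := by
    unfold exitTime
    simp only [div_eq_mul_inv]
    exact (hi.neg.add (hd.sqrt h.ne')).mul (hn2.inv hv')
  have hq : DifferentiableAt ℝ (fun z : Line => z.at (exitTime r z)) z := by
    unfold Line.at
    exact differentiableAt_fst.add (hs.smul differentiableAt_snd)
  have hm : DifferentiableAt ℝ (fun z : Line => mirror (r⁻¹ • z.at (exitTime r z)) z.2) z := by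
    unfold mirror
    have hN := hq.const_smul r⁻¹
    exact differentiableAt_snd.sub (((differentiableAt_snd.inner ℝ hN).const_mul (2 : ℝ)).smul hN)
  unfold arcBounce Line.bounce
  exact (hq.sub (hs.smul hm)).prodMk hm

lemma measurable_disc (r : ℝ) : Measurable (disc r) := by
  unfold disc; fun_prop

lemma measurable_arcBounce (r : ℝ) : Measurable (arcBounce r) := by
  have hs : Measurable (exitTime r) := by
    unfold exitTime
    have := measurable_disc r
    fun_prop
  unfold arcBounce Line.bounce mirror Line.at
  fun_prop

/-! ### Negligible sets of lines -/

/-- Sets of lines which are null for Lebesgue measure and do not depend on the speed. -/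
structure Negligible (Z : Set Line) : Prop where
  measurable : MeasurableSet Z
  null : (volume : Measure Plane).prod volume Z = 0
  smul : ∀ z ∈ Z, ∀ c : ℝ, 0 < c → (z.1, c • z.2) ∈ Z

lemma Negligible.iUnion {ι : Type*} [Countable ι] {Z : ι → Set Line}
    (h : ∀ i, Negligible (Z i)) : Negligible (⋃ i, Z i) where
  measurable := MeasurableSet.iUnion fun i => (h i).measurable
  null := measure_iUnion_null fun i => (h i).null
  smul := fun z hz c hc => by
    obtain ⟨i, hi⟩ := mem_iUnion.1 hz
    exact mem_iUnion.2 ⟨i, (h i).smul z hi c hc⟩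

lemma Negligible.union {Z W : Set Line} (hZ : Negligible Z) (hW : Negligible W) :
    Negligible (Z ∪ W) where
  measurable := hZ.measurable.union hW.measurable
  null := measure_union_null hZ.null hW.null
  smul := fun z hz c hc => hz.imp (fun h => hZ.smul z h c hc) fun h => hW.smul z h c hc

/-- A map with a differentiable left inverse pulls null sets back to null sets. -/
lemma null_preimage_of_leftInverse {D N : Set Line} {T S : Line → Line}
    (hS : ∀ z ∈ D, DifferentiableAt ℝ S (T z)) (hST : ∀ z ∈ D, S (T z) = z)
    (hN : (volume : Measure Plane).prod volume N = 0) :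
    (volume : Measure Plane).prod volume (D ∩ T ⁻¹' N) = 0 := by
  refine measure_mono_null (t := S '' (N ∩ T '' D)) ?_ ?_
  · rintro z ⟨hz, hzN⟩
    exact ⟨T z, ⟨hzN, mem_image_of_mem T hz⟩, hST z hz⟩
  · refine addHaar_image_eq_zero_of_differentiableOn_of_addHaar_eq_zero _ ?_
      (measure_mono_null inter_subset_left hN)
    rintro _ ⟨-, z, hz, rfl⟩
    exact (hS z hz).differentiableWithinAt

lemma Negligible.flat_preimage {Z : Set Line} (hZ : Negligible Z) {N : Plane} (hN : ‖N‖ = 1)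
    (d : ℝ) : Negligible (flatBounce N d ⁻¹' Z) where
  measurable := (differentiable_flatBounce N d).continuous.measurable hZ.measurable
  null := by
    have := null_preimage_of_leftInverse (D := univ) (T := flatBounce N d)
      (S := flatBounce N d) (fun z _ => (differentiable_flatBounce N d).differentiableAt)
      (fun z _ => flatBounce_flatBounce hN d z) hZ.null
    rwa [univ_inter] at this
  smul := fun z hz c hc => by
    have := hZ.smul _ hz c hc
    have e : flatBounce N d (z.1, c • z.2) = ((flatBounce N d z).1, c • (flatBounce N d z).2) := by
      simp [flatBounce, mirror_smul]
    rw [mem_preimage, e]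
    exact this

lemma measurable_reverse : Measurable Line.reverse := by
  unfold Line.reverse; fun_prop

lemma differentiable_reverse : Differentiable ℝ Line.reverse := by
  unfold Line.reverse; fun_prop

lemma reverse_reverse (z : Line) : z.reverse.reverse = z := by simp [Line.reverse]

lemma Negligible.reverse_preimage {Z : Set Line} (hZ : Negligible Z) :
    Negligible (Line.reverse ⁻¹' Z) where
  measurable := measurable_reverse hZ.measurable
  null := by
    have := null_preimage_of_leftInverse (D := univ) (T := Line.reverse)
      (S := Line.reverse) (fun z _ => differentiable_reverse.differentiableAt)
      (fun z _ => reverse_reverse z) hZ.null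
    rwa [univ_inter] at this
  smul := fun z hz c hc => by
    have := hZ.smul _ hz c hc
    simpa [Line.reverse] using this

lemma disc_smul (r : ℝ) (z : Line) (c : ℝ) : disc r (z.1, c • z.2) = c ^ 2 * disc r z := by
  unfold disc
  simp only [real_inner_smul_right, norm_smul, mul_pow, Real.norm_eq_abs, sq_abs]
  ring

lemma arcBounce_smul {r : ℝ} (hr : 0 < r) {z : Line} (h : 0 < disc r z) {c : ℝ} (hc : 0 < c) :
    arcBounce r (z.1, c • z.2) = ((arcBounce r z).1, c • (arcBounce r z).2) := by
  have hc' := hc.ne'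
  have hat : Line.at (z.1, c • z.2) (exitTime r z / c) = z.at (exitTime r z) := by
    unfold Line.at
    rw [smul_smul, div_mul_cancel₀ _ hc']
  have hq := norm_at_exitTime hr h
  have hb := inner_at_exitTime h
  rw [arcBounce_eq (s := exitTime r z / c) (by rw [hat, hq]), hat]
  · unfold arcBounce Line.bounce
    simp only [hat, mirror_smul, smul_smul, div_mul_cancel₀ _ hc']
  · rw [hat, real_inner_smul_right, hb]
    exact mul_pos hc (Real.sqrt_pos.2 h)

lemma Negligible.arc_preimage {Z : Set Line} (hZ : Negligible Z) {r : ℝ} (hr : 0 < r) :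
    Negligible ({z | 0 < disc r z} ∩ arcBounce r ⁻¹' Z) where
  measurable := (measurableSet_lt measurable_const (measurable_disc r)).inter
    (measurable_arcBounce r hZ.measurable)
  null := by
    refine null_preimage_of_leftInverse (S := fun w => (arcBounce r w.reverse).reverse)
      (fun z hz => ?_) (fun z hz => (reverse_arcBounce hr hz).2) hZ.null
    exact differentiable_reverse.differentiableAt.comp _
      ((differentiableAt_arcBounce (reverse_arcBounce hr hz).1).comp _
        differentiable_reverse.differentiableAt)
  smul := fun z hz c hc => by
    have h0 : 0 < disc r z := hz.1
    refine ⟨?_, ?_⟩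
    · simp only [mem_ofPred_eq, disc_smul]; positivity
    · rw [mem_preimage, arcBounce_smul hr h0 hc]
      exact hZ.smul _ hz.2 c hc

lemma volume_cross_eq_zero {a : Plane} (ha : a ≠ 0) : volume {v : Plane | cross a v = 0} = 0 := by
  have h := Measure.addHaar_submodule (volume : Measure Plane)
    (LinearMap.ker (a 0 • PiLp.projₗ (𝕜 := ℝ) 2 (fun _ : Fin 2 => ℝ) 1 -
      a 1 • PiLp.projₗ (𝕜 := ℝ) 2 (fun _ : Fin 2 => ℝ) 0)) (by
      intro h
      apply ha
      have h0 : (!₂[1, 0] : Plane) ∈ (⊤ : Submodule ℝ Plane) := trivial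
      have h1 : (!₂[0, 1] : Plane) ∈ (⊤ : Submodule ℝ Plane) := trivial
      rw [← h] at h0 h1
      simp at h0 h1
      ext i
      fin_cases i
      · simpa using h1
      · simpa using h0)
  exact h

lemma measurable_cross_sub (c : Plane) : Measurable fun z : Line => cross (c - z.1) z.2 := by
  unfold cross
  fun_prop

/-- Almost no line passes through a given point. -/
lemma negligible_through (c : Plane) : Negligible {z : Line | cross (c - z.1) z.2 = 0} where
  measurable := measurableSet_eq_fun (measurable_cross_sub c) measurable_const
  null := by
    rw [Measure.measure_prod_null
      (measurableSet_eq_fun (measurable_cross_sub c) measurable_const)]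
    have : ∀ᵐ x : Plane, x ≠ c := by
      rw [ae_iff]; simp
    filter_upwards [this] with x hx
    exact volume_cross_eq_zero (sub_ne_zero.2 hx.symm)
  smul := fun z hz c hc => by
    simp only [mem_ofPred_eq, cross, PiLp.smul_apply, smul_eq_mul] at hz ⊢
    linear_combination c * hz

/-- Almost no line has a direction parallel to a given one. -/
lemma negligible_parallel {a : Plane} (ha : a ≠ 0) : Negligible {z : Line | cross a z.2 = 0} where
  measurable := measurableSet_eq_fun (by unfold cross; fun_prop) measurable_const
  null := by
    have : {z : Line | cross a z.2 = 0} = univ ×ˢ {v : Plane | cross a v = 0} := by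
      ext z; simp
    rw [this, Measure.prod_prod, volume_cross_eq_zero ha, mul_zero]
  smul := fun z hz c hc => by
    simp only [mem_ofPred_eq, cross, PiLp.smul_apply, smul_eq_mul] at hz ⊢
    linear_combination c * hz

/-- A negligible set of lines is null for the phase measure on unit directions. -/
lemma Negligible.phaseMeasure_eq_zero {Z : Set Line} (hZ : Negligible Z) :
    phaseMeasure {z : Plane × Dir | (z.1, (z.2 : Plane)) ∈ Z} = 0 := by
  have hm : MeasurableSet {z : Plane × Dir | (z.1, (z.2 : Plane)) ∈ Z} := by
    have : Measurable fun z : Plane × Dir => ((z.1, (z.2 : Plane)) : Line) := by fun_prop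
    exact this hZ.measurable
  unfold phaseMeasure
  rw [Measure.measure_prod_null hm]
  filter_upwards [Measure.measure_ae_null_of_prod_null hZ.null] with x hx
  have hmx : MeasurableSet (Prod.mk x ⁻¹' {z : Plane × Dir | (z.1, (z.2 : Plane)) ∈ Z}) :=
    measurable_prodMk_left hm
  rw [Measure.toSphere_apply' _ hmx]
  simp only [Pi.zero_apply, mul_eq_zero]
  right
  refine measure_mono_null ?_ hx
  rintro _ ⟨c, hc, _, ⟨ω, hω, rfl⟩, rfl⟩
  exact hZ.smul _ hω c hc.1

/-! ### The exceptional set of lines -/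

/-- The six corners of the mushroom. -/
def corner (r₁ r₂ t : ℝ) : Fin 6 → Plane :=
  ![!₂[r₂, 0], !₂[-r₂, 0], !₂[r₁, 0], !₂[-r₁, 0], !₂[r₁, -t], !₂[-r₁, -t]]

lemma norm_east : ‖(!₂[1, 0] : Plane)‖ = 1 := by
  rw [← sq_eq_sq₀ (norm_nonneg _) zero_le_one, norm_sq_plane]; simp

lemma norm_west : ‖(!₂[-1, 0] : Plane)‖ = 1 := by
  rw [← sq_eq_sq₀ (norm_nonneg _) zero_le_one, norm_sq_plane]; simp

lemma norm_south : ‖(!₂[0, -1] : Plane)‖ = 1 := by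
  rw [← sq_eq_sq₀ (norm_nonneg _) zero_le_one, norm_sq_plane]; simp

lemma OuterNormal.norm_eq_one {r₁ r₂ t : ℝ} (hr₂ : 0 < r₂) {q N : Plane}
    (h : OuterNormal r₁ r₂ t q N) : ‖N‖ = 1 := by
  cases h with
  | arc hp hp' =>
    rw [norm_smul, hp, norm_inv, Real.norm_eq_abs, abs_of_pos hr₂, inv_mul_cancel₀ hr₂.ne']
  | ledge => exact norm_south
  | right => exact norm_east
  | left => exact norm_west
  | bottom => exact norm_south

/-- The lines through a corner and the lines parallel to an axis. -/
def singularLines (r₁ r₂ t : ℝ) : Set Line :=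
  (⋃ i, {z : Line | cross (corner r₁ r₂ t i - z.1) z.2 = 0}) ∪
    ({z : Line | cross !₂[1, 0] z.2 = 0} ∪ {z : Line | cross !₂[0, 1] z.2 = 0})

lemma negligible_singularLines (r₁ r₂ t : ℝ) : Negligible (singularLines r₁ r₂ t) := by
  refine (Negligible.iUnion fun i => negligible_through _).union
    ((negligible_parallel ?_).union (negligible_parallel ?_))
  · intro h
    have := congrArg (fun v : Plane => v 0) h
    simp at this
  · intro h
    have := congrArg (fun v : Plane => v 1) h
    simp at this

/-- The lines that become singular after one bounce off one of the five boundary pieces. -/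
noncomputable def pullback (r₁ r₂ t : ℝ) (Z : Set Line) : Set Line :=
  ({z | 0 < disc r₂ z} ∩ arcBounce r₂ ⁻¹' Z) ∪
    ((flatBounce !₂[0, -1] 0 ⁻¹' Z ∪ flatBounce !₂[1, 0] r₁ ⁻¹' Z) ∪
      (flatBounce !₂[-1, 0] r₁ ⁻¹' Z ∪ flatBounce !₂[0, -1] t ⁻¹' Z))

lemma Negligible.pullback {Z : Set Line} (hZ : Negligible Z) {r₁ r₂ t : ℝ} (hr₂ : 0 < r₂) :
    Negligible (pullback r₁ r₂ t Z) :=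
  (hZ.arc_preimage hr₂).union
    (((hZ.flat_preimage norm_south 0).union (hZ.flat_preimage norm_east r₁)).union
      ((hZ.flat_preimage norm_west r₁).union (hZ.flat_preimage norm_south t)))

lemma mem_pullback {r₁ r₂ t : ℝ} {Z : Set Line} {z : Line} {s : ℝ} {N : Plane}
    (hN : OuterNormal r₁ r₂ t (z.at s) N) (hpos : 0 < inner ℝ z.2 N)
    (h : z.bounce s N ∈ Z) : z ∈ pullback r₁ r₂ t Z := by
  generalize hq : z.at s = q at hN
  cases hN with
  | arc hp hp' =>
    have hr : 0 < r₂ := by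
      rw [← hp, norm_pos_iff]
      rintro rfl; simp at hp'
    have hin : 0 < inner ℝ (z.at s) z.2 := by
      rw [real_inner_smul_right, real_inner_comm] at hpos
      rw [hq]
      exact pos_of_mul_pos_right hpos (by positivity)
    have hn : ‖z.at s‖ = r₂ := by rw [hq, hp]
    left
    refine ⟨?_, ?_⟩
    · simp only [mem_ofPred_eq, disc_eq_of_norm_at hn]; positivity
    · rw [mem_preimage, arcBounce_eq hn hin, hq]; exact h
  | ledge hp h₁ h₂ =>
    right; left; left
    rw [mem_preimage, flatBounce_eq (s := s)]
    · exact h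
    · rw [hq, inner_plane]; simp [hp]
  | right hp h₁ h₂ =>
    right; left; right
    rw [mem_preimage, flatBounce_eq (s := s)]
    · exact h
    · rw [hq, inner_plane]; simp [hp]
  | left hp h₁ h₂ =>
    right; right; left
    rw [mem_preimage, flatBounce_eq (s := s)]
    · exact h
    · rw [hq, inner_plane]; simp [hp]
  | bottom hp h₁ =>
    right; right; right
    rw [mem_preimage, flatBounce_eq (s := s)]
    · exact h
    · rw [hq, inner_plane]; simp [hp]

/-- The lines whose itinerary ends in a singular line after finitely many bounces. -/
noncomputable def exceptionalLines (r₁ r₂ t : ℝ) : Set Line :=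
  ⋃ n : ℕ, (pullback r₁ r₂ t)^[n] (singularLines r₁ r₂ t)

lemma negligible_exceptionalLines {r₁ r₂ t : ℝ} (hr₂ : 0 < r₂) :
    Negligible (exceptionalLines r₁ r₂ t) := by
  refine Negligible.iUnion fun n => ?_
  induction n with
  | zero => exact negligible_singularLines r₁ r₂ t
  | succ n ih => rw [Function.iterate_succ_apply']; exact ih.pullback hr₂

lemma singularLines_subset (r₁ r₂ t : ℝ) : singularLines r₁ r₂ t ⊆ exceptionalLines r₁ r₂ t :=
  fun _ hz => mem_iUnion.2 ⟨0, hz⟩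

lemma mem_exceptionalLines_of_bounce {r₁ r₂ t : ℝ} {z : Line} {s : ℝ} {N : Plane}
    (hN : OuterNormal r₁ r₂ t (z.at s) N) (hpos : 0 < inner ℝ z.2 N)
    (h : z.bounce s N ∈ exceptionalLines r₁ r₂ t) : z ∈ exceptionalLines r₁ r₂ t := by
  obtain ⟨n, hn⟩ := mem_iUnion.1 h
  refine mem_iUnion.2 ⟨n + 1, ?_⟩
  rw [Function.iterate_succ_apply']
  exact mem_pullback hN hpos hn

lemma at_ne_corner {r₁ r₂ t : ℝ} {z : Line} (hz : z ∉ singularLines r₁ r₂ t) (s : ℝ) (i : Fin 6) :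
    z.at s ≠ corner r₁ r₂ t i := by
  intro h
  refine hz (Or.inl (mem_iUnion.2 ⟨i, ?_⟩))
  rw [mem_ofPred_eq, ← h]
  simp [cross, Line.at]
  ring

lemma snd_ne_zero {r₁ r₂ t : ℝ} {z : Line} (hz : z ∉ singularLines r₁ r₂ t) : z.2 ≠ 0 := by
  intro h
  refine hz (Or.inr (Or.inl ?_))
  rw [mem_ofPred_eq, h]
  simp [cross]

/-! ### The interior of the mushroom -/

/-- An open subset of the mushroom whose complement in the mushroom consists of the smooth
boundary points and the corners. -/
def room (r₁ r₂ t : ℝ) : Set Plane :=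
  {p | (‖p‖ < r₂ ∧ 0 < p 1) ∨ (|p 0| < r₁ ∧ -t < p 1 ∧ (p 1 < 0 ∨ ‖p‖ < r₂))}

lemma isOpen_room (r₁ r₂ t : ℝ) : IsOpen (room r₁ r₂ t) := by
  refine IsOpen.union (IsOpen.and ?_ ?_) (IsOpen.and ?_ (IsOpen.and ?_
    (IsOpen.union (s₁ := {p : Plane | p 1 < 0}) (s₂ := {p : Plane | ‖p‖ < r₂}) ?_ ?_)))
  all_goals exact isOpen_lt (by fun_prop) (by fun_prop)

lemma room_subset_mushroom (r₁ r₂ t : ℝ) : room r₁ r₂ t ⊆ mushroom r₁ r₂ t := by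
  rintro p (⟨h1, h2⟩ | ⟨h1, h2, h3⟩)
  · exact Or.inr ⟨h1.le, h2.le⟩
  · rw [abs_lt] at h1
    rcases le_or_gt (p 1) 0 with h | h
    · exact Or.inl ⟨h1.1.le, h1.2.le, h2.le, h⟩
    · exact Or.inr ⟨(h3.resolve_left (by linarith)).le, h.le⟩

lemma isClosed_mushroom (r₁ r₂ t : ℝ) : IsClosed (mushroom r₁ r₂ t) := by
  refine IsClosed.union (IsClosed.and ?_ (IsClosed.and ?_ (IsClosed.and ?_ ?_))) (isClosed_cap r₂)
  all_goals exact isClosed_le (by fun_prop) (by fun_prop)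

lemma abs_coord_le_norm (p : Plane) (i : Fin 2) : |p i| ≤ ‖p‖ := by
  rw [← Real.norm_eq_abs]; exact PiLp.norm_apply_le p i

lemma norm_le_of_mem_mushroom {r₁ r₂ t : ℝ} (hr₁ : 0 < r₁) (ht : 0 < t) {p : Plane} (hr₂ : 0 < r₂)
    (hp : p ∈ mushroom r₁ r₂ t) : ‖p‖ ≤ r₁ + r₂ + t := by
  rcases hp with ⟨h1, h2, h3, h4⟩ | ⟨h1, h2⟩
  · rw [← abs_of_nonneg (norm_nonneg p), ← abs_of_pos (by linarith : 0 < r₁ + r₂ + t), ← sq_le_sq,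
      norm_sq_plane]
    have e1 : p 0 ^ 2 ≤ r₁ ^ 2 := sq_le_sq' h1 h2
    have e2 : p 1 ^ 2 ≤ t ^ 2 := sq_le_sq' h3 (by linarith)
    nlinarith [mul_pos hr₁ ht, mul_pos hr₁ hr₂, mul_pos ht hr₂]
  · linarith

/-- A point of the mushroom outside `room` is a smooth boundary point or a corner. -/
lemma exists_outerNormal_or_corner {r₁ r₂ t : ℝ} (hr₁ : 0 < r₁) (hr : r₁ < r₂) (ht : 0 < t)
    {p : Plane}
    (hp : p ∈ mushroom r₁ r₂ t) (hp' : p ∉ room r₁ r₂ t) :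
    (∃ N, OuterNormal r₁ r₂ t p N) ∨ ∃ i, p = corner r₁ r₂ t i := by
  have hext : ∀ {a b : ℝ}, p 0 = a → p 1 = b → p = !₂[a, b] := by
    intro a b h0 h1
    ext i
    fin_cases i
    · simpa using h0
    · simpa using h1
  have hnr : ∀ h : (‖p‖ < r₂ ∧ 0 < p 1) ∨ (|p 0| < r₁ ∧ -t < p 1 ∧ (p 1 < 0 ∨ ‖p‖ < r₂)),
    False := hp'
  have hr₂ : 0 < r₂ := hr₁.trans hr
  have hn := norm_sq_plane p
  rcases lt_trichotomy (p 1) 0 with h | h | h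
  · -- below the mouth, in the stalk
    obtain ⟨h1, h2, h3, -⟩ : p ∈ stalk r₁ t := by
      rcases hp with hp | hp
      · exact hp
      · have := hp.2; linarith
    have hor : |p 0| = r₁ ∨ p 1 = -t := by
      by_contra! hcon
      exact hnr (Or.inr ⟨lt_of_le_of_ne (abs_le.2 ⟨h1, h2⟩) hcon.1,
        lt_of_le_of_ne h3 (Ne.symm hcon.2), Or.inl h⟩)
    rcases eq_or_lt_of_le h3 with h3 | h3
    · rcases eq_or_lt_of_le (abs_le.2 ⟨h1, h2⟩) with h0 | h0
      · rcases (abs_eq hr₁.le).1 h0 with h0 | h0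
        · exact Or.inr ⟨4, hext h0 h3.symm⟩
        · exact Or.inr ⟨5, hext h0 h3.symm⟩
      · exact Or.inl ⟨_, .bottom p h3.symm h0⟩
    · rcases (abs_eq hr₁.le).1 (hor.resolve_right h3.ne') with h0 | h0
      · exact Or.inl ⟨_, .right p h0 h3 h⟩
      · exact Or.inl ⟨_, .left p h0 h3 h⟩
  · -- on the level of the mouth
    have habs : ‖p‖ = |p 0| := by
      rw [← abs_of_nonneg (norm_nonneg p), ← sq_eq_sq_iff_abs_eq_abs, hn, h]; ring
    have hle : |p 0| ≤ r₂ := by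
      rcases hp with hp | hp
      · exact (abs_le.2 ⟨hp.1, hp.2.1⟩).trans hr.le
      · rw [← habs]; exact hp.1
    have hge : r₁ ≤ |p 0| := by
      by_contra! hcon
      exact hnr (Or.inr ⟨hcon, by linarith, Or.inr (by rw [habs]; linarith)⟩)
    rcases eq_or_lt_of_le hge with h1 | h1
    · rcases (abs_eq hr₁.le).1 h1.symm with h0 | h0
      · exact Or.inr ⟨2, hext h0 h⟩
      · exact Or.inr ⟨3, hext h0 h⟩
    · rcases eq_or_lt_of_le hle with h2 | h2
      · rcases (abs_eq hr₂.le).1 h2 with h0 | h0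
        · exact Or.inr ⟨0, hext h0 h⟩
        · exact Or.inr ⟨1, hext h0 h⟩
      · exact Or.inl ⟨_, .ledge p h h1 h2⟩
  · have hle : ‖p‖ ≤ r₂ := by
      rcases hp with hp | hp
      · have := hp.2.2.2; linarith
      · exact hp.1
    have : ‖p‖ = r₂ := le_antisymm hle (not_lt.1 fun hlt => hnr (Or.inl ⟨hlt, h⟩))
    exact Or.inl ⟨_, .arc p this h⟩

/-- Near a smooth boundary point the interior lies on the inner side of the tangent line. -/
lemma OuterNormal.eventually_inner_neg {r₁ r₂ t : ℝ} {q N : Plane} (hr₂ : 0 < r₂)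
    (ht : 0 < t) (h : OuterNormal r₁ r₂ t q N) :
    ∀ᶠ p in 𝓝 q, p ∈ room r₁ r₂ t → inner ℝ (p - q) N < 0 := by
  have c0 : Continuous fun p : Plane => p 0 := by fun_prop
  have c1 : Continuous fun p : Plane => p 1 := by fun_prop
  have ca : Continuous fun p : Plane => |p 0| := by fun_prop
  cases h with
  | arc hp hp' =>
    filter_upwards [(c1.tendsto q).eventually (lt_mem_nhds hp')] with p h1 hG
    have hlt : ‖p‖ < r₂ := by
      rcases hG with hG | hG
      · exact hG.1
      · exact hG.2.2.resolve_left (by linarith)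
    rw [real_inner_smul_right, inner_sub_left, real_inner_self_eq_norm_sq, hp]
    have := real_inner_le_norm p q
    rw [hp] at this
    have h3 : inner ℝ p q - r₂ ^ 2 < 0 := by nlinarith
    have h4 : 0 < r₂⁻¹ := by positivity
    nlinarith
  | ledge hp h₁ h₂ =>
    filter_upwards [(ca.tendsto q).eventually (lt_mem_nhds h₁)] with p h1 hG
    rw [inner_plane]
    rcases hG with hG | hG
    · have := hG.2; simp [hp]; exact this
    · exact absurd hG.1 (by linarith)
  | right hp h₁ h₂ =>
    filter_upwards [(c1.tendsto q).eventually (gt_mem_nhds h₂)] with p h1 hG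
    rw [inner_plane]
    rcases hG with hG | hG
    · exact absurd hG.2 (by linarith)
    · have := (abs_lt.1 hG.1).2; simp [hp]; exact this
  | left hp h₁ h₂ =>
    filter_upwards [(c1.tendsto q).eventually (gt_mem_nhds h₂)] with p h1 hG
    rw [inner_plane]
    rcases hG with hG | hG
    · exact absurd hG.2 (by linarith)
    · have := (abs_lt.1 hG.1).1; simp [hp]; linarith
  | bottom hp h₁ =>
    filter_upwards [] with p hG
    rw [inner_plane]
    rcases hG with hG | hG
    · have := hG.2; simp [hp]; linarith
    · have := hG.2.1; simp [hp]; linarith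

/-- A line pointing inwards at a smooth boundary point enters the interior. -/
lemma OuterNormal.eventually_mem_room {r₁ r₂ t : ℝ} (ht : 0 < t) {q N v : Plane} (hr₁ : 0 < r₁)
    (hr : r₁ < r₂) (h : OuterNormal r₁ r₂ t q N) (hv : inner ℝ v N < 0) :
    ∀ᶠ u in 𝓝[>] (0 : ℝ), q + u • v ∈ room r₁ r₂ t := by
  have hr₂ : 0 < r₂ := hr₁.trans hr
  have hl : Tendsto (fun u : ℝ => q + u • v) (𝓝[>] 0) (𝓝 q) := by
    have : Continuous fun u : ℝ => q + u • v := by fun_prop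
    have h := (this.tendsto 0).mono_left (nhdsWithin_le_nhds (s := Ioi 0))
    simpa using h
  have hpos : ∀ᶠ u in 𝓝[>] (0 : ℝ), 0 < u := self_mem_nhdsWithin
  have c0 : Continuous fun p : Plane => p 0 := by fun_prop
  have c1 : Continuous fun p : Plane => p 1 := by fun_prop
  have ca : Continuous fun p : Plane => |p 0| := by fun_prop
  have cn : Continuous fun p : Plane => ‖p‖ := by fun_prop
  have l0 := (c0.tendsto q).comp hl
  have l1 := (c1.tendsto q).comp hl
  have la := (ca.tendsto q).comp hl
  have ln := (cn.tendsto q).comp hl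
  cases h with
  | arc hp hp' =>
    have hb : inner ℝ q v < 0 := by
      rw [real_inner_smul_right, real_inner_comm] at hv
      by_contra! hcon
      have : 0 ≤ r₂⁻¹ * inner ℝ q v := by positivity
      linarith
    have lq : Tendsto (fun u : ℝ => 2 * inner ℝ q v + u * ‖v‖ ^ 2) (𝓝[>] 0)
        (𝓝 (2 * inner ℝ q v)) := by
      have : Continuous fun u : ℝ => 2 * inner ℝ q v + u * ‖v‖ ^ 2 := by fun_prop
      have h := (this.tendsto 0).mono_left (nhdsWithin_le_nhds (s := Ioi 0))
      simpa using h
    filter_upwards [hpos, l1.eventually (lt_mem_nhds hp'),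
      lq.eventually (gt_mem_nhds (by linarith : 2 * inner ℝ q v < 0))] with u hu h1 h2
    left
    refine ⟨?_, h1⟩
    rw [← abs_of_nonneg (norm_nonneg _), ← abs_of_pos hr₂, ← sq_lt_sq]
    have := norm_sq_at (q, v) u
    simp only [Line.at] at this
    rw [this, hp]
    nlinarith
  | ledge hp h₁ h₂ =>
    rw [inner_plane] at hv
    have hn : ‖q‖ < r₂ := by
      have hn := norm_sq_plane q
      have : ‖q‖ = |q 0| := by
        rw [← abs_of_nonneg (norm_nonneg q), ← sq_eq_sq_iff_abs_eq_abs, hn, hp]; ring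
      rwa [this]
    filter_upwards [hpos, ln.eventually (gt_mem_nhds hn)] with u hu h1
    left
    refine ⟨h1, ?_⟩
    simp at hv
    simp [hp]; positivity
  | right hp h₁ h₂ =>
    rw [inner_plane] at hv
    filter_upwards [hpos, l0.eventually (lt_mem_nhds (by linarith : -r₁ < q 0)),
      l1.eventually (lt_mem_nhds h₁), l1.eventually (gt_mem_nhds h₂)] with u hu h1 h2 h3
    right
    refine ⟨abs_lt.2 ⟨h1, ?_⟩, h2, Or.inl h3⟩
    simp at hv
    simp [hp]; exact mul_neg_of_pos_of_neg hu hv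
  | left hp h₁ h₂ =>
    rw [inner_plane] at hv
    filter_upwards [hpos, l0.eventually (gt_mem_nhds (by linarith : q 0 < r₁)),
      l1.eventually (lt_mem_nhds h₁), l1.eventually (gt_mem_nhds h₂)] with u hu h1 h2 h3
    right
    refine ⟨abs_lt.2 ⟨?_, h1⟩, h2, Or.inl h3⟩
    simp at hv
    simp [hp]; positivity
  | bottom hp h₁ =>
    rw [inner_plane] at hv
    filter_upwards [hpos, la.eventually (gt_mem_nhds h₁),
      l1.eventually (gt_mem_nhds (by linarith : q 1 < 0))] with u hu h1 h2
    right
    refine ⟨h1, ?_, Or.inl h2⟩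
    simp at hv
    simp [hp]; positivity

/-! ### One-sided billiard orbits -/

/-- The line is in the interior of the table just after time `s`. -/
def Live (r₁ r₂ t : ℝ) (z : Line) (s : ℝ) : Prop := ∀ᶠ u in 𝓝[>] s, z.at u ∈ room r₁ r₂ t

lemma continuous_at (z : Line) : Continuous z.at := by
  unfold Line.at; fun_prop

lemma at_sub_at (z : Line) (u s : ℝ) : z.at u - z.at s = (u - s) • z.2 := by
  unfold Line.at; module

lemma exists_next_collision {r₁ r₂ t : ℝ} (hr₁ : 0 < r₁) (hr : r₁ < r₂) (ht : 0 < t) {z : Line}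
    (hz : z ∉ singularLines r₁ r₂ t) {s : ℝ} (hlive : Live r₁ r₂ t z s) :
    ∃ s' N, s < s' ∧ (∀ u ∈ Ioo s s', z.at u ∈ room r₁ r₂ t) ∧
      OuterNormal r₁ r₂ t (z.at s') N ∧ 0 < inner ℝ z.2 N ∧ Live r₁ r₂ t (z.bounce s' N) s' := by
  have hr₂ : 0 < r₂ := hr₁.trans hr
  have hv : z.2 ≠ 0 := snd_ne_zero hz
  obtain ⟨c, hc, hcG⟩ := mem_nhdsGT_iff_exists_Ioo_subset.1 hlive
  have hsc : s < c := hc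
  set S := Ici c ∩ z.at ⁻¹' (room r₁ r₂ t)ᶜ with hS
  have hcl : IsClosed S :=
    isClosed_Ici.inter ((isOpen_room r₁ r₂ t).isClosed_compl.preimage (continuous_at z))
  have hne : S.Nonempty := by
    -- the table is bounded and the speed is positive
    have hlim : Tendsto (fun u : ℝ => u * ‖z.2‖ - ‖z.1‖) atTop atTop :=
      tendsto_atTop_add_const_right _ _
        (tendsto_id.atTop_mul_const (norm_pos_iff.2 hv))
    obtain ⟨u, hu1, hu2, hu3⟩ := ((hlim.eventually_gt_atTop (r₁ + r₂ + t)).and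
      ((eventually_ge_atTop c).and (eventually_ge_atTop 0))).exists
    refine ⟨u, hu2, fun hmem => ?_⟩
    have h1 := norm_le_of_mem_mushroom hr₁ ht hr₂ (room_subset_mushroom _ _ _ hmem)
    have h2 : ‖u • z.2‖ ≤ ‖z.at u‖ + ‖z.1‖ := by
      have : u • z.2 = z.at u - z.1 := by simp [Line.at]
      rw [this]; exact norm_sub_le _ _
    rw [norm_smul, Real.norm_eq_abs, abs_of_nonneg hu3] at h2
    linarith
  have hbdd : BddBelow S := ⟨c, fun u hu => hu.1⟩
  set s' := sInf S
  have hs' : s' ∈ S := hcl.csInf_mem hne hbdd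
  have hcs' : c ≤ s' := hs'.1
  have hss' : s < s' := hsc.trans_le hcs'
  have hroom : ∀ u ∈ Ioo s s', z.at u ∈ room r₁ r₂ t := by
    intro u hu
    rcases lt_or_ge u c with h | h
    · exact hcG ⟨hu.1, h⟩
    · by_contra hcon
      exact absurd (csInf_le hbdd (⟨h, hcon⟩ : u ∈ S)) (not_le.2 hu.2)
  have hleft : ∀ᶠ u in 𝓝[<] s', z.at u ∈ room r₁ r₂ t := by
    filter_upwards [Ioo_mem_nhdsLT hss'] with u hu using hroom u hu
  have htend : Tendsto z.at (𝓝[<] s') (𝓝 (z.at s')) :=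
    ((continuous_at z).tendsto s').mono_left nhdsWithin_le_nhds
  have hmem : z.at s' ∈ mushroom r₁ r₂ t :=
    (isClosed_mushroom r₁ r₂ t).mem_of_tendsto htend
      (hleft.mono fun u hu => room_subset_mushroom _ _ _ hu)
  obtain ⟨N, hN⟩ : ∃ N, OuterNormal r₁ r₂ t (z.at s') N := by
    refine (exists_outerNormal_or_corner hr₁ hr ht hmem hs'.2).resolve_right ?_
    rintro ⟨i, hi⟩
    exact at_ne_corner hz s' i hi
  have hpos : 0 < inner ℝ z.2 N := by
    obtain ⟨u, hu1, hu2, hu3⟩ := ((htend.eventually (hN.eventually_inner_neg hr₂ ht)).and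
      (hleft.and self_mem_nhdsWithin)).exists
    have h := hu1 hu2
    have hu3' : u < s' := hu3
    rw [at_sub_at, real_inner_smul_left] at h
    by_contra! hcon
    nlinarith
  refine ⟨s', N, hss', hroom, hN, hpos, ?_⟩
  have hin : inner ℝ (mirror N z.2) N < 0 := by
    rw [inner_mirror (hN.norm_eq_one hr₂)]; linarith
  have h := hN.eventually_mem_room ht hr₁ hr hin
  have hshift : Tendsto (fun u : ℝ => u - s') (𝓝[>] s') (𝓝[>] 0) := by
    refine tendsto_nhdsWithin_iff.2 ⟨?_, ?_⟩
    · have : Continuous fun u : ℝ => u - s' := by fun_prop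
      simpa using (this.tendsto s').mono_left (nhdsWithin_le_nhds (s := Ioi s'))
    · filter_upwards [self_mem_nhdsWithin] with u hu
      exact sub_pos.2 (mem_Ioi.1 hu)
  filter_upwards [hshift.eventually h] with u hu
  have e : (z.bounce s' N).at u = z.at s' + (u - s') • mirror N z.2 := by
    unfold Line.bounce Line.at; module
  rwa [e]

/-- A forward billiard orbit: the `n`-th leg follows the line `l n` during the time interval
`[s n, s (n + 1)]` and ends with a collision at a point with outer normal `N n`. -/
structure IsOrbit (r₁ r₂ t : ℝ) (l : ℕ → Line) (s : ℕ → ℝ) (N : ℕ → Plane) : Prop where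
  lt : ∀ n, s n < s (n + 1)
  room : ∀ n, ∀ u ∈ Ioo (s n) (s (n + 1)), (l n).at u ∈ room r₁ r₂ t
  normal : ∀ n, OuterNormal r₁ r₂ t ((l n).at (s (n + 1))) (N n)
  hits : ∀ n, 0 < inner ℝ (l n).2 (N n)
  bounce : ∀ n, l (n + 1) = (l n).bounce (s (n + 1)) (N n)

lemma exists_isOrbit {r₁ r₂ t : ℝ} (hr₁ : 0 < r₁) (hr : r₁ < r₂) (ht : 0 < t) {z : Line}
    (hz : z ∉ exceptionalLines r₁ r₂ t) {s₀ : ℝ} (hlive : Live r₁ r₂ t z s₀) :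
    ∃ l s N, IsOrbit r₁ r₂ t l s N ∧ l 0 = z ∧ s 0 = s₀ := by
  let State := {p : Line × ℝ // p.1 ∉ exceptionalLines r₁ r₂ t ∧ Live r₁ r₂ t p.1 p.2}
  have hstep : ∀ p : State, ∃ s' N, p.1.2 < s' ∧
      (∀ u ∈ Ioo p.1.2 s', p.1.1.at u ∈ Mushroom.room r₁ r₂ t) ∧
      OuterNormal r₁ r₂ t (p.1.1.at s') N ∧ 0 < inner ℝ p.1.1.2 N ∧
      Live r₁ r₂ t (p.1.1.bounce s' N) s' := fun p =>
    exists_next_collision hr₁ hr ht (fun h => p.2.1 (singularLines_subset _ _ _ h)) p.2.2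
  choose s' N h1 h2 h3 h4 h5 using hstep
  let next : State → State := fun p => ⟨(p.1.1.bounce (s' p) (N p), s' p),
    fun h => p.2.1 (mem_exceptionalLines_of_bounce (h3 p) (h4 p) h), h5 p⟩
  let seq : ℕ → State := fun n => next^[n] ⟨(z, s₀), hz, hlive⟩
  have hseq : ∀ n, seq (n + 1) = next (seq n) := fun n => Function.iterate_succ_apply' next n _
  have hs : ∀ n, (seq (n + 1)).1.2 = s' (seq n) := fun n => by rw [hseq]
  refine ⟨fun n => (seq n).1.1, fun n => (seq n).1.2, fun n => N (seq n),
    ⟨fun n => ?_, fun n => ?_, fun n => ?_, fun n => h4 _, fun n => ?_⟩, rfl, rfl⟩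
  · simp only [hs]; exact h1 _
  · simp only [hs]; exact h2 _
  · simp only [hs]; exact h3 _
  · simp only [hs]; rw [hseq]

namespace IsOrbit

variable {r₁ r₂ t : ℝ} {l : ℕ → Line} {s : ℕ → ℝ} {N : ℕ → Plane}

lemma strictMono (h : IsOrbit r₁ r₂ t l s N) : StrictMono s := strictMono_nat_of_lt_succ h.lt

lemma snd_succ (h : IsOrbit r₁ r₂ t l s N) (n : ℕ) : (l (n + 1)).2 = mirror (N n) (l n).2 := by
  rw [h.bounce]; rfl

lemma at_succ (h : IsOrbit r₁ r₂ t l s N) (n : ℕ) :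
    (l (n + 1)).at (s (n + 1)) = (l n).at (s (n + 1)) := by
  rw [h.bounce, Line.bounce_at]

lemma norm_snd (h : IsOrbit r₁ r₂ t l s N) (hr₂ : 0 < r₂) (n : ℕ) : ‖(l n).2‖ = ‖(l 0).2‖ := by
  induction n with
  | zero => rfl
  | succ n ih => rw [h.snd_succ, norm_mirror ((h.normal n).norm_eq_one hr₂), ih]

lemma norm_at_sub_le (h : IsOrbit r₁ r₂ t l s N) (hr₂ : 0 < r₂) (n k : ℕ) :
    ‖(l (n + k)).at (s (n + k + 1)) - (l n).at (s (n + 1))‖ ≤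
      (s (n + k + 1) - s (n + 1)) * ‖(l 0).2‖ := by
  induction k with
  | zero => simp
  | succ k ih =>
    have e : (l (n + (k + 1))).at (s (n + (k + 1) + 1)) - (l n).at (s (n + 1)) =
        ((l (n + k + 1)).at (s (n + k + 1 + 1)) - (l (n + k + 1)).at (s (n + k + 1))) +
          ((l (n + k)).at (s (n + k + 1)) - (l n).at (s (n + 1))) := by
      rw [h.at_succ (n + k)]
      simp only [← add_assoc]
      abel
    rw [e, at_sub_at]
    refine (norm_add_le _ _).trans ?_
    have hlt := h.lt (n + k + 1)
    rw [norm_smul, h.norm_snd hr₂, Real.norm_eq_abs, abs_of_pos (by linarith)]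
    simp only [← add_assoc]
    linarith

end IsOrbit

/-- The collision at `q` takes place on the arc. -/
def IsArc (r₂ : ℝ) (q N : Plane) : Prop := ‖q‖ = r₂ ∧ 0 < q 1 ∧ N = r₂⁻¹ • q

/-- The collision at `q` takes place on the line of the ledges, with their normal; the bounds on
`q 0` are not needed and not recorded. -/
def IsLedge (q N : Plane) : Prop := q 1 = 0 ∧ N = !₂[0, -1]

lemma OuterNormal.arc_or_ledge_or_stalk {r₁ r₂ t : ℝ} (ht : 0 < t) (hr₁ : 0 < r₁) {q N : Plane}
    (h : OuterNormal r₁ r₂ t q N) : IsArc r₂ q N ∨ IsLedge q N ∨ q ∈ stalk r₁ t := by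
  cases h with
  | arc hp hp' => exact Or.inl ⟨hp, hp', rfl⟩
  | ledge hp h₁ h₂ => exact Or.inr (Or.inl ⟨hp, rfl⟩)
  | right hp h₁ h₂ =>
    exact Or.inr (Or.inr ⟨by linarith, by linarith, by linarith, by linarith⟩)
  | left hp h₁ h₂ =>
    exact Or.inr (Or.inr ⟨by linarith, by linarith, by linarith, by linarith⟩)
  | bottom hp h₁ =>
    rw [abs_lt] at h₁
    exact Or.inr (Or.inr ⟨by linarith, by linarith, by linarith, by linarith⟩)

lemma mirror_south (v : Plane) : mirror !₂[0, -1] v = !₂[v 0, -v 1] := by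
  ext i
  fin_cases i
  · simp [mirror, inner_plane]
  · simp [mirror, inner_plane]; ring

lemma mirror_east (v : Plane) : mirror !₂[1, 0] v = !₂[-v 0, v 1] := by
  ext i
  fin_cases i
  · simp [mirror, inner_plane]; ring
  · simp [mirror, inner_plane]

lemma mirror_west (v : Plane) : mirror !₂[-1, 0] v = !₂[-v 0, v 1] := by
  ext i
  fin_cases i
  · simp [mirror, inner_plane]; ring
  · simp [mirror, inner_plane]

/-- A collision with a ledge preserves the radial component of the velocity. -/
lemma IsLedge.inner_mirror {q N : Plane} (h : IsLedge q N) (v : Plane) :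
    inner ℝ q (mirror N v) = inner ℝ q v := by
  rw [h.2, mirror_south, inner_plane, inner_plane, h.1]
  simp

/-- A collision with the arc reverses the radial component of the velocity. -/
lemma IsArc.inner_mirror {r₂ : ℝ} (hr₂ : 0 < r₂) {q N : Plane} (h : IsArc r₂ q N) (v : Plane) :
    inner ℝ q (mirror N v) = -inner ℝ q v := by
  have hN : ‖N‖ = 1 := by
    rw [h.2.2, norm_smul, h.1, norm_inv, Real.norm_eq_abs, abs_of_pos hr₂, inv_mul_cancel₀ hr₂.ne']
  have e : q = r₂ • N := by rw [h.2.2, smul_smul, mul_inv_cancel₀ hr₂.ne', one_smul]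
  rw [e, real_inner_smul_left, real_inner_smul_left, real_inner_comm, Mushroom.inner_mirror hN,
    real_inner_comm]
  ring

lemma IsArc.inner_pos {r₂ : ℝ} (hr₂ : 0 < r₂) {q N v : Plane} (h : IsArc r₂ q N)
    (hv : 0 < inner ℝ v N) : 0 < inner ℝ q v := by
  have e : q = r₂ • N := by rw [h.2.2, smul_smul, mul_inv_cancel₀ hr₂.ne', one_smul]
  rw [e, real_inner_smul_left, real_inner_comm]
  positivity

lemma disc_eq_at (r : ℝ) (z : Line) (u : ℝ) :
    disc r z = (inner ℝ (z.at u) z.2) ^ 2 - ‖z.2‖ ^ 2 * (‖z.at u‖ ^ 2 - r ^ 2) := by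
  rw [inner_at, norm_sq_at]
  unfold disc
  ring

lemma inner_at_sub (z : Line) (u w : ℝ) :
    inner ℝ (z.at u) z.2 = inner ℝ (z.at w) z.2 + (u - w) * ‖z.2‖ ^ 2 := by
  rw [inner_at, inner_at]; ring

/-- Points of the arc have distance at least `r₂ - r₁` from the stalk. -/
lemma sub_le_norm_sub_of_stalk {r₁ r₂ t : ℝ} {q p : Plane} (hq : ‖q‖ = r₂)
    (hq1 : 0 < q 1) (hp : p ∈ stalk r₁ t) : r₂ - r₁ ≤ ‖p - q‖ := by
  obtain ⟨h1, h2, -, h4⟩ := hp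
  have e : ‖q‖ ≤ ‖(!₂[q 0 - p 0, q 1] : Plane)‖ + ‖(!₂[p 0, 0] : Plane)‖ := by
    have : q = !₂[q 0 - p 0, q 1] + !₂[p 0, 0] := by
      ext i; fin_cases i <;> simp
    calc ‖q‖ = ‖(!₂[q 0 - p 0, q 1] : Plane) + !₂[p 0, 0]‖ := by rw [← this]
      _ ≤ _ := norm_add_le _ _
  have e2 : ‖(!₂[p 0, 0] : Plane)‖ ≤ r₁ := by
    rw [← abs_of_nonneg (norm_nonneg _), ← abs_of_nonneg (by linarith : 0 ≤ r₁), ← sq_le_sq,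
      norm_sq_plane]
    simpa using sq_le_sq' h1 h2
  have e3 : ‖(!₂[q 0 - p 0, q 1] : Plane)‖ ≤ ‖p - q‖ := by
    rw [← sq_le_sq₀ (norm_nonneg _) (norm_nonneg _), norm_sq_plane, norm_sq_plane]
    simp
    nlinarith
  linarith

namespace IsOrbit

variable {r₁ r₂ t : ℝ} {l : ℕ → Line} {s : ℕ → ℝ} {N : ℕ → Plane}

/-- Two consecutive collisions cannot both take place on the ledges. -/
lemma not_ledge_ledge (h : IsOrbit r₁ r₂ t l s N) (n : ℕ)
    (h1 : IsLedge ((l n).at (s (n + 1))) (N n))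
    (h2 : IsLedge ((l (n + 1)).at (s (n + 1 + 1))) (N (n + 1))) : False := by
  have a := h.hits n
  have b := h.hits (n + 1)
  rw [h.snd_succ, h1.2, h2.2, mirror_south, inner_plane] at b
  rw [h1.2, inner_plane] at a
  simp at a b
  linarith

lemma disc_succ (h : IsOrbit r₁ r₂ t l s N) (hr₂ : 0 < r₂) (n : ℕ)
    (hn : IsArc r₂ ((l n).at (s (n + 1))) (N n) ∨ IsLedge ((l n).at (s (n + 1))) (N n)) :
    disc r₂ (l (n + 1)) = disc r₂ (l n) := by
  rw [disc_eq_at r₂ (l (n + 1)) (s (n + 1)), disc_eq_at r₂ (l n) (s (n + 1)), h.at_succ,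
    h.norm_snd hr₂ (n + 1), h.norm_snd hr₂ n, h.snd_succ]
  rcases hn with hn | hn
  · rw [hn.inner_mirror hr₂]; ring
  · rw [hn.inner_mirror]

/-- Collisions with the arc do not accumulate: as long as the orbit stays away from the stalk, the
time between two of them is determined by the conserved quantity `disc`. -/
lemma eventually_not_arc (h : IsOrbit r₁ r₂ t l s N) (hr₁ : 0 < r₁) (hr : r₁ < r₂) (ht : 0 < t)
    (hv : (l 0).2 ≠ 0) (hs : ∀ δ > 0, ∃ n₀, ∀ n ≥ n₀, ∀ k, s (n + k) - s n < δ) :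
    ∃ n₀, ∀ n ≥ n₀, ¬IsArc r₂ ((l n).at (s (n + 1))) (N n) := by
  have hr₂ : 0 < r₂ := hr₁.trans hr
  by_contra! hfreq
  have hV : 0 < ‖(l 0).2‖ := norm_pos_iff.2 hv
  obtain ⟨n₀, hn₀⟩ := hs ((r₂ - r₁) / ‖(l 0).2‖) (div_pos (by linarith) hV)
  obtain ⟨n₁, hn₁, harc⟩ := hfreq n₀
  have hkind : ∀ n ≥ n₁, IsArc r₂ ((l n).at (s (n + 1))) (N n) ∨
      IsLedge ((l n).at (s (n + 1))) (N n) := by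
    intro n hn
    rcases (h.normal n).arc_or_ledge_or_stalk ht hr₁ with hk | hk | hk
    · exact Or.inl hk
    · exact Or.inr hk
    · exfalso
      obtain ⟨k, rfl⟩ := Nat.exists_eq_add_of_le hn
      have e1 := sub_le_norm_sub_of_stalk harc.1 harc.2.1 hk
      have e2 := h.norm_at_sub_le hr₂ n₁ k
      have e3 := hn₀ (n₁ + 1) (by omega) k
      rw [lt_div_iff₀ hV, show n₁ + 1 + k = n₁ + k + 1 by omega] at e3
      linarith
  have hdisc : ∀ k, disc r₂ (l (n₁ + k)) = disc r₂ (l n₁) := by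
    intro k
    induction k with
    | zero => rfl
    | succ k ih => rw [← ih]; exact h.disc_succ hr₂ (n₁ + k) (hkind _ (by omega))
  -- `β` is the radial speed at every collision with the arc
  have hβ : ∀ n ≥ n₁, IsArc r₂ ((l n).at (s (n + 1))) (N n) →
      inner ℝ ((l n).at (s (n + 1))) (l n).2 = √(disc r₂ (l n₁)) := by
    intro n hn ha
    obtain ⟨k, rfl⟩ := Nat.exists_eq_add_of_le hn
    rw [← hdisc k, disc_eq_of_norm_at ha.1, Real.sqrt_sq (ha.inner_pos hr₂ (h.hits _)).le]
  have hβ0 : 0 < √(disc r₂ (l n₁)) := by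
    rw [← hβ n₁ le_rfl harc]; exact harc.inner_pos hr₂ (h.hits _)
  set β := √(disc r₂ (l n₁))
  obtain ⟨n₂, hn₂⟩ := hs (β / ‖(l 0).2‖ ^ 2) (by positivity)
  obtain ⟨m, hm, hmarc⟩ := hfreq (max n₁ n₂)
  have hm1 : n₁ ≤ m := (le_max_left _ _).trans hm
  have hm2 : n₂ ≤ m := (le_max_right _ _).trans hm
  -- after this collision the radial component stays negative
  have hrad : ∀ k, inner ℝ ((l (m + 1 + k)).at (s (m + 1 + k))) (l (m + 1 + k)).2 =
      -β + (s (m + 1 + k) - s (m + 1)) * ‖(l 0).2‖ ^ 2 ∧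
      IsLedge ((l (m + 1 + k)).at (s (m + 1 + k + 1))) (N (m + 1 + k)) := by
    have ledge : ∀ k, inner ℝ ((l (m + 1 + k)).at (s (m + 1 + k))) (l (m + 1 + k)).2 =
        -β + (s (m + 1 + k) - s (m + 1)) * ‖(l 0).2‖ ^ 2 →
        inner ℝ ((l (m + 1 + k)).at (s (m + 1 + k + 1))) (l (m + 1 + k)).2 =
          -β + (s (m + 1 + k + 1) - s (m + 1)) * ‖(l 0).2‖ ^ 2 ∧
        IsLedge ((l (m + 1 + k)).at (s (m + 1 + k + 1))) (N (m + 1 + k)) := by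
      intro k hk
      have e : inner ℝ ((l (m + 1 + k)).at (s (m + 1 + k + 1))) (l (m + 1 + k)).2 =
          -β + (s (m + 1 + k + 1) - s (m + 1)) * ‖(l 0).2‖ ^ 2 := by
        rw [inner_at_sub _ _ (s (m + 1 + k)), hk, h.norm_snd hr₂ (m + 1 + k)]
        ring
      refine ⟨e, (hkind (m + 1 + k) (by omega)).resolve_left fun ha => ?_⟩
      rw [hβ _ (by omega) ha] at e
      have := hn₂ (m + 1) (by omega) (k + 1)
      rw [lt_div_iff₀ (by positivity), show m + 1 + (k + 1) = m + 1 + k + 1 by omega] at this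
      linarith
    have base : ∀ k, inner ℝ ((l (m + 1 + k)).at (s (m + 1 + k))) (l (m + 1 + k)).2 =
        -β + (s (m + 1 + k) - s (m + 1)) * ‖(l 0).2‖ ^ 2 := by
      intro k
      induction k with
      | zero =>
        simp only [add_zero, sub_self, zero_mul]
        rw [h.at_succ, h.snd_succ, hmarc.inner_mirror hr₂, hβ m hm1 hmarc]
      | succ k ih =>
        obtain ⟨e, hl⟩ := ledge k ih
        rw [show m + 1 + (k + 1) = m + 1 + k + 1 by omega, h.at_succ, h.snd_succ, hl.inner_mirror, e]
    exact fun k => ⟨base k, (ledge k (base k)).2⟩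
  exact h.not_ledge_ledge (m + 1) (hrad 0).2 (hrad 1).2

/-- The collision times of an orbit do not accumulate. -/
lemma tendsto_atTop (h : IsOrbit r₁ r₂ t l s N) (hr₁ : 0 < r₁) (hr : r₁ < r₂) (ht : 0 < t)
    (hv : (l 0).2 ≠ 0) : Tendsto s atTop atTop := by
  have hr₂ : 0 < r₂ := hr₁.trans hr
  rcases tendsto_atTop_of_monotone h.strictMono.monotone with htop | ⟨T, hT⟩
  · exact htop
  exfalso
  have hV : 0 < ‖(l 0).2‖ := norm_pos_iff.2 hv
  have hsT : ∀ n, s n ≤ T := h.strictMono.monotone.ge_of_tendsto hT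
  have hs : ∀ δ > 0, ∃ n₀, ∀ n ≥ n₀, ∀ k, s (n + k) - s n < δ := by
    intro δ hδ
    obtain ⟨n₀, hn₀⟩ := eventually_atTop.1 (hT.eventually (lt_mem_nhds (by linarith : T - δ < T)))
    exact ⟨n₀, fun n hn k => by linarith [hn₀ n hn, hsT (n + k)]⟩
  obtain ⟨n₀, hn₀⟩ := h.eventually_not_arc hr₁ hr ht hv hs
  -- horizontal walls: after one such collision the vertical velocity stays positive
  have hup : ∀ n ≥ n₀, 0 < (l n).2 1 → 0 < (l (n + 1)).2 1 := by
    intro n hn hpos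
    have hN := h.normal n
    have hhit := h.hits n
    have hna := hn₀ n hn
    rw [h.snd_succ]
    generalize (l n).at (s (n + 1)) = q at *
    generalize N n = M at *
    cases hN with
    | arc hp hp' => exact absurd ⟨hp, hp', rfl⟩ hna
    | ledge => rw [inner_plane] at hhit; simp at hhit; linarith
    | right => rw [mirror_east]; simpa using hpos
    | left => rw [mirror_west]; simpa using hpos
    | bottom => rw [inner_plane] at hhit; simp at hhit; linarith
  have hside : ∃ n₁ ≥ n₀, ∀ n ≥ n₁, N n = !₂[1, 0] ∨ N n = !₂[-1, 0] := by
    by_contra! hcon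
    obtain ⟨n₁, hn₁, hx⟩ := hcon n₀ le_rfl
    have hflip : ∀ n ≥ n₀, ¬(N n = !₂[1, 0] ∨ N n = !₂[-1, 0]) →
        (l n).2 1 < 0 ∧ 0 < (l (n + 1)).2 1 := by
      intro n hn hnot
      have hN := h.normal n
      have hhit := h.hits n
      have hna := hn₀ n hn
      rw [h.snd_succ]
      generalize (l n).at (s (n + 1)) = q at *
      generalize N n = M at *
      cases hN with
      | arc hp hp' => exact absurd ⟨hp, hp', rfl⟩ hna
      | ledge =>
        rw [inner_plane] at hhit; simp at hhit
        rw [mirror_south]; simpa using hhit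
      | right => exact absurd (Or.inl rfl) hnot
      | left => exact absurd (Or.inr rfl) hnot
      | bottom =>
        rw [inner_plane] at hhit; simp at hhit
        rw [mirror_south]; simpa using hhit
    have h1 := (hflip n₁ hn₁ (by simpa using hx)).2
    have hall : ∀ k, 0 < (l (n₁ + 1 + k)).2 1 := by
      intro k
      induction k with
      | zero => exact h1
      | succ k ih => exact hup (n₁ + 1 + k) (by omega) ih
    obtain ⟨n₂, hn₂, hx₂⟩ := hcon (n₁ + 1) (by omega)
    obtain ⟨k, rfl⟩ := Nat.exists_eq_add_of_le hn₂
    have h2 := (hflip (n₁ + 1 + k) (by omega) (by simpa using hx₂)).1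
    linarith [hall k]
  -- vertical walls: consecutive collisions take place on opposite sides of the stalk
  obtain ⟨n₁, -, hn₁⟩ := hside
  obtain ⟨n₂, hn₂⟩ := hs (2 * r₁ / ‖(l 0).2‖) (by positivity)
  set n := max n₁ n₂
  have ha := hn₁ n (le_max_left _ _)
  have hb := hn₁ (n + 1) (by have := le_max_left n₁ n₂; omega)
  have hgap := hn₂ (n + 1) (by have := le_max_right n₁ n₂; omega) 1
  rw [lt_div_iff₀ hV] at hgap
  have hd := h.norm_at_sub_le hr₂ n 1
  have hd0 := (abs_coord_le_norm _ 0).trans hd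
  simp only [PiLp.sub_apply] at hd0
  have qe : ∀ {q : Plane}, OuterNormal r₁ r₂ t q !₂[1, 0] → q 0 = r₁ := by
    intro q hq
    generalize hM : (!₂[1, 0] : Plane) = M at hq
    have m0 : M 0 = 1 := by rw [← hM]; rfl
    have m1 : M 1 = 0 := by rw [← hM]; rfl
    cases hq with
    | arc hp hp' =>
      simp only [PiLp.smul_apply, smul_eq_mul] at m1
      rcases mul_eq_zero.1 m1 with h | h
      · exact absurd h (by positivity)
      · linarith
    | ledge => simp at m0
    | right hp => exact hp
    | left => norm_num at m0
    | bottom => simp at m0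
  have qw : ∀ {q : Plane}, OuterNormal r₁ r₂ t q !₂[-1, 0] → q 0 = -r₁ := by
    intro q hq
    generalize hM : (!₂[-1, 0] : Plane) = M at hq
    have m0 : M 0 = -1 := by rw [← hM]; rfl
    have m1 : M 1 = 0 := by rw [← hM]; rfl
    cases hq with
    | arc hp hp' =>
      simp only [PiLp.smul_apply, smul_eq_mul] at m1
      rcases mul_eq_zero.1 m1 with h | h
      · exact absurd h (by positivity)
      · linarith
    | ledge => simp at m0
    | right => norm_num at m0
    | left hp => exact hp
    | bottom => simp at m0
  have Ha := h.normal n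
  have Hb := h.normal (n + 1)
  have ia := h.hits n
  have ib := h.hits (n + 1)
  rw [h.snd_succ] at ib
  rcases ha with ha | ha <;> rcases hb with hb | hb <;> rw [ha] at Ha ia ib <;>
    rw [hb] at Hb ib
  · rw [mirror_east, inner_plane] at ib
    rw [inner_plane] at ia
    simp at ia ib; linarith
  · rw [qe Ha, qw Hb] at hd0
    have := neg_le_abs (-r₁ - r₁)
    linarith
  · rw [qw Ha, qe Hb] at hd0
    have := le_abs_self (r₁ - -r₁)
    linarith
  · rw [mirror_west, inner_plane] at ib
    rw [inner_plane] at ia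
    simp at ia ib; linarith

end IsOrbit

/-! ### Two-sided trajectories -/

/-- A bi-infinite sequence of lines that match at successive times is traced by one path. -/
lemma exists_glued_path {L : ℤ → Line} {τ : ℤ → ℝ} (hτ : StrictMono τ)
    (htop : Tendsto τ atTop atTop) (hbot : Tendsto τ atBot atBot)
    (hmatch : ∀ n, (L n).at (2 * τ (n + 1)) = (L (n + 1)).at (2 * τ (n + 1))) :
    ∃ x : ℝ → Plane, ∀ n, ∀ u ∈ Icc (τ n) (τ (n + 1)), x u = (L n).at (2 * u) := by
  have hex : ∀ u : ℝ, ∃ n : ℤ, τ n ≤ u ∧ ∀ m, τ m ≤ u → m ≤ n := by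
    intro u
    obtain ⟨b, hb⟩ := (htop.eventually_gt_atTop u).exists
    obtain ⟨a, ha⟩ := (hbot.eventually_le_atBot u).exists
    exact Int.exists_greatest_of_bdd
      ⟨b, fun m hm => (hτ.lt_iff_lt.1 (hm.trans_lt hb)).le⟩ ⟨a, ha⟩
  choose idx h1 h2 using hex
  refine ⟨fun u => (L (idx u)).at (2 * u), fun n u hu => ?_⟩
  have hn : n ≤ idx u := h2 u n hu.1
  have hn' : idx u ≤ n + 1 := hτ.le_iff_le.1 ((h1 u).trans hu.2)
  rcases hn.eq_or_lt with h | h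
  · simp only [← h]
  · have e : idx u = n + 1 := by omega
    have hu' : u = τ (n + 1) := le_antisymm hu.2 (by rw [← e]; exact h1 u)
    simp only [e]
    rw [hu', hmatch]

/-- Forward and backward orbits of a phase point in the interior fit together to a complete
trajectory. -/
lemma mem_flowDomain {r₁ r₂ t : ℝ} (hr₁ : 0 < r₁) (hr : r₁ < r₂) (ht : 0 < t) {x : Plane}
    {ω : Dir} (hx : x ∈ room r₁ r₂ t) (h₁ : (x, (ω : Plane)) ∉ exceptionalLines r₁ r₂ t)
    (h₂ : (x, -(ω : Plane)) ∉ exceptionalLines r₁ r₂ t) : (x, ω) ∈ flowDomain r₁ r₂ t := by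
  have hr₂ : 0 < r₂ := hr₁.trans hr
  have hlive : ∀ v : Plane, Live r₁ r₂ t (x, v) 0 := by
    intro v
    have : Tendsto (Line.at (x, v)) (𝓝[>] 0) (𝓝 x) := by
      have h := ((continuous_at (x, v)).tendsto 0).mono_left (nhdsWithin_le_nhds (s := Ioi 0))
      simpa [Line.at] using h
    exact this.eventually ((isOpen_room r₁ r₂ t).mem_nhds hx)
  obtain ⟨l, s, N, ho, hl0, hs0⟩ := exists_isOrbit hr₁ hr ht h₁ (hlive _)
  obtain ⟨l', s', N', ho', hl0', hs0'⟩ := exists_isOrbit hr₁ hr ht h₂ (hlive _)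
  have hnorm : ∀ n, ‖(l n).2‖ = 1 := fun n => by rw [ho.norm_snd hr₂, hl0]; simp
  have hnorm' : ∀ n, ‖(l' n).2‖ = 1 := fun n => by rw [ho'.norm_snd hr₂, hl0']; simp
  have htop := ho.tendsto_atTop hr₁ hr ht (by rw [← norm_ne_zero_iff, hnorm]; norm_num)
  have htop' := ho'.tendsto_atTop hr₁ hr ht (by rw [← norm_ne_zero_iff, hnorm']; norm_num)
  have hl00 : l 0 = (l' 0).reverse := by rw [hl0, hl0']; simp [Line.reverse]
  -- legs `0, 1, 2, …` come from the forward orbit, legs `0, -1, -2, …` from the backward orbit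
  let L : ℤ → Line := fun n => if 0 ≤ n then l n.toNat else (l' (-n).toNat).reverse
  let τ : ℤ → ℝ := fun n => if 0 < n then s n.toNat / 2 else -(s' ((-n).toNat + 1) / 2)
  have L1 : ∀ k : ℕ, L k = l k := fun k => by simp [L]
  have L2 : ∀ k : ℕ, L (-(k : ℤ)) = (l' k).reverse := by
    intro k
    rcases k with _ | k
    · simp [L, hl00]
    · have : ¬(0 ≤ -((k + 1 : ℕ) : ℤ)) := by omega
      simp only [L, this, if_false, neg_neg, Int.toNat_natCast]
  have τ1 : ∀ k : ℕ, τ ((k : ℤ) + 1) = s (k + 1) / 2 := by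
    intro k
    have h1 : (0 : ℤ) < (k : ℤ) + 1 := by omega
    have h2 : ((k : ℤ) + 1).toNat = k + 1 := by omega
    simp only [τ, h1, if_true, h2]
  have τ2 : ∀ k : ℕ, τ (-(k : ℤ)) = -(s' (k + 1) / 2) := by
    intro k
    have h1 : ¬((0 : ℤ) < -(k : ℤ)) := by omega
    simp only [τ, h1, if_false, neg_neg, Int.toNat_natCast]
  have hcases : ∀ n : ℤ, (∃ k : ℕ, n = k) ∨ ∃ k : ℕ, n = -((k : ℤ) + 1) := by
    intro n
    rcases le_or_gt 0 n with h | h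
    · exact Or.inl ⟨n.toNat, by omega⟩
    · exact Or.inr ⟨(-n - 1).toNat, by omega⟩
  have hspos : ∀ k, 0 < s (k + 1) := fun k => by
    rw [← hs0]; exact ho.strictMono (Nat.succ_pos k)
  have hspos' : ∀ k, 0 < s' (k + 1) := fun k => by
    rw [← hs0']; exact ho'.strictMono (Nat.succ_pos k)
  have e2 : ∀ k : ℕ, -((k : ℤ) + 1) + 1 = -(k : ℤ) := fun k => by ring
  have e3 : ∀ k : ℕ, -((k : ℤ) + 1) = -((k + 1 : ℕ) : ℤ) := fun k => by push_cast; ring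
  have τ0 : τ 0 = -(s' 1 / 2) := by simpa using τ2 0
  have hτ : StrictMono τ := by
    refine strictMono_int_of_lt_succ fun n => ?_
    rcases hcases n with ⟨k, rfl⟩ | ⟨k, rfl⟩
    · rw [τ1]
      rcases k with _ | k
      · have := hspos 0; have := hspos' 0
        simp only [Nat.cast_zero, τ0]
        simp only [zero_add] at *
        linarith
      · have := ho.lt (k + 1)
        push_cast
        rw [τ1]; linarith
    · rw [e2, e3, τ2, τ2]
      have := ho'.lt (k + 1)
      linarith
  have hτtop : Tendsto τ atTop atTop := by
    refine tendsto_atTop_atTop_of_monotone hτ.monotone fun b => ?_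
    obtain ⟨k, hk⟩ := ((tendsto_add_atTop_iff_nat 1).2 htop |>.eventually_ge_atTop (2 * b)).exists
    exact ⟨(k : ℤ) + 1, by rw [τ1]; linarith⟩
  have hτbot : Tendsto τ atBot atBot := by
    refine tendsto_atBot_atBot_of_monotone hτ.monotone fun b => ?_
    obtain ⟨k, hk⟩ :=
      ((tendsto_add_atTop_iff_nat 1).2 htop' |>.eventually_ge_atTop (-(2 * b))).exists
    exact ⟨-(k : ℤ), by rw [τ2]; linarith⟩
  have hmatch : ∀ n, (L n).at (2 * τ (n + 1)) = (L (n + 1)).at (2 * τ (n + 1)) := by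
    intro n
    rcases hcases n with ⟨k, rfl⟩ | ⟨k, rfl⟩
    · have : L ((k : ℤ) + 1) = l (k + 1) := by exact_mod_cast L1 (k + 1)
      rw [τ1, L1, this, mul_div_cancel₀ _ (two_ne_zero), ho.at_succ]
    · rw [e2, e3, L2, L2, τ2, Line.reverse_at, Line.reverse_at]
      have : -(2 * -(s' (k + 1) / 2)) = s' (k + 1) := by ring
      rw [this, ho'.at_succ]
  obtain ⟨y, hy⟩ := exists_glued_path hτ hτtop hτbot hmatch
  have hLn : ∀ n, ‖(L n).2‖ = 1 := by
    intro n
    rcases hcases n with ⟨k, rfl⟩ | ⟨k, rfl⟩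
    · rw [L1, hnorm]
    · rw [e3, L2]; simp only [Line.reverse, norm_neg, hnorm']
  let Ω : ℤ → Dir := fun n => ⟨(L n).2, by rw [mem_sphere_zero_iff_norm, hLn]⟩
  have hlr : ∀ n : ℤ, τ n ≤ τ (n + 1) := fun n => (hτ (by omega)).le
  have hend : ∀ n : ℤ, y (τ (n + 1)) = (L n).at (2 * τ (n + 1)) := fun n =>
    hy n _ (right_mem_Icc.2 (hlr n))
  refine ⟨y, τ, Ω, ⟨hτ, hτtop, hτbot, ?_, ?_, ?_⟩, ?_, 0, ?_, ?_⟩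
  · intro n u hu
    rw [hy n u hu, hy n (τ n) (left_mem_Icc.2 (hlr n))]
    simp only [Line.at, Ω]
    module
  · intro n u hu
    rw [hy n u (Ioo_subset_Icc_self hu)]
    refine interior_maximal (room_subset_mushroom r₁ r₂ t) (isOpen_room r₁ r₂ t) ?_
    have hneg : ∀ k : ℕ, -(s' (k + 1)) < 2 * u → 2 * u < -s' k → (l' k).reverse.at (2 * u) ∈
        room r₁ r₂ t := by
      intro k h1 h2
      rw [Line.reverse_at]
      exact ho'.room k _ ⟨by linarith, by linarith⟩
    rcases hcases n with ⟨k, rfl⟩ | ⟨k, rfl⟩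
    · rw [τ1] at hu
      rw [L1]
      rcases k with _ | k
      · simp only [Nat.cast_zero, τ0] at hu
        rcases lt_trichotomy u 0 with h0 | h0 | h0
        · rw [hl00]
          exact hneg 0 (by simp only [zero_add]; linarith [hu.1]) (by rw [hs0']; linarith)
        · rw [h0, hl0]; simpa [Line.at] using hx
        · exact ho.room 0 _ ⟨by rw [hs0]; linarith, by linarith [hu.2]⟩
      · push_cast at hu
        rw [τ1] at hu
        exact ho.room (k + 1) _ ⟨by linarith [hu.1], by linarith [hu.2]⟩
    · rw [e2, e3, τ2, τ2] at hu
      rw [e3, L2]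
      exact hneg (k + 1) (by linarith [hu.1]) (by linarith [hu.2])
  · intro n
    rw [hend]
    rcases hcases n with ⟨k, rfl⟩ | ⟨k, rfl⟩
    · have : L ((k : ℤ) + 1) = l (k + 1) := by exact_mod_cast L1 (k + 1)
      simp only [Ω, this, L1, τ1]
      rw [mul_div_cancel₀ _ (two_ne_zero)]
      exact ⟨N k, ho.normal k, ho.hits k, ho.snd_succ k⟩
    · have hN := ho'.normal k
      have hN1 := hN.norm_eq_one hr₂
      have hin : inner ℝ (-(l' (k + 1)).2) (N' k) = inner ℝ (l' k).2 (N' k) := by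
        rw [ho'.snd_succ, inner_neg_left, inner_mirror hN1, neg_neg]
      have : -(2 * -(s' (k + 1) / 2)) = s' (k + 1) := by ring
      have a1 : L (-((k : ℤ) + 1)) = (l' (k + 1)).reverse := by rw [e3, L2]
      have a2 : L (-((k : ℤ) + 1) + 1) = (l' k).reverse := by rw [e2, L2]
      have a3 : τ (-((k : ℤ) + 1) + 1) = -(s' (k + 1) / 2) := by rw [e2, τ2]
      simp only [Ω, a1, a2, a3, Line.reverse_at, this]
      rw [ho'.at_succ]
      refine ⟨N' k, hN, ?_, ?_⟩
      · simp only [Line.reverse]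
        rw [hin]; exact ho'.hits k
      · simp only [Line.reverse]
        change _ = mirror (N' k) (-(l' (k + 1)).2)
        rw [ho'.snd_succ, mirror_neg, mirror_mirror hN1]
  · have h0 : (0 : ℝ) ∈ Icc (τ 0) (τ (0 + 1)) := by
      have := hspos 0; have := hspos' 0
      have h1 := τ1 0
      simp only [Nat.cast_zero, zero_add] at *
      rw [h1, τ0]
      exact ⟨by linarith, by linarith⟩
    rw [hy 0 0 h0]
    have := L1 0
    simp only [Nat.cast_zero] at this
    rw [this, hl0]; simp [Line.at]
  · have := hspos 0; have := hspos' 0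
    have h1 := τ1 0
    simp only [Nat.cast_zero, zero_add] at *
    rw [h1, τ0]
    exact ⟨by linarith, by linarith⟩
  · have := L1 0
    simp only [Nat.cast_zero] at this
    ext1
    simp only [Ω, this, hl0]

/-! ### Trajectories outside the ergodic region -/

lemma norm_sq_eq_inner_add_cross (p : Plane) (ω : Dir) :
    ‖p‖ ^ 2 = inner ℝ p (ω : Plane) ^ 2 + cross p ω ^ 2 := by
  rw [norm_sq_plane, inner_plane]
  unfold cross
  linear_combination -(p 0 ^ 2 + p 1 ^ 2) * norm_sq_dir ω

/-- A trajectory avoiding the stalk and the disk of radius `r₁` has angular momentum at least `r₁`: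
otherwise its radial velocity could never vanish, while it can only jump from positive to negative
values, and grows linearly in between. -/
lemma le_abs_cross_of_avoids {r₁ r₂ t : ℝ} (hr₁ : 0 < r₁) (hr : r₁ < r₂) (ht : 0 < t)
    {x : ℝ → Plane} {τ : ℤ → ℝ} {ω : ℤ → Dir} (h : IsTrajectory r₁ r₂ t x τ ω) {z : Plane × Dir}
    (hz : StartsAt x τ ω z) (hav : ∀ s, x s ∉ stalk r₁ t ∪ Metric.closedBall 0 r₁) :
    r₁ ≤ |cross z.1 z.2| := by
  have hr₂ : 0 < r₂ := hr₁.trans hr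
  set a : ℤ → ℝ := fun n => inner ℝ (x (τ n)) (ω n : Plane) with ha
  set c : ℤ → ℝ := fun n => inner ℝ (x (τ (n + 1))) (ω n : Plane) with hc
  set C : ℤ → ℝ := fun n => cross (x (τ n)) (ω n) ^ 2 with hC
  have hω : ∀ n, inner ℝ (ω n : Plane) (ω n : Plane) = (1 : ℝ) := fun n => by
    rw [real_inner_self_eq_norm_sq]; simp
  have hlt : ∀ n, τ n < τ (n + 1) := fun n => h.strictMono (by omega)
  have hrad : ∀ n, ∀ u ∈ Icc (τ n) (τ (n + 1)),
      inner ℝ (x u) (ω n : Plane) = a n + 2 * (u - τ n) := by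
    intro n u hu
    rw [h.free n u hu, inner_add_left, real_inner_smul_left, hω, mul_one]
  have hcross : ∀ n, ∀ u ∈ Icc (τ n) (τ (n + 1)), cross (x u) (ω n) ^ 2 = C n := by
    intro n u hu
    rw [h.free n u hu]
    simp only [hC, cross, PiLp.add_apply, PiLp.smul_apply, smul_eq_mul]
    ring
  have hca : ∀ n, c n = a n + 2 * (τ (n + 1) - τ n) := fun n =>
    hrad n _ (right_mem_Icc.2 (hlt n).le)
  have hrefl : ∀ n, a (n + 1) = c n ∨ (0 < c n ∧ a (n + 1) = -c n) := by
    intro n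
    obtain ⟨N, hN, hpos, heq⟩ := h.reflect n
    have heq' : (ω (n + 1) : Plane) = mirror N (ω n) := heq
    rcases hN.arc_or_ledge_or_stalk ht hr₁ with hk | hk | hk
    · right
      simp only [ha, hc]
      rw [heq', hk.inner_mirror hr₂]
      exact ⟨hk.inner_pos hr₂ hpos, rfl⟩
    · left
      simp only [ha, hc]
      rw [heq', hk.inner_mirror]
    · exact absurd (Or.inl hk) (hav _)
  have hCsucc : ∀ n, C (n + 1) = C n := by
    intro n
    have e1 := norm_sq_eq_inner_add_cross (x (τ (n + 1))) (ω n)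
    have e2 := norm_sq_eq_inner_add_cross (x (τ (n + 1))) (ω (n + 1))
    rw [hcross n _ (right_mem_Icc.2 (hlt n).le)] at e1
    have e3 : a (n + 1) ^ 2 = c n ^ 2 := by
      rcases hrefl n with h | h
      · rw [h]
      · rw [h.2]; ring
    simp only [ha, hc, hC] at *
    linarith
  have hCconst : ∀ n, C n = C 0 := by
    intro n
    induction n using Int.induction_on with
    | zero => rfl
    | succ k ih => rw [hCsucc, ih]
    | pred k ih =>
      rw [← ih, ← hCsucc (-(k : ℤ) - 1)]
      congr 1; ring
  obtain ⟨hz1, n₀, hn₀, hz2⟩ := hz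
  have hz3 : cross z.1 z.2 ^ 2 = C 0 := by
    rw [← hz1, ← hz2, hcross n₀ 0 hn₀, hCconst]
  by_contra! hcon
  have hC0 : C 0 < r₁ ^ 2 := by
    rw [← hz3, ← sq_abs]
    gcongr
  have hne : ∀ n, ∀ u ∈ Icc (τ n) (τ (n + 1)), a n + 2 * (u - τ n) ≠ 0 := by
    intro n u hu h0
    have e := norm_sq_eq_inner_add_cross (x u) (ω n)
    rw [hrad n u hu, h0, hcross n u hu, hCconst] at e
    have hn : r₁ < ‖x u‖ := by
      by_contra! hle
      exact hav u (Or.inr (by simpa using hle))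
    nlinarith
  have hsign : ∀ n, a n ≤ 0 → c n < 0 := by
    intro n hn
    by_contra! hcn
    rw [hca] at hcn
    exact hne n (τ n - a n / 2) ⟨by linarith, by linarith⟩ (by ring)
  have ha0 : a 0 ≠ 0 := by
    have := hne 0 (τ 0) (left_mem_Icc.2 (hlt 0).le)
    simpa using this
  rcases lt_or_gt_of_ne ha0 with h0 | h0
  · -- moving inwards now means moving inwards for ever
    have hall : ∀ k : ℕ, a k < 0 ∧ a k = a 0 + 2 * (τ k - τ 0) := by
      intro k
      induction k with
      | zero => simpa using h0
      | succ k ih =>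
        have h1 := hsign k ih.1.le
        have h2 := (hrefl k).resolve_right fun h => by linarith [h.1]
        push_cast
        rw [h2]
        refine ⟨h1, ?_⟩
        rw [hca, ih.2]; ring
    obtain ⟨k, hk⟩ := ((h.tendsto_top.comp tendsto_natCast_atTop_atTop).eventually_gt_atTop
      (τ 0 - a 0 / 2)).exists
    have := hall k
    simp only [Function.comp] at hk
    linarith [this.1, this.2]
  · -- moving outwards now means having always moved outwards
    have hall : ∀ k : ℕ, 0 < a (-(k : ℤ)) ∧ a (-(k : ℤ)) = a 0 + 2 * (τ (-(k : ℤ)) - τ 0) := by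
      intro k
      induction k with
      | zero => simpa using h0
      | succ k ih =>
        have e : -((k + 1 : ℕ) : ℤ) + 1 = -(k : ℤ) := by push_cast; ring
        have h2 := hrefl (-((k + 1 : ℕ) : ℤ))
        have h3 := hca (-((k + 1 : ℕ) : ℤ))
        rw [e] at h2 h3
        have h4 := h2.resolve_right fun h => by linarith [h.1, h.2, ih.1]
        refine ⟨?_, by linarith [ih.2]⟩
        by_contra! hneg
        linarith [hsign _ hneg, ih.1]
    have hneg : Tendsto (fun k : ℕ => -(k : ℤ)) atTop atBot :=
      tendsto_neg_atTop_atBot.comp tendsto_natCast_atTop_atTop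
    obtain ⟨k, hk⟩ := ((h.tendsto_bot.comp hneg).eventually_lt_atBot (τ 0 - a 0 / 2)).exists
    have := hall k
    simp only [Function.comp] at hk
    linarith [this.1, this.2]

lemma flowDomain_diff_ergodicRegion_subset {r₁ r₂ t : ℝ} (hr₁ : 0 < r₁) (hr : r₁ < r₂)
    (ht : 0 < t) :
    mushroom r₁ r₂ t ×ˢ univ ∩ (flowDomain r₁ r₂ t \ ergodicRegion r₁ r₂ t) ⊆
      annularRegion r₁ r₂ := by
  rintro z ⟨⟨hzM, -⟩, ⟨x, τ, ω, hT, hS⟩, hnot⟩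
  have hav : ∀ s, x s ∉ stalk r₁ t ∪ Metric.closedBall 0 r₁ := fun s hs =>
    hnot ⟨x, τ, ω, hT, hS, s, hs⟩
  refine ⟨hzM.resolve_left fun h => hav 0 (Or.inl (by rw [hS.1]; exact h)), ?_⟩
  exact le_abs_cross_of_avoids hr₁ hr ht hT hS hav

/-! ### The billiard flow is defined almost everywhere -/

lemma volume_mushroom_diff_room {r₁ r₂ t : ℝ} (hr₁ : 0 < r₁) (hr : r₁ < r₂) (ht : 0 < t) :
    volume (mushroom r₁ r₂ t \ room r₁ r₂ t) = 0 := by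
  have hr₂ : 0 < r₂ := hr₁.trans hr
  refine measure_mono_null (t := Metric.sphere 0 r₂ ∪ (({p | p 1 = 0} ∪ {p | p 1 = -t}) ∪
    ({p | p 0 = r₁} ∪ {p | p 0 = -r₁}))) ?_ ?_
  · rintro p ⟨hp, hp'⟩
    rcases exists_outerNormal_or_corner hr₁ hr ht hp hp' with ⟨N, hN⟩ | ⟨i, rfl⟩
    · cases hN with
      | arc h _ => left; simpa using h
      | ledge h => right; left; left; exact h
      | right h => right; right; left; exact h
      | left h => right; right; right; exact h
      | bottom h => right; left; right; exact h
    · right; left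
      fin_cases i <;> simp [corner]
  · exact measure_union_null (Measure.addHaar_sphere _ _ _)
      (measure_union_null
        (measure_union_null (volume_coord_eq_zero _ _) (volume_coord_eq_zero _ _))
        (measure_union_null (volume_coord_eq_zero _ _) (volume_coord_eq_zero _ _)))

lemma phaseMeasure_diff_flowDomain {r₁ r₂ t : ℝ} (hr₁ : 0 < r₁) (hr : r₁ < r₂) (ht : 0 < t) :
    phaseMeasure (mushroom r₁ r₂ t ×ˢ univ ∩ (flowDomain r₁ r₂ t)ᶜ) = 0 := by
  have hr₂ : 0 < r₂ := hr₁.trans hr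
  have hexc := negligible_exceptionalLines (r₁ := r₁) (t := t) hr₂
  refine measure_mono_null (t := (mushroom r₁ r₂ t \ room r₁ r₂ t) ×ˢ univ ∪
    ({z : Plane × Dir | (z.1, (z.2 : Plane)) ∈ exceptionalLines r₁ r₂ t} ∪
      {z : Plane × Dir | (z.1, (z.2 : Plane)) ∈
        Line.reverse ⁻¹' exceptionalLines r₁ r₂ t})) ?_ ?_
  · rintro ⟨x, ω⟩ ⟨⟨hx, -⟩, hD⟩
    by_contra hcon
    simp only [mem_union, not_or] at hcon
    refine hD (mem_flowDomain hr₁ hr ht ?_ hcon.2.1 hcon.2.2)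
    by_contra hroom
    exact hcon.1 ⟨⟨hx, hroom⟩, trivial⟩
  · refine measure_union_null ?_ (measure_union_null hexc.phaseMeasure_eq_zero
      hexc.reverse_preimage.phaseMeasure_eq_zero)
    rw [phaseMeasure, Measure.prod_prod, volume_mushroom_diff_room hr₁ hr ht, zero_mul]

/-! ### The Liouville measure of the ergodic region -/

lemma volume_mushroom_ne_top {r₁ r₂ t : ℝ} (hr₁ : 0 < r₁) (hr : r₁ < r₂) (ht : 0 < t) :
    volume (mushroom r₁ r₂ t) ≠ ⊤ := by
  refine ne_top_of_le_ne_top (measure_closedBall_lt_top (x := (0 : Plane)) (r := r₁ + r₂ + t)).ne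
    (measure_mono fun p hp => ?_)
  simpa using norm_le_of_mem_mushroom hr₁ ht (hr₁.trans hr) hp

lemma area_pos {r₁ r₂ t : ℝ} (hr₁ : 0 < r₁) (hr : r₁ < r₂) (ht : 0 < t) : 0 < area r₁ r₂ t := by
  refine ENNReal.toReal_pos ?_ (volume_mushroom_ne_top hr₁ hr ht)
  have hne : (room r₁ r₂ t).Nonempty := by
    refine ⟨0, Or.inr ⟨by simpa using hr₁, by simpa using ht, Or.inr ?_⟩⟩
    simpa using hr₁.trans hr
  exact ((isOpen_room r₁ r₂ t).measure_pos volume hne |>.trans_le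
    (measure_mono (room_subset_mushroom r₁ r₂ t))).ne'

lemma phaseMeasure_mushroom {r₁ r₂ t : ℝ} (hr₁ : 0 < r₁) (hr : r₁ < r₂) (ht : 0 < t) :
    phaseMeasure (mushroom r₁ r₂ t ×ˢ univ) =
      ENNReal.ofReal (area r₁ r₂ t * (2 * Real.pi)) := by
  rw [phaseMeasure, Measure.prod_prod, toSphere_univ, area, ENNReal.ofReal_mul ENNReal.toReal_nonneg,
    ENNReal.ofReal_toReal (volume_mushroom_ne_top hr₁ hr ht)]

lemma liouville_apply {r₁ r₂ t : ℝ} (hr₁ : 0 < r₁) (hr : r₁ < r₂) (ht : 0 < t)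
    (E : Set (Plane × Dir)) :
    liouville r₁ r₂ t E = (ENNReal.ofReal (area r₁ r₂ t * (2 * Real.pi)))⁻¹ *
      phaseMeasure (mushroom r₁ r₂ t ×ˢ univ ∩ E) := by
  rw [← phaseMeasure_mushroom hr₁ hr ht]
  exact ProbabilityTheory.cond_apply ((isClosed_mushroom r₁ r₂ t).measurableSet.prod .univ) _ _

lemma capIntegral_nonneg {c : ℝ} (hc : c ≤ 1) : 0 ≤ capIntegral c :=
  intervalIntegral.integral_nonneg hc fun _ _ => Real.sqrt_nonneg _

lemma liouville_univ {r₁ r₂ t : ℝ} (hr₁ : 0 < r₁) (hr : r₁ < r₂) (ht : 0 < t) :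
    liouville r₁ r₂ t univ = 1 := by
  have hA := area_pos hr₁ hr ht
  have hπ := Real.pi_pos
  rw [liouville_apply hr₁ hr ht, inter_univ, phaseMeasure_mushroom hr₁ hr ht]
  exact ENNReal.inv_mul_cancel (ENNReal.ofReal_pos.2 (by positivity)).ne' ENNReal.ofReal_ne_top

lemma liouville_flowDomain {r₁ r₂ t : ℝ} (hr₁ : 0 < r₁) (hr : r₁ < r₂) (ht : 0 < t) :
    liouville r₁ r₂ t (flowDomain r₁ r₂ t) = 1 := by
  have hc : liouville r₁ r₂ t (flowDomain r₁ r₂ t)ᶜ = 0 := by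
    rw [liouville_apply hr₁ hr ht, phaseMeasure_diff_flowDomain hr₁ hr ht, mul_zero]
  rw [← liouville_univ hr₁ hr ht]
  exact measure_of_measure_compl_eq_zero hc

lemma one_sub_liouville_ergodicRegion_le {r₁ r₂ t : ℝ} (hr₁ : 0 < r₁) (hr : r₁ < r₂)
    (ht : 0 < t) :
    1 - (liouville r₁ r₂ t (ergodicRegion r₁ r₂ t)).toReal ≤
      2 * r₂ ^ 2 * capIntegral (r₁ / r₂) / area r₁ r₂ t := by
  have hr₂ : 0 < r₂ := hr₁.trans hr
  have hA := area_pos hr₁ hr ht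
  have hπ := Real.pi_pos
  have hI : 0 ≤ capIntegral (r₁ / r₂) := capIntegral_nonneg ((div_le_one hr₂).2 hr.le)
  set μ := liouville r₁ r₂ t
  set U := ergodicRegion r₁ r₂ t
  set D := flowDomain r₁ r₂ t
  have hdiff : μ (D \ U) ≤
      ENNReal.ofReal (2 * r₂ ^ 2 * capIntegral (r₁ / r₂) / area r₁ r₂ t) := by
    rw [liouville_apply hr₁ hr ht]
    calc _ ≤ (ENNReal.ofReal (area r₁ r₂ t * (2 * Real.pi)))⁻¹ *
          ENNReal.ofReal (4 * Real.pi * r₂ ^ 2 * capIntegral (r₁ / r₂)) := by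
          gcongr
          exact (measure_mono (flowDomain_diff_ergodicRegion_subset hr₁ hr ht)).trans
            (phaseMeasure_annularRegion_le hr₁ hr)
      _ = _ := by
          rw [← ENNReal.ofReal_inv_of_pos (by positivity), ← ENNReal.ofReal_mul (by positivity)]
          congr 1
          field_simp
          ring
  have h1 : 1 ≤ μ U + μ (D \ U) := by
    rw [← liouville_flowDomain hr₁ hr ht]
    exact (measure_mono (fun z hz => by
      by_cases h : z ∈ U
      · exact Or.inl h
      · exact Or.inr ⟨hz, h⟩)).trans (measure_union_le U (D \ U))
  have hU : μ U ≠ ⊤ := ne_top_of_le_ne_top ENNReal.one_ne_top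
    ((measure_mono (subset_univ U)).trans_eq (liouville_univ hr₁ hr ht))
  have h2 := h1.trans (add_le_add_right hdiff _)
  have h3 := ENNReal.toReal_mono (ENNReal.add_ne_top.2 ⟨hU, ENNReal.ofReal_ne_top⟩) h2
  rw [ENNReal.toReal_add hU ENNReal.ofReal_ne_top, ENNReal.toReal_ofReal (by positivity),
    ENNReal.toReal_one] at h3
  linarith

end Mushroom

theorem proposition3p2p3 (r₁ r₂ t : ℝ) (hr₁ : 0 < r₁) (hr : r₁ < r₂) (ht : 0 < t) :
    (∀ ε : ℝ, 0 < ε → ∀ lam : ℝ, (Mushroom.quasimodeIndices r₁ r₂ ε lam).Finite) ∧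
    ∃ L : ℝ,
      Filter.Tendsto
        (fun ε : ℝ => Filter.liminf
          (fun lam : ℝ =>
            ((((Mushroom.quasimodeIndices r₁ r₂ ε lam).ncard : ℝ) / lam ^ 2 : ℝ) : EReal))
          Filter.atTop)
        (nhdsWithin 0 (Set.Ioi 0)) (nhds (L : EReal)) ∧
      (1 - (Mushroom.liouville r₁ r₂ t (Mushroom.ergodicRegion r₁ r₂ t)).toReal /
          (Mushroom.liouville r₁ r₂ t (Mushroom.flowDomain r₁ r₂ t)).toReal) *
        (Mushroom.area r₁ r₂ t / (4 * Real.pi)) ≤ L := by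
  refine ⟨fun ε _ lam => Mushroom.quasimodeIndices_finite (hr₁.trans hr), ?_⟩
  obtain ⟨L, hL, hle⟩ := Mushroom.exists_tendsto_quasimodeDensity hr₁ hr
  refine ⟨L, hL, le_trans ?_ hle⟩
  rw [Mushroom.liouville_flowDomain hr₁ hr ht, ENNReal.toReal_one, div_one]
  have hA := Mushroom.area_pos hr₁ hr ht
  have hπ := Real.pi_pos
  calc _ ≤ 2 * r₂ ^ 2 * Mushroom.capIntegral (r₁ / r₂) / Mushroom.area r₁ r₂ t *
        (Mushroom.area r₁ r₂ t / (4 * Real.pi)) := by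
        gcongr
        exact Mushroom.one_sub_liouville_ergodicRegion_le hr₁ hr ht
    _ = _ := by
        field_simp
        ring
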